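/- **Theorem.** The rooted conjunctive query entailment problem is $\mathrm{coNExpTime}$-hard (in combined complexity) for the description logic $\mathcal{ALC}\mathsf{Self}$, and hence also for the description logic $\mathcal{ZIQ}$. Here the notions are as follows. Fix countably infinite, pairwise disjoint sets of individual names, concept names, role names and variables. An interpretation $\mathcal I$ has a non-empty domain $\Delta^{\mathcal I}$ and maps individual names $a$ to elements $a^{\mathcal I}$, concept names $A$ to subsets $A^{\mathcal I}$ and role names $r$ to binary relations $r^{\mathcal I}$ of $\Delta^{\mathcal I}$ (distinct individual names may denote the same element). *$\mathcal{ALC}\mathsf{Self}$.* Concepts are given by $C ::= \bot \mid A \mid \neg C \mid C\sqcap C \mid \exists r.C \mid \exists r.\mathsf{Self}$ with $A$ a concept name and $r$ a role name; $d\in(\exists r.C)^{\mathcal I}$ iff $(d,e)\in r^{\mathcal I}$ for some $e\in C^{\mathcal I}$, and $d\in(\exists r.\mathsf{Self})^{\mathcal I}$ iff $(d,d)\in r^{\mathcal I}$. A TBox is a finite set of inclusions $C\sqsubseteq D$ of concepts, with the meaning $C^{\mathcal I}\subseteq D^{\mathcal I}$. *$\mathcal{ZIQ}$.* Simple roles are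 given by $s ::= r \mid s^- \mid s\cap s\mid s\cup s\mid s\setminus s$. Concepts are given by $C ::= \bot\mid A\mid\neg C\mid C\sqcap C\mid \exists s.C\mid ({\ge} n\ s).C\mid\exists s.\mathsf{Self}\mid\exists\mathcal A.C$, where $n\in\mathbb N$, $s$ is a simple role and $\mathcal A$ is a nondeterministic finite automaton whose letters are simple roles and tests $D?$ for concepts $D$; $d\in(({\ge}n\ s).C)^{\mathcal I}$ iff at least $n$ elements $e\in C^{\mathcal I}$ satisfy $(d,e)\in s^{\mathcal I}$, and $d\in(\exists\mathcal A.C)^{\mathcal I}$ iff some path from $d$ to some $e\in C^{\mathcal I}$ (possibly of length $0$) realises a word accepted by $\mathcal A$, where a role letter is read along an $s^{\mathcal I}$-edge and a test $D?$ is read at an element of $D^{\mathcal I}$. A TBox is a finite set of inclusions $C\sqsubseteq D$ of concepts and $s\subseteq t$ of simple roles. In both logics a knowledge base $\mathcal K=(\mathcal A,\mathcal T)$ consists of a TBox $\mathcal T$ and a finite ABox $\mathcal A$ of axioms $A(a)$, $r(a,b)$, $a\approx b$ and negations of such axioms. A conjunctive query is a non-empty finite conjunction of atoms $A(x)$ and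 $r(x,y)$ with $A$ a concept name, $r$ a role name, and $x,y$ variables or individual names; it is *rooted* if at least one individual name occurs in it and its query graph (nodes: the terms that occur in the query; edges: the pairs that occur together in a role atom) is connected. $\mathcal K$ *entails* $q$ if in every model of $\mathcal K$ there is an assignment of the variables that makes $q$ true. The rooted conjunctive query entailment problem for a logic is: given a knowledge base $\mathcal K$ of this logic and a rooted conjunctive query $q$, both being part of the input, does $\mathcal K$ entail $q$? It is $\mathrm{coNExpTime}$-hard if every language over a finite alphabet whose complement is decided by a nondeterministic Turing machine in time $2^{p(n)}$, for some polynomial $p$, is reducible to it by a many-one reduction computable in deterministic polynomial time. -/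

import Mathlib

/-! ### Nondeterministic exponential time -/

/-- A nondeterministic Turing machine with one tape, infinite to the right, over the input
alphabet `α`. It halts in the accepting state and whenever no transition applies; a halting
configuration whose state is not accepting is rejecting. -/
structure NTM (α : Type) where
  /-- states -/
  Q : Type
  /-- tape symbols -/
  Γ : Type
  finQ : Finite Q
  finΓ : Finite Γ
  start : Q
  accept : Q
  blank : Γ
  /-- the inclusion of the input alphabet into the tape alphabet -/
  input : α → Γ
  input_injective : Function.Injective input
  input_ne_blank : ∀ a, input a ≠ blank
  δ : Q → Γ → Set (Q × Γ × Turing.Dir)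

namespace NTM

/-- A configuration: current state, head position, tape content. -/
structure Cfg {α : Type} (M : NTM α) where
  state : M.Q
  head : ℕ
  tape : ℕ → M.Γ

/-- Head movement; a move to the left of the leftmost cell leaves the head where it is. -/
def move : Turing.Dir → ℕ → ℕ
  | Turing.Dir.left, i => i - 1
  | Turing.Dir.right, i => i + 1

/-- The initial configuration: the input at the left end of the tape, blanks after it. -/
def init {α : Type} (M : NTM α) (w : List α) : M.Cfg where
  state := M.start
  head := 0
  tape i := (w[i]?.map M.input).getD M.blank

/-- One step of a computation. -/
def Step {α : Type} (M : NTM α) (c c' : M.Cfg) : Prop :=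
  c.state ≠ M.accept ∧
    ∃ q b d, (q, b, d) ∈ M.δ c.state (c.tape c.head) ∧
      c' = ⟨q, move d c.head, Function.update c.tape c.head b⟩

/-- `M.Reaches n c c'`: some computation of exactly `n` steps leads from `c` to `c'`. -/
def Reaches {α : Type} (M : NTM α) : ℕ → M.Cfg → M.Cfg → Prop
  | 0, c, c' => c = c'
  | n + 1, c, c' => ∃ d, M.Step c d ∧ M.Reaches n d c'

/-- `M` decides `L` in time `t`: on every input `w` every computation has at most `t |w|` steps,
and some computation is accepting exactly if `w ∈ L`. -/
def DecidesInTime {α : Type} (M : NTM α) (L : Language α) (t : ℕ → ℕ) : Prop :=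
  (∀ w n c, M.Reaches n (M.init w) c → n ≤ t w.length) ∧
    ∀ w, w ∈ L ↔ ∃ n c, M.Reaches n (M.init w) c ∧ c.state = M.accept

end NTM

/-- The class NExpTime. -/
def InNExpTime {α : Type} (L : Language α) : Prop :=
  ∃ (p : Polynomial ℕ) (M : NTM α), M.DecidesInTime L (fun n => 2 ^ p.eval n)

/-- The class coNExpTime: the complement is in NExpTime. -/
def InCoNExpTime {α : Type} (L : Language α) : Prop :=
  InNExpTime ({w | w ∉ L} : Language α)

/-- Many-one reducibility by a function computable in polynomial time by a deterministic
(multi-stack) Turing machine. -/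
def PolyTimeReducible {α β : Type} (L : Language α) (P : Language β) : Prop :=
  ∃ f : List α → List β,
    Nonempty (Turing.TM2ComputableInPolyTime (id : List α → List α) (id : List β → List β) f) ∧
      ∀ w, w ∈ L ↔ f w ∈ P

/-- Every coNExpTime language, over any finite alphabet, reduces to `P` in polynomial time. -/
def CoNExpTimeHard {β : Type} (P : Language β) : Prop :=
  ∀ (α : Type) [Fintype α] (L : Language α), InCoNExpTime L → PolyTimeReducible L P

/-! ### Description logics: syntax -/

namespace DL

/-- Names are binary words. The sets of individual names, concept names, role names and variables
are disjoint copies of this countably infinite set, told apart by where a name occurs. -/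
abbrev Name := List Bool

/-- Simple roles. -/
inductive SRole where
  | name (r : Name)
  | inv (s : SRole)
  | inter (s t : SRole)
  | union (s t : SRole)
  | diff (s t : SRole)

mutual

/-- Concepts of ZOIQ. -/
inductive Concept where
  | bot
  | name (A : Name)
  | nominal (o : Name)
  | neg (C : Concept)
  | inter (C D : Concept)
  /-- `∃s.C` -/
  | ex (s : SRole) (C : Concept)
  /-- `(≥ n s).C` -/
  | atLeast (n : ℕ) (s : SRole) (C : Concept)
  /-- `∃s.Self` -/
  | self (s : SRole)
  /-- `∃𝒜.C` -/
  | exNFA (𝒜 : NFAutomaton) (C : Concept)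

/-- Nondeterministic finite automata whose letters are simple roles and tests `C?`: the lists of
initial and of final states, extended by one transition at a time. States are named by words. -/
inductive NFAutomaton where
  | states (initial final : List Name)
  | role (q : Name) (s : SRole) (q' : Name) (𝒜 : NFAutomaton)
  | test (q : Name) (C : Concept) (q' : Name) (𝒜 : NFAutomaton)

end

/-- TBox axioms `C ⊑ D` and `s ⊆ t`. -/
inductive TAxiom where
  | gci (C D : Concept)
  | roleIncl (s t : SRole)

/-- ABox axioms `A(a)`, `r(a, b)`, `a ≈ b` and `¬α`. -/
inductive AAxiom where
  | concept (A : Name) (a : Name)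
  | role (r : Name) (a b : Name)
  | eq (a b : Name)
  | neg (α : AAxiom)

/-- Knowledge bases. -/
structure KB where
  abox : List AAxiom
  tbox : List TAxiom

/-! ### The fragments ALCSelf and ZIQ -/

/-- ALCSelf-concepts: built from `⊥`, concept names, `¬`, `⊓`, `∃r.C` and `∃r.Self` with role
names `r`. -/
def Concept.IsALCSelf : Concept → Prop
  | .bot => True
  | .name _ => True
  | .nominal _ => False
  | .neg C => C.IsALCSelf
  | .inter C D => C.IsALCSelf ∧ D.IsALCSelf
  | .ex s C => (∃ r, s = .name r) ∧ C.IsALCSelf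
  | .atLeast _ _ _ => False
  | .self s => ∃ r, s = .name r
  | .exNFA _ _ => False

mutual

/-- ZIQ-concepts: no nominals, also in the tests of automata. -/
def Concept.IsZIQ : Concept → Prop
  | .bot => True
  | .name _ => True
  | .nominal _ => False
  | .neg C => C.IsZIQ
  | .inter C D => C.IsZIQ ∧ D.IsZIQ
  | .ex _ C => C.IsZIQ
  | .atLeast _ _ C => C.IsZIQ
  | .self _ => True
  | .exNFA 𝒜 C => 𝒜.IsZIQ ∧ C.IsZIQ

/-- All tests of the automaton are ZIQ-concepts. -/
def NFAutomaton.IsZIQ : NFAutomaton → Prop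
  | .states _ _ => True
  | .role _ _ _ 𝒜 => 𝒜.IsZIQ
  | .test _ C _ 𝒜 => C.IsZIQ ∧ 𝒜.IsZIQ

end

/-- ALCSelf-KBs: the TBox consists of inclusions between ALCSelf-concepts. -/
def KB.IsALCSelf (K : KB) : Prop :=
  ∀ τ ∈ K.tbox, ∃ C D : Concept, τ = .gci C D ∧ C.IsALCSelf ∧ D.IsALCSelf

/-- ZIQ-KBs: concepts in the TBox are ZIQ-concepts; inclusions of simple roles are allowed. -/
def KB.IsZIQ (K : KB) : Prop :=
  ∀ C D : Concept, TAxiom.gci C D ∈ K.tbox → C.IsZIQ ∧ D.IsZIQ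

/-! ### Semantics -/

/-- Interpretations with domain `Δ`. The domain is non-empty as it interprets individual names;
distinct names may denote the same element. -/
structure Interp (Δ : Type) where
  ind : Name → Δ
  con : Name → Set Δ
  rol : Name → Set (Δ × Δ)

/-- The interpretation of simple roles. -/
def SRole.sem {Δ : Type} (I : Interp Δ) : SRole → Set (Δ × Δ)
  | .name r => I.rol r
  | .inv s => {p | (p.2, p.1) ∈ s.sem I}
  | .inter s t => s.sem I ∩ t.sem I
  | .union s t => s.sem I ∪ t.sem I
  | .diff s t => s.sem I \ t.sem I

def NFAutomaton.initial : NFAutomaton → List Name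
  | .states i _ => i
  | .role _ _ _ 𝒜 => 𝒜.initial
  | .test _ _ _ 𝒜 => 𝒜.initial

def NFAutomaton.final : NFAutomaton → List Name
  | .states _ f => f
  | .role _ _ _ 𝒜 => 𝒜.final
  | .test _ _ _ 𝒜 => 𝒜.final

mutual

/-- The interpretation of concepts. For `∃𝒜.C`, a path from `d` to `e` that realises `𝒜` is an
accepting run of `𝒜` that moves along the letters it reads, from `d` to `e`. -/
def Concept.sem {Δ : Type} (I : Interp Δ) : Concept → Set Δ
  | .bot => ∅
  | .name A => I.con A
  | .nominal o => {I.ind o}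
  | .neg C => (C.sem I)ᶜ
  | .inter C D => C.sem I ∩ D.sem I
  | .ex s C => {d | ∃ e, e ∈ C.sem I ∧ (d, e) ∈ s.sem I}
  | .atLeast n s C => {d | (n : ℕ∞) ≤ {e | e ∈ C.sem I ∧ (d, e) ∈ s.sem I}.encard}
  | .self s => {d | (d, d) ∈ s.sem I}
  | .exNFA 𝒜 C => {d | ∃ q ∈ 𝒜.initial, ∃ q' ∈ 𝒜.final, ∃ e ∈ C.sem I,
      Relation.ReflTransGen (𝒜.step I) (q, d) (q', e)}

/-- One step of a run of an automaton in an interpretation: reading a role leads from an element to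
one related to it by the role; reading a test `C?` stays at an element of `C`. -/
def NFAutomaton.step {Δ : Type} (I : Interp Δ) : NFAutomaton → Name × Δ → Name × Δ → Prop
  | .states _ _ => fun _ _ => False
  | .role q s q' 𝒜 => fun x y =>
      (x.1 = q ∧ y.1 = q' ∧ (x.2, y.2) ∈ s.sem I) ∨ 𝒜.step I x y
  | .test q C q' 𝒜 => fun x y =>
      (x.1 = q ∧ y.1 = q' ∧ x.2 = y.2 ∧ x.2 ∈ C.sem I) ∨ 𝒜.step I x y

end

def TAxiom.Holds {Δ : Type} (I : Interp Δ) : TAxiom → Prop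
  | .gci C D => C.sem I ⊆ D.sem I
  | .roleIncl s t => s.sem I ⊆ t.sem I

def AAxiom.Holds {Δ : Type} (I : Interp Δ) : AAxiom → Prop
  | .concept A a => I.ind a ∈ I.con A
  | .role r a b => (I.ind a, I.ind b) ∈ I.rol r
  | .eq a b => I.ind a = I.ind b
  | .neg α => ¬ α.Holds I

/-- `I` is a model of `K`. -/
def KB.Models {Δ : Type} (I : Interp Δ) (K : KB) : Prop :=
  (∀ α ∈ K.abox, α.Holds I) ∧ ∀ τ ∈ K.tbox, τ.Holds I

/-! ### Conjunctive queries -/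

inductive Term where
  | var (x : Name)
  | ind (a : Name)

/-- Conjunctive queries. -/
inductive CQ where
  | concept (A : Name) (t : Term)
  | role (r : Name) (t u : Term)
  | and (q q' : CQ)

/-- The terms that occur in a query. -/
def CQ.terms : CQ → Set Term
  | .concept _ t => {t}
  | .role _ t u => {t, u}
  | .and q q' => q.terms ∪ q'.terms

/-- The query has an atom `r(t, u)` for some role name `r`. -/
def CQ.HasRoleAtom : CQ → Term → Term → Prop
  | .concept _ _ => fun _ _ => False
  | .role _ t u => fun t' u' => t' = t ∧ u' = u
  | .and q q' => fun t u => q.HasRoleAtom t u ∨ q'.HasRoleAtom t u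

/-- The query graph: its nodes are the terms of the query, two of them being adjacent if they occur
together in a role atom. -/
def CQ.graph (q : CQ) : SimpleGraph q.terms :=
  SimpleGraph.fromRel fun t u => q.HasRoleAtom t u

/-- A query is rooted if it has an individual name and its query graph is connected. -/
def CQ.IsRooted (q : CQ) : Prop :=
  (∃ a, Term.ind a ∈ q.terms) ∧ q.graph.Connected

def Term.sem {Δ : Type} (I : Interp Δ) (η : Name → Δ) : Term → Δ
  | .var x => η x
  | .ind a => I.ind a

/-- The query is true in `I` under the assignment `η` of the variables. -/
def CQ.Holds {Δ : Type} (I : Interp Δ) (η : Name → Δ) : CQ → Prop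
  | .concept A t => t.sem I η ∈ I.con A
  | .role r t u => (t.sem I η, u.sem I η) ∈ I.rol r
  | .and q q' => q.Holds I η ∧ q'.Holds I η

/-- Every model of `K` has a match of `q`. -/
def KB.Entails (K : KB) (q : CQ) : Prop :=
  ∀ (Δ : Type) (I : Interp Δ), K.Models I → ∃ η, q.Holds I η

/-! ### Inputs as words over a finite alphabet -/

/-- The symbols used to write down knowledge bases and queries, in prefix notation. -/
inductive Sym where
  | bit (b : Bool)
  | endName
  | name
  | inv
  | inter
  | union
  | diff
  | bot
  | nominal
  | neg
  | ex
  | atLeast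
  | self
  | nfa
  | role
  | test
  | incl
  | eq
  | var
  | cons
  | nil
  deriving DecidableEq, Fintype

def Name.enc (w : Name) : List Sym := w.map Sym.bit ++ [.endName]

/-- Lists, with an encoding of the entries. -/
def listEnc {α : Type} (enc : α → List Sym) : List α → List Sym
  | [] => [.nil]
  | a :: l => .cons :: (enc a ++ listEnc enc l)

def SRole.enc : SRole → List Sym
  | .name r => .name :: Name.enc r
  | .inv s => .inv :: s.enc
  | .inter s t => .inter :: (s.enc ++ t.enc)
  | .union s t => .union :: (s.enc ++ t.enc)
  | .diff s t => .diff :: (s.enc ++ t.enc)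

mutual

/-- Numbers are written in binary. -/
def Concept.enc : Concept → List Sym
  | .bot => [.bot]
  | .name A => .name :: Name.enc A
  | .nominal o => .nominal :: Name.enc o
  | .neg C => .neg :: C.enc
  | .inter C D => .inter :: (C.enc ++ D.enc)
  | .ex s C => .ex :: (s.enc ++ C.enc)
  | .atLeast n s C => .atLeast :: (Name.enc (Computability.encodeNat n) ++ (s.enc ++ C.enc))
  | .self s => .self :: s.enc
  | .exNFA 𝒜 C => .nfa :: (𝒜.enc ++ C.enc)

def NFAutomaton.enc : NFAutomaton → List Sym
  | .states i f => .nil :: (listEnc Name.enc i ++ listEnc Name.enc f)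
  | .role q s q' 𝒜 => .role :: (Name.enc q ++ (s.enc ++ (Name.enc q' ++ 𝒜.enc)))
  | .test q C q' 𝒜 => .test :: (Name.enc q ++ (C.enc ++ (Name.enc q' ++ 𝒜.enc)))

end

def TAxiom.enc : TAxiom → List Sym
  | .gci C D => .incl :: (C.enc ++ D.enc)
  | .roleIncl s t => .role :: (s.enc ++ t.enc)

def AAxiom.enc : AAxiom → List Sym
  | .concept A a => .name :: (Name.enc A ++ Name.enc a)
  | .role r a b => .role :: (Name.enc r ++ (Name.enc a ++ Name.enc b))
  | .eq a b => .eq :: (Name.enc a ++ Name.enc b)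
  | .neg α => .neg :: α.enc

def Term.enc : Term → List Sym
  | .var x => .var :: Name.enc x
  | .ind a => .name :: Name.enc a

def CQ.enc : CQ → List Sym
  | .concept A t => .name :: (Name.enc A ++ t.enc)
  | .role r t u => .role :: (Name.enc r ++ (t.enc ++ u.enc))
  | .and q q' => .inter :: (q.enc ++ q'.enc)

/-- The word that represents the input `(K, q)`; ABox, TBox and query all count for its length. -/
def encInput (K : KB) (q : CQ) : List Sym :=
  listEnc AAxiom.enc K.abox ++ (listEnc TAxiom.enc K.tbox ++ q.enc)

/-- The rooted conjunctive query entailment problem for the description logic whose knowledge bases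
are those that satisfy `IsKB`: given such a knowledge base and a rooted conjunctive query, is the
query entailed? -/
def RootedCQEntailment (IsKB : KB → Prop) : Language Sym :=
  {w | ∃ (K : KB) (q : CQ), w = encInput K q ∧ IsKB K ∧ q.IsRooted ∧ K.Entails q}

/-! ### Inputs can be read off from the words that represent them -/

theorem Name.enc_inj : ∀ (x y : Name) (u v : List Sym),
    Name.enc x ++ u = Name.enc y ++ v → x = y ∧ u = v
  | [], [], u, v, h => by simpa [Name.enc] using h
  | [], b :: y, u, v, h => by simp [Name.enc] at h
  | a :: x, [], u, v, h => by simp [Name.enc] at h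
  | a :: x, b :: y, u, v, h => by
      have h' : a = b ∧ Name.enc x ++ u = Name.enc y ++ v := by simpa [Name.enc] using h
      obtain ⟨e₁, e₂⟩ := Name.enc_inj x y u v h'.2
      exact ⟨by rw [h'.1, e₁], e₂⟩

theorem listEnc_inj {α : Type} (enc : α → List Sym)
    (henc : ∀ x y u v, enc x ++ u = enc y ++ v → x = y ∧ u = v) :
    ∀ (x y : List α) (u v : List Sym), listEnc enc x ++ u = listEnc enc y ++ v → x = y ∧ u = v
  | [], [], u, v, h => by simpa [listEnc] using h
  | [], b :: y, u, v, h => by simp [listEnc] at h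
  | a :: x, [], u, v, h => by simp [listEnc] at h
  | a :: x, b :: y, u, v, h => by
      simp only [listEnc, List.cons_append, List.append_assoc, List.cons.injEq, true_and] at h
      obtain ⟨e₁, h⟩ := henc _ _ _ _ h
      obtain ⟨e₂, h⟩ := listEnc_inj enc henc _ _ _ _ h
      exact ⟨by rw [e₁, e₂], h⟩

theorem SRole.enc_inj (x : SRole) : ∀ (y : SRole) (u v : List Sym),
    x.enc ++ u = y.enc ++ v → x = y ∧ u = v := by
  induction x with
  | name r =>
    intro y u v h
    cases y <;> simp [SRole.enc] at h ⊢
    exact Name.enc_inj _ _ _ _ h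
  | inv s ih =>
    intro y u v h
    cases y <;> simp [SRole.enc] at h ⊢
    exact ih _ _ _ h
  | inter s t ih₁ ih₂ =>
    intro y u v h
    cases y <;> simp [SRole.enc] at h ⊢
    obtain ⟨e, h⟩ := ih₁ _ _ _ h
    exact ⟨⟨e, (ih₂ _ _ _ h).1⟩, (ih₂ _ _ _ h).2⟩
  | union s t ih₁ ih₂ =>
    intro y u v h
    cases y <;> simp [SRole.enc] at h ⊢
    obtain ⟨e, h⟩ := ih₁ _ _ _ h
    exact ⟨⟨e, (ih₂ _ _ _ h).1⟩, (ih₂ _ _ _ h).2⟩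
  | diff s t ih₁ ih₂ =>
    intro y u v h
    cases y <;> simp [SRole.enc] at h ⊢
    obtain ⟨e, h⟩ := ih₁ _ _ _ h
    exact ⟨⟨e, (ih₂ _ _ _ h).1⟩, (ih₂ _ _ _ h).2⟩

theorem encodeNat_inj (m n : ℕ) (h : Computability.encodeNat m = Computability.encodeNat n) :
    m = n := by
  rw [← Computability.decode_encodeNat m, h, Computability.decode_encodeNat]

mutual

theorem Concept.enc_inj : ∀ (x y : Concept) (u v : List Sym),
    x.enc ++ u = y.enc ++ v → x = y ∧ u = v
  | .bot, y, u, v, h => by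
      cases y <;> simp [Concept.enc] at h ⊢
      exact h
  | .name A, y, u, v, h => by
      cases y <;> simp [Concept.enc] at h ⊢
      exact Name.enc_inj _ _ _ _ h
  | .nominal o, y, u, v, h => by
      cases y <;> simp [Concept.enc] at h ⊢
      exact Name.enc_inj _ _ _ _ h
  | .neg C, y, u, v, h => by
      cases y <;> simp [Concept.enc] at h ⊢
      exact Concept.enc_inj C _ _ _ h
  | .inter C D, y, u, v, h => by
      cases y <;> simp [Concept.enc] at h ⊢
      obtain ⟨e₁, h⟩ := Concept.enc_inj C _ _ _ h
      obtain ⟨e₂, h⟩ := Concept.enc_inj D _ _ _ h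
      exact ⟨⟨e₁, e₂⟩, h⟩
  | .ex s C, y, u, v, h => by
      cases y <;> simp [Concept.enc] at h ⊢
      obtain ⟨e₁, h⟩ := SRole.enc_inj s _ _ _ h
      obtain ⟨e₂, h⟩ := Concept.enc_inj C _ _ _ h
      exact ⟨⟨e₁, e₂⟩, h⟩
  | .atLeast n s C, y, u, v, h => by
      cases y <;> simp [Concept.enc] at h ⊢
      obtain ⟨e₀, h⟩ := Name.enc_inj _ _ _ _ h
      obtain ⟨e₁, h⟩ := SRole.enc_inj s _ _ _ h
      obtain ⟨e₂, h⟩ := Concept.enc_inj C _ _ _ h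
      exact ⟨⟨encodeNat_inj _ _ e₀, e₁, e₂⟩, h⟩
  | .self s, y, u, v, h => by
      cases y <;> simp [Concept.enc] at h ⊢
      exact SRole.enc_inj s _ _ _ h
  | .exNFA 𝒜 C, y, u, v, h => by
      cases y <;> simp [Concept.enc] at h ⊢
      obtain ⟨e₁, h⟩ := NFAutomaton.enc_inj 𝒜 _ _ _ h
      obtain ⟨e₂, h⟩ := Concept.enc_inj C _ _ _ h
      exact ⟨⟨e₁, e₂⟩, h⟩

theorem NFAutomaton.enc_inj : ∀ (x y : NFAutomaton) (u v : List Sym),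
    x.enc ++ u = y.enc ++ v → x = y ∧ u = v
  | .states i f, y, u, v, h => by
      cases y <;> simp [NFAutomaton.enc] at h ⊢
      obtain ⟨e₁, h⟩ := listEnc_inj _ Name.enc_inj _ _ _ _ h
      obtain ⟨e₂, h⟩ := listEnc_inj _ Name.enc_inj _ _ _ _ h
      exact ⟨⟨e₁, e₂⟩, h⟩
  | .role q s q' 𝒜, y, u, v, h => by
      cases y <;> simp [NFAutomaton.enc] at h ⊢
      obtain ⟨e₁, h⟩ := Name.enc_inj _ _ _ _ h
      obtain ⟨e₂, h⟩ := SRole.enc_inj s _ _ _ h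
      obtain ⟨e₃, h⟩ := Name.enc_inj _ _ _ _ h
      obtain ⟨e₄, h⟩ := NFAutomaton.enc_inj 𝒜 _ _ _ h
      exact ⟨⟨e₁, e₂, e₃, e₄⟩, h⟩
  | .test q C q' 𝒜, y, u, v, h => by
      cases y <;> simp [NFAutomaton.enc] at h ⊢
      obtain ⟨e₁, h⟩ := Name.enc_inj _ _ _ _ h
      obtain ⟨e₂, h⟩ := Concept.enc_inj C _ _ _ h
      obtain ⟨e₃, h⟩ := Name.enc_inj _ _ _ _ h
      obtain ⟨e₄, h⟩ := NFAutomaton.enc_inj 𝒜 _ _ _ h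
      exact ⟨⟨e₁, e₂, e₃, e₄⟩, h⟩

end

theorem TAxiom.enc_inj (x y : TAxiom) (u v : List Sym) (h : x.enc ++ u = y.enc ++ v) :
    x = y ∧ u = v := by
  cases x <;> cases y <;> simp [TAxiom.enc] at h ⊢
  · obtain ⟨e₁, h⟩ := Concept.enc_inj _ _ _ _ h
    obtain ⟨e₂, h⟩ := Concept.enc_inj _ _ _ _ h
    exact ⟨⟨e₁, e₂⟩, h⟩
  · obtain ⟨e₁, h⟩ := SRole.enc_inj _ _ _ _ h
    obtain ⟨e₂, h⟩ := SRole.enc_inj _ _ _ _ h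
    exact ⟨⟨e₁, e₂⟩, h⟩

theorem AAxiom.enc_inj : ∀ (x y : AAxiom) (u v : List Sym),
    x.enc ++ u = y.enc ++ v → x = y ∧ u = v
  | .concept A a, y, u, v, h => by
      cases y <;> simp [AAxiom.enc] at h ⊢
      obtain ⟨e₁, h⟩ := Name.enc_inj _ _ _ _ h
      obtain ⟨e₂, h⟩ := Name.enc_inj _ _ _ _ h
      exact ⟨⟨e₁, e₂⟩, h⟩
  | .role r a b, y, u, v, h => by
      cases y <;> simp [AAxiom.enc] at h ⊢
      obtain ⟨e₁, h⟩ := Name.enc_inj _ _ _ _ h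
      obtain ⟨e₂, h⟩ := Name.enc_inj _ _ _ _ h
      obtain ⟨e₃, h⟩ := Name.enc_inj _ _ _ _ h
      exact ⟨⟨e₁, e₂, e₃⟩, h⟩
  | .eq a b, y, u, v, h => by
      cases y <;> simp [AAxiom.enc] at h ⊢
      obtain ⟨e₁, h⟩ := Name.enc_inj _ _ _ _ h
      obtain ⟨e₂, h⟩ := Name.enc_inj _ _ _ _ h
      exact ⟨⟨e₁, e₂⟩, h⟩
  | .neg α, y, u, v, h => by
      cases y <;> simp [AAxiom.enc] at h ⊢
      exact AAxiom.enc_inj α _ _ _ h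

theorem Term.enc_inj (x y : Term) (u v : List Sym) (h : x.enc ++ u = y.enc ++ v) :
    x = y ∧ u = v := by
  cases x <;> cases y <;> simp [Term.enc] at h ⊢
  · exact Name.enc_inj _ _ _ _ h
  · exact Name.enc_inj _ _ _ _ h

theorem CQ.enc_inj : ∀ (x y : CQ) (u v : List Sym), x.enc ++ u = y.enc ++ v → x = y ∧ u = v
  | .concept A t, y, u, v, h => by
      cases y <;> simp [CQ.enc] at h ⊢
      obtain ⟨e₁, h⟩ := Name.enc_inj _ _ _ _ h
      obtain ⟨e₂, h⟩ := Term.enc_inj _ _ _ _ h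
      exact ⟨⟨e₁, e₂⟩, h⟩
  | .role r s t, y, u, v, h => by
      cases y <;> simp [CQ.enc] at h ⊢
      obtain ⟨e₁, h⟩ := Name.enc_inj _ _ _ _ h
      obtain ⟨e₂, h⟩ := Term.enc_inj _ _ _ _ h
      obtain ⟨e₃, h⟩ := Term.enc_inj _ _ _ _ h
      exact ⟨⟨e₁, e₂, e₃⟩, h⟩
  | .and q q', y, u, v, h => by
      cases y <;> simp [CQ.enc] at h ⊢
      obtain ⟨e₁, h⟩ := CQ.enc_inj q _ _ _ h
      obtain ⟨e₂, h⟩ := CQ.enc_inj q' _ _ _ h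
      exact ⟨⟨e₁, e₂⟩, h⟩

/-- Distinct inputs are represented by distinct words. -/
theorem encInput_inj (K K' : KB) (q q' : CQ) (h : encInput K q = encInput K' q') :
    K = K' ∧ q = q' := by
  obtain ⟨e₁, h⟩ := listEnc_inj _ AAxiom.enc_inj _ _ _ _ h
  obtain ⟨e₂, h⟩ := listEnc_inj _ TAxiom.enc_inj _ _ _ _ h
  refine ⟨?_, (CQ.enc_inj q q' [] [] (by simpa using h)).1⟩
  cases K
  cases K'
  simp only at e₁ e₂
  rw [e₁, e₂]

end DL

set_option linter.unusedSimpArgs false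

-- Let `M` decide the complement of `L` in time `2 ^ p n`, and let `N` be polynomial in the length
-- of the input and large enough. An accepting run of `M` amounts to a tiling of a `2 ^ N` by `2 ^
-- N` grid with rows closed to cycles, where a tile of row `t + 1` is constrained by three adjacent
-- tiles of row `t` and row `0` by the input (`NTM.exists_trace_of_accepts`,
-- `NTM.accepts_of_trace`). The knowledge base and the query are built so that a countermodel exists
-- exactly if a tiling does (`entails_iff_no_tiling`).
--
-- The knowledge base generates a tree whose leaves carry all pairs `(t, i)` of addresses and all
-- triples `(a, b, c)` of tiles. Propositional clauses make each leaf claim something about one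
-- cell. A negative claim denies that cell `i`, `i + 1` or `i + 2` of row `t` holds `a`, `b` or `c`,
-- respectively; a positive claim asserts that cell `i + 1` of row `t + 1` holds some tile allowed
-- above `a`, `b`, `c`. At the last row the claim is positive and concerns row `0`. The query asks
-- for a positive and a negative claim about the same cell and tile. Without such a pair, positive
-- claims build a tiling row by row: the leaf whose triple is the actual window cannot deny it,
-- hence it claims a next tile (`exists_tiling_of_family`). Conversely, given a tiling, every leaf
-- can make a true claim, and true claims do not contradict each other (`exists_family_of_tiling`).
--
-- What remains is to compare the bits of two leaves by a conjunctive query of polynomial size. This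
-- is where `Self` enters. A bit of a leaf is represented by a bit node, reached by the role
-- `bitRole` of its value, with loops for `edge` and for the other bit role. Block `b` of the query
-- is a fork: from a common top, two legs of `N + 1` edges each, followed by one `bitRole b` step to
-- a bit node. In the tree model the fork either collapses to the loops of a single bit node, so
-- that its two ends are equal, or it passes through leaves, so that both ends have value `b`. Block
-- `0` and block `1`, chained through a middle bit node, thus express that two values agree
-- (`query_holds_of_eq_bits`, `treeInterp_not_holds`).
--
-- For polynomial time, a small language of stack programs is compiled to `TM2` machines. Names are
-- in unary, so that the text of the knowledge base and the query is printed by nested loops over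
-- numbers below `N` (`computable_of_prints`, `computable_encInput`). The knowledge base is in
-- ALCSelf, hence also in ZIQ, so one reduction serves both logics.

namespace DL.Reduction

-- Construction of the knowledge base and the query.

/-! ### Names -/

/-- The name that codes a list of numbers in unary. -/
def mk (l : List ℕ) : Name := l.flatMap fun a => List.replicate a true ++ [false]

theorem mk_cons (a : ℕ) (l : List ℕ) :
    mk (a :: l) = List.replicate a true ++ false :: mk l := by
  simp [mk]

theorem replicate_true_append_inj : ∀ (a b : ℕ) (u v : List Bool),
    List.replicate a true ++ false :: u = List.replicate b true ++ false :: v → a = b ∧ u = v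
  | 0, 0, u, v, h => by simpa using h
  | 0, b + 1, u, v, h => by simp [List.replicate_succ] at h
  | a + 1, 0, u, v, h => by simp [List.replicate_succ] at h
  | a + 1, b + 1, u, v, h => by
      simp only [List.replicate_succ, List.cons_append, List.cons.injEq, true_and] at h
      have := replicate_true_append_inj a b u v h
      exact ⟨by rw [this.1], this.2⟩

theorem mk_injective : Function.Injective mk := by
  intro l
  induction l with
  | nil =>
    intro m h
    cases m with
    | nil => rfl
    | cons b m =>
      rw [mk_cons] at h
      simp [mk] at h
  | cons a l ih =>
    intro m h
    cases m with
    | nil =>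
      rw [mk_cons] at h
      simp [mk] at h
    | cons b m =>
      rw [mk_cons, mk_cons] at h
      obtain ⟨e, h⟩ := replicate_true_append_inj _ _ _ _ h
      rw [e, ih h]

/-- A left inverse of `mk`. -/
noncomputable def unmk : Name → List ℕ := Function.invFun mk

@[simp] theorem unmk_mk (l : List ℕ) : unmk (mk l) = l :=
  Function.leftInverse_invFun mk_injective l

/-! ### The knowledge base

Concept names, given by their lists: `[0, j]` level `j` of the tree, `[1]` leaves, `[2, f, b, j]` the
`j`-th bit of address `f` is `b`, `3 :: τ` the leaf has type `τ`, `[4, f, j]` bits of the claim made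
at a leaf, `[5, f, j]` the child of a leaf that represents such a bit, `[6]` and `[7]` positive and
negative claims. -/

/-- The concept with the name coded by `l`. -/
def cn (l : List ℕ) : Concept := .name (mk l)

/-- The role of the edges of the tree. -/
def edge : SRole := .name (mk [0])

/-- The role of the edges to bits of value `b`. -/
def bitRole (b : ℕ) : SRole := .name (mk [1, b])

/-- Clauses, as pairs of lists of negative and of positive concept names. -/
abbrev Clause := List (List ℕ) × List (List ℕ)

/-- The final conjunct `cn [1]` restricts every clause to leaves. -/
def clauseBody : List (List ℕ) → Concept
  | [] => cn [1]
  | a :: l => .inter (cn a) (clauseBody l)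

/-- A disjunction, by De Morgan's law, since the grammar has no `⊔`. -/
def clauseHead : List (List ℕ) → Concept
  | [] => .bot
  | a :: l => .neg (.inter (.neg (cn a)) (.neg (clauseHead l)))

/-- The clause holds at all leaves. -/
def clauseAxiom (c : Clause) : TAxiom := .gci (clauseBody c.1) (clauseHead c.2)

def splitAxiom (j b c : ℕ) : TAxiom :=
  .gci (cn [0, j]) (.ex edge (.inter (cn [0, j + 1]) (.inter (cn [2, 0, b, j]) (cn [2, 1, c, j]))))

/-- A value restriction along `edge`: an address bit chosen at one level is handed down to the
leaves. -/
def inheritAxiom (f b j : ℕ) : TAxiom :=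
  .gci (cn [2, f, b, j]) (.neg (.ex edge (.neg (cn [2, f, b, j]))))

def leafAxiom (N : ℕ) (τ : List ℕ) : TAxiom :=
  .gci (cn [0, N]) (.ex edge (.inter (cn [1]) (cn (3 :: τ))))

/-- The loop for `bitRole 0` makes the walk `bitRole 0`, `bitRole 1` from a leaf to its bit node
possible for both values: for value 1 it waits at the leaf, for value 0 it waits at the bit node. -/
def loopAxiom : TAxiom := .gci (cn [1]) (.inter (.self (bitRole 0)) (.self (bitRole 1)))

/-- The loops at the bit node let a whole leg of the query collapse to this node, but only in the
block of the other value; `zeroAxiom` is the mirror image. -/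
def oneAxiom (f j : ℕ) : TAxiom :=
  .gci (.inter (cn [1]) (cn [4, f, j]))
    (.ex (bitRole 1) (.inter (cn [5, f, j]) (.inter (.self edge) (.self (bitRole 0)))))

def zeroAxiom (f j : ℕ) : TAxiom :=
  .gci (.inter (cn [1]) (.neg (cn [4, f, j])))
    (.ex (bitRole 0) (.inter (cn [5, f, j]) (.inter (.self edge) (.self (bitRole 1)))))

def levelAxioms (j : ℕ) : List TAxiom :=
  [splitAxiom j 0 0, splitAxiom j 0 1, splitAxiom j 1 0, splitAxiom j 1 1,
    inheritAxiom 0 0 j, inheritAxiom 0 1 j, inheritAxiom 1 0 j, inheritAxiom 1 1 j]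

/-- The knowledge base with a tree of depth `N`, leaf types `τs`, bits `bs` and clauses `Φ`. -/
def kb (N : ℕ) (τs : List (List ℕ)) (bs : List (ℕ × ℕ)) (Φ : List Clause) : KB where
  abox := [.concept (mk [0, 0]) (mk [])]
  tbox := Φ.map clauseAxiom ++ ((List.range N).flatMap levelAxioms ++
    (τs.map (leafAxiom N) ++ (bs.flatMap (fun p => [oneAxiom p.1 p.2, zeroAxiom p.1 p.2]) ++
      [loopAxiom])))

/-! ### The query -/

def conjunction : List CQ → CQ → CQ
  | [], q => q
  | a :: l, q => .and a (conjunction l q)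

/-- The variable coded by `l`. -/
def vr (l : List ℕ) : Term := .var (mk l)

def edgeAtom (t u : Term) : CQ := .role (mk [0]) t u

def bitAtom (b : ℕ) (t u : Term) : CQ := .role (mk [1, b]) t u

/-- The `N + 1` edges are the distance from the root to a leaf. The legs `c = 0, 1` of block `b`
share the top `vr [2, f, j, b]` and end at the bit nodes `vr [4, f, j, b]` and `vr [4, f, j, b +
1]`. -/
def legAtoms (N f j b c : ℕ) : List CQ :=
  edgeAtom (vr [2, f, j, b]) (vr [3, f, j, b, c, 0]) ::
    bitAtom b (vr [3, f, j, b, c, N]) (vr [4, f, j, b + c]) ::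
    (List.range N).map fun l => edgeAtom (vr [3, f, j, b, c, l]) (vr [3, f, j, b, c, l + 1])

/-- The two-step walks tie the outer bit nodes `vr [4, f, j, 0]` and `vr [4, f, j, 2]` to the two
leaves compared; the middle one is free. -/
def markAtoms (N f j : ℕ) : List CQ :=
  [.concept (mk [5, f, j]) (vr [4, f, j, 0]), .concept (mk [5, f, j]) (vr [4, f, j, 1]),
    .concept (mk [5, f, j]) (vr [4, f, j, 2]),
    bitAtom 0 (vr [0, N]) (vr [5, f, j, 0]), bitAtom 1 (vr [5, f, j, 0]) (vr [4, f, j, 0]),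
    bitAtom 0 (vr [1]) (vr [5, f, j, 1]), bitAtom 1 (vr [5, f, j, 1]) (vr [4, f, j, 2])]

/-- The atoms that compare one bit of the claims made at the leaves `vr [0, N]` and `vr [1]`. -/
def compareAtoms (N f j : ℕ) : List CQ :=
  markAtoms N f j ++ (legAtoms N f j 0 0 ++ (legAtoms N f j 0 1 ++
    (legAtoms N f j 1 0 ++ legAtoms N f j 1 1)))

def pathAtoms (N : ℕ) : List CQ :=
  edgeAtom (.ind (mk [])) (vr [0, 0]) ::
    (List.range N).map fun l => edgeAtom (vr [0, l]) (vr [0, l + 1])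

/-- The query: there are a positive and a negative claim with the same bits. -/
def query (N : ℕ) (bs : List (ℕ × ℕ)) : CQ :=
  conjunction (pathAtoms N ++ (bs.flatMap fun p => compareAtoms N p.1 p.2))
    (.and (.concept (mk [6]) (vr [0, N])) (.concept (mk [7]) (vr [1])))

theorem conjunction_holds {Δ : Type} (I : Interp Δ) (η : Name → Δ) (l : List CQ) (q : CQ) :
    (conjunction l q).Holds I η ↔ (∀ a ∈ l, a.Holds I η) ∧ q.Holds I η := by
  induction l with
  | nil => simp [conjunction]
  | cons a l ih => simp [conjunction, CQ.Holds, ih, and_assoc]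

theorem mem_legAtoms {N f j b c : ℕ} {P : CQ → Prop} :
    (∀ a ∈ legAtoms N f j b c, P a) ↔
      P (edgeAtom (vr [2, f, j, b]) (vr [3, f, j, b, c, 0])) ∧
      P (bitAtom b (vr [3, f, j, b, c, N]) (vr [4, f, j, b + c])) ∧
      ∀ l < N, P (edgeAtom (vr [3, f, j, b, c, l]) (vr [3, f, j, b, c, l + 1])) := by
  simp [legAtoms]

theorem mem_pathAtoms {N : ℕ} {P : CQ → Prop} :
    (∀ a ∈ pathAtoms N, P a) ↔ P (edgeAtom (.ind (mk [])) (vr [0, 0])) ∧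
      ∀ l < N, P (edgeAtom (vr [0, l]) (vr [0, l + 1])) := by
  simp [pathAtoms]

/-- The predicate is arbitrary because atoms are inspected for their truth, for their role atoms and
for their terms. -/
theorem mem_compareAtoms {N f j : ℕ} {P : CQ → Prop} :
    (∀ a ∈ compareAtoms N f j, P a) ↔ (∀ a ∈ markAtoms N f j, P a) ∧
      ∀ b < 2, ∀ c < 2, ∀ a ∈ legAtoms N f j b c, P a := by
  constructor
  · intro h
    refine ⟨fun a ha => h a (by simp [compareAtoms, ha]), fun b hb c hc a ha => h a ?_⟩
    interval_cases b <;> interval_cases c <;> simp [compareAtoms, ha]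
  · rintro ⟨h₁, h₂⟩ a ha
    simp only [compareAtoms, List.mem_append] at ha
    rcases ha with ha | ha | ha | ha | ha
    · exact h₁ a ha
    · exact h₂ 0 (by simp) 0 (by simp) a ha
    · exact h₂ 0 (by simp) 1 (by simp) a ha
    · exact h₂ 1 (by simp) 0 (by simp) a ha
    · exact h₂ 1 (by simp) 1 (by simp) a ha

/-! ### The fragments -/

theorem clauseBody_isALCSelf : ∀ l, (clauseBody l).IsALCSelf
  | [] => by simp [clauseBody, cn, Concept.IsALCSelf]
  | a :: l => by simp [clauseBody, cn, Concept.IsALCSelf, clauseBody_isALCSelf l]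

theorem clauseHead_isALCSelf : ∀ l, (clauseHead l).IsALCSelf
  | [] => by simp [clauseHead, Concept.IsALCSelf]
  | a :: l => by simp [clauseHead, cn, Concept.IsALCSelf, clauseHead_isALCSelf l]

theorem kb_isALCSelf (N : ℕ) (τs : List (List ℕ)) (bs : List (ℕ × ℕ)) (Φ : List Clause) :
    (kb N τs bs Φ).IsALCSelf := by
  intro τ hτ
  simp only [kb, List.mem_append, List.mem_map, List.mem_flatMap, levelAxioms] at hτ
  rcases hτ with ⟨c, -, rfl⟩ | ⟨j, -, h⟩ | ⟨τ, -, rfl⟩ | ⟨p, -, h⟩ | h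
  · exact ⟨_, _, rfl, clauseBody_isALCSelf _, clauseHead_isALCSelf _⟩
  · simp only [List.mem_cons, List.not_mem_nil, or_false] at h
    rcases h with rfl | rfl | rfl | rfl | rfl | rfl | rfl | rfl <;>
      exact ⟨_, _, rfl, by simp [cn, Concept.IsALCSelf], by simp [cn, Concept.IsALCSelf, edge]⟩
  · exact ⟨_, _, rfl, by simp [cn, Concept.IsALCSelf], by simp [cn, Concept.IsALCSelf, edge]⟩
  · simp only [List.mem_cons, List.not_mem_nil, or_false] at h
    rcases h with rfl | rfl <;>
      exact ⟨_, _, rfl, by simp [cn, Concept.IsALCSelf],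
        by simp [cn, Concept.IsALCSelf, edge, bitRole]⟩
  · simp only [List.mem_cons, List.not_mem_nil, or_false] at h
    subst h
    exact ⟨_, _, rfl, by simp [cn, Concept.IsALCSelf], by simp [Concept.IsALCSelf, bitRole]⟩

theorem _root_.DL.Concept.IsALCSelf.isZIQ : ∀ C : Concept, C.IsALCSelf → C.IsZIQ
  | .bot, _ => by simp [Concept.IsZIQ]
  | .name _, _ => by simp [Concept.IsZIQ]
  | .nominal _, h => by simp [Concept.IsALCSelf] at h
  | .neg C, h => by
      simp only [Concept.IsALCSelf] at h
      simpa [Concept.IsZIQ] using Concept.IsALCSelf.isZIQ C h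
  | .inter C D, h => by
      simp only [Concept.IsALCSelf] at h
      simpa [Concept.IsZIQ] using
        ⟨Concept.IsALCSelf.isZIQ C h.1, Concept.IsALCSelf.isZIQ D h.2⟩
  | .ex s C, h => by
      simp only [Concept.IsALCSelf] at h
      simpa [Concept.IsZIQ] using Concept.IsALCSelf.isZIQ C h.2
  | .atLeast _ _ _, h => by simp [Concept.IsALCSelf] at h
  | .self _, _ => by simp [Concept.IsZIQ]
  | .exNFA _ _, h => by simp [Concept.IsALCSelf] at h

theorem _root_.DL.KB.IsALCSelf.isZIQ {K : KB} (h : K.IsALCSelf) : K.IsZIQ := by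
  intro C D hCD
  obtain ⟨C', D', e, hC, hD⟩ := h _ hCD
  cases e
  exact ⟨hC.isZIQ, hD.isZIQ⟩

/-! ### The query is rooted -/

/-- `t` is connected to `s` in the query graph. -/
def Linked (q : CQ) (s t : Term) : Prop :=
  ∃ (hs : s ∈ q.terms) (ht : t ∈ q.terms), q.graph.Reachable ⟨s, hs⟩ ⟨t, ht⟩

theorem hasRoleAtom_terms : ∀ {q : CQ} {t u : Term}, q.HasRoleAtom t u → t ∈ q.terms ∧ u ∈ q.terms
  | .concept _ _, _, _, h => by simp [CQ.HasRoleAtom] at h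
  | .role _ _ _, _, _, h => by
      simp only [CQ.HasRoleAtom] at h
      simp [CQ.terms, h.1, h.2]
  | .and q q', _, _, h => by
      simp only [CQ.HasRoleAtom] at h
      rcases h with h | h
      · exact ⟨Or.inl (hasRoleAtom_terms h).1, Or.inl (hasRoleAtom_terms h).2⟩
      · exact ⟨Or.inr (hasRoleAtom_terms h).1, Or.inr (hasRoleAtom_terms h).2⟩

theorem reachable_of_hasRoleAtom {q : CQ} {t u : Term} (h : q.HasRoleAtom t u) :
    q.graph.Reachable ⟨t, (hasRoleAtom_terms h).1⟩ ⟨u, (hasRoleAtom_terms h).2⟩ := by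
  by_cases e : t = u
  · subst e
    exact SimpleGraph.Reachable.refl _
  · apply SimpleGraph.Adj.reachable
    rw [CQ.graph, SimpleGraph.fromRel_adj]
    exact ⟨by simpa using e, Or.inl h⟩

theorem Linked.forward {q : CQ} {s t u : Term} (h : Linked q s t) (h' : q.HasRoleAtom t u) :
    Linked q s u := by
  obtain ⟨hs, ht, hr⟩ := h
  exact ⟨hs, (hasRoleAtom_terms h').2, hr.trans (reachable_of_hasRoleAtom h')⟩

theorem Linked.backward {q : CQ} {s t u : Term} (h : Linked q s u) (h' : q.HasRoleAtom t u) :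
    Linked q s t := by
  obtain ⟨hs, ht, hr⟩ := h
  exact ⟨hs, (hasRoleAtom_terms h').1, hr.trans (reachable_of_hasRoleAtom h').symm⟩

theorem conjunction_hasRoleAtom {l : List CQ} {q a : CQ} (ha : a ∈ l) {t u : Term}
    (h : a.HasRoleAtom t u) : (conjunction l q).HasRoleAtom t u := by
  induction l with
  | nil => simp at ha
  | cons b l ih =>
    rcases List.mem_cons.1 ha with rfl | ha
    · exact Or.inl h
    · exact Or.inr (ih ha)

theorem mem_conjunction_terms {l : List CQ} {q : CQ} {t : Term} :
    t ∈ (conjunction l q).terms ↔ (∃ a ∈ l, t ∈ a.terms) ∨ t ∈ q.terms := by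
  induction l with
  | nil => simp [conjunction]
  | cons a l ih => simp [conjunction, CQ.terms, ih, or_assoc]

/-- From the individual one reaches the first leaf, its bit node, and then, block by block, the bit
node of the second leaf and this leaf itself. Only the comparison of some bit links `vr [1]` to the
rest, hence `hbs`. -/
theorem query_isRooted (N : ℕ) {bs : List (ℕ × ℕ)} (hbs : bs ≠ []) : (query N bs).IsRooted := by
  set q := query N bs with hq
  set s : Term := .ind (mk []) with hs
  have hpath : ∀ a ∈ pathAtoms N, ∀ t u, a.HasRoleAtom t u → q.HasRoleAtom t u := by
    intro a ha t u h
    exact conjunction_hasRoleAtom (by simp [ha]) h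
  have hcomp : ∀ p ∈ bs, ∀ a ∈ compareAtoms N p.1 p.2, ∀ t u, a.HasRoleAtom t u →
      q.HasRoleAtom t u := by
    intro p hp a ha t u h
    exact conjunction_hasRoleAtom (List.mem_append_right _ (List.mem_flatMap.2 ⟨p, hp, ha⟩)) h
  obtain ⟨h₀, h₁⟩ := mem_pathAtoms.1 hpath
  have r₀ := h₀ s (vr [0, 0]) ⟨rfl, rfl⟩
  have hs' : s ∈ q.terms := (hasRoleAtom_terms r₀).1
  have hss : Linked q s s := ⟨hs', hs', .refl _⟩
  have hP : ∀ l ≤ N, Linked q s (vr [0, l]) := by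
    intro l
    induction l with
    | zero => exact fun _ => hss.forward r₀
    | succ l ih => exact fun h => (ih (by omega)).forward (h₁ l (by omega) _ _ ⟨rfl, rfl⟩)
  have hbit : ∀ p ∈ bs, (∀ b < 3, Linked q s (vr [4, p.1, p.2, b])) ∧
      (∀ b < 2, Linked q s (vr [5, p.1, p.2, b])) ∧ (∀ b < 2, Linked q s (vr [2, p.1, p.2, b])) ∧
      (∀ b < 2, ∀ c < 2, ∀ l ≤ N, Linked q s (vr [3, p.1, p.2, b, c, l])) ∧ Linked q s (vr [1]) := by
    rintro ⟨f, j⟩ hp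
    obtain ⟨hm, hl⟩ := mem_compareAtoms.1 (hcomp _ hp)
    simp only [markAtoms, List.forall_mem_cons] at hm
    obtain ⟨-, -, -, m₁, m₂, m₃, m₄, -⟩ := hm
    have w₀ := (hP N le_rfl).forward (m₁ _ _ ⟨rfl, rfl⟩)
    have u₀ := w₀.forward (m₂ _ _ ⟨rfl, rfl⟩)
    have block : ∀ b < 2, Linked q s (vr [4, f, j, b]) →
        (∀ c < 2, ∀ l ≤ N, Linked q s (vr [3, f, j, b, c, l])) ∧ Linked q s (vr [2, f, j, b]) ∧
          Linked q s (vr [4, f, j, b + 1]) := by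
      intro b hb hu
      obtain ⟨a₁, a₂, a₃⟩ := mem_legAtoms.1 (hl b hb 0 (by simp))
      obtain ⟨b₁, b₂, b₃⟩ := mem_legAtoms.1 (hl b hb 1 (by simp))
      -- Leg `0` is climbed from its end to the common top, against the direction of its edges; leg
      -- `1` is then descended.
      have down : ∀ l ≤ N, Linked q s (vr [3, f, j, b, 0, N - l]) := by
        intro l
        induction l with
        | zero => exact fun _ => hu.backward (a₂ _ _ ⟨rfl, rfl⟩)
        | succ l ih =>
          intro h
          have := a₃ (N - (l + 1)) (by omega) _ _ ⟨rfl, rfl⟩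
          rw [show N - (l + 1) + 1 = N - l by omega] at this
          exact (ih (by omega)).backward this
      have k₀ : ∀ l ≤ N, Linked q s (vr [3, f, j, b, 0, l]) := by
        intro l h
        have := down (N - l) (by omega)
        rwa [show N - (N - l) = l by omega] at this
      have top := (k₀ 0 (by omega)).backward (a₁ _ _ ⟨rfl, rfl⟩)
      have k₁ : ∀ l ≤ N, Linked q s (vr [3, f, j, b, 1, l]) := by
        intro l
        induction l with
        | zero => exact fun _ => top.forward (b₁ _ _ ⟨rfl, rfl⟩)
        | succ l ih => exact fun h => (ih (by omega)).forward (b₃ l (by omega) _ _ ⟨rfl, rfl⟩)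
      refine ⟨?_, top, (k₁ N le_rfl).forward (b₂ _ _ ⟨rfl, rfl⟩)⟩
      intro c hc
      interval_cases c
      · exact k₀
      · exact k₁
    obtain ⟨k₀, t₀, u₁⟩ := block 0 (by simp) u₀
    obtain ⟨k₁, t₁, u₂⟩ := block 1 (by simp) u₁
    have w₁ := u₂.backward (m₄ _ _ ⟨rfl, rfl⟩)
    refine ⟨?_, ?_, ?_, ?_, w₁.backward (m₃ _ _ ⟨rfl, rfl⟩)⟩
    · intro b hb
      interval_cases b
      exacts [u₀, u₁, u₂]
    · intro b hb
      interval_cases b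
      exacts [w₀, w₁]
    · intro b hb
      interval_cases b
      exacts [t₀, t₁]
    · intro b hb
      interval_cases b
      exacts [k₀, k₁]
  have all : ∀ t ∈ q.terms, Linked q s t := by
    intro t ht
    rw [hq, query, mem_conjunction_terms] at ht
    rcases ht with ⟨a, ha, ht⟩ | ht
    · rcases List.mem_append.1 ha with ha | ha
      · refine mem_pathAtoms (P := fun a => ∀ t ∈ a.terms, Linked q s t).2 ⟨?_, ?_⟩ a ha t ht
        · rintro t (rfl | rfl)
          exacts [hss, hP 0 (by omega)]
        · rintro l hl t (rfl | rfl)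
          exacts [hP l (by omega), hP (l + 1) (by omega)]
      · obtain ⟨p, hp, hap⟩ := List.mem_flatMap.1 ha
        obtain ⟨hu, hw, htop, hk, hY⟩ := hbit p hp
        refine mem_compareAtoms (P := fun a => ∀ t ∈ a.terms, Linked q s t).2 ⟨?_, ?_⟩ a hap t ht
        · simp only [markAtoms, List.forall_mem_cons]
          refine ⟨?_, ?_, ?_, ?_, ?_, ?_, ?_, by simp⟩
          · rintro t rfl; exact hu 0 (by simp)
          · rintro t rfl; exact hu 1 (by simp)
          · rintro t rfl; exact hu 2 (by simp)
          · rintro t (rfl | rfl)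
            exacts [hP N le_rfl, hw 0 (by simp)]
          · rintro t (rfl | rfl)
            exacts [hw 0 (by simp), hu 0 (by simp)]
          · rintro t (rfl | rfl)
            exacts [hY, hw 1 (by simp)]
          · rintro t (rfl | rfl)
            exacts [hw 1 (by simp), hu 2 (by simp)]
        · intro b hb c hc
          refine mem_legAtoms.2 ⟨?_, ?_, ?_⟩
          · rintro t (rfl | rfl)
            exacts [htop b hb, hk b hb c hc 0 (by omega)]
          · rintro t (rfl | rfl)
            exacts [hk b hb c hc N le_rfl, hu (b + c) (by omega)]
          · rintro l hl t (rfl | rfl)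
            exacts [hk b hb c hc l (by omega), hk b hb c hc (l + 1) (by omega)]
    · obtain ⟨p, hp⟩ := List.exists_mem_of_ne_nil _ hbs
      rcases ht with ht | ht <;> cases ht
      · exact hP N le_rfl
      · exact (hbit p hp).2.2.2.2
  refine ⟨⟨_, hs'⟩, ?_⟩
  have : Nonempty q.terms := ⟨⟨s, hs'⟩⟩
  refine SimpleGraph.Connected.mk fun x y => ?_
  obtain ⟨_, _, hx⟩ := all x.1 x.2
  obtain ⟨_, _, hy⟩ := all y.1 y.2
  exact hx.symm.trans hy

end DL.Reduction

-- Countermodels and families of valuations of the leaves.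

namespace DL.Reduction

/-! ### Models of the knowledge base without a match of the query

They correspond to families of valuations: `v z τ a` tells whether the concept name coded by `a`
holds at the leaf with the addresses given by `z` and type `τ`. -/

def Satisfies (v : List ℕ → Prop) (c : Clause) : Prop :=
  (∀ a ∈ c.1, v a) → ∃ a ∈ c.2, v a

/-- A family of valuations that satisfy the clauses such that no positive claim contradicts a
negative one. -/
structure IsFamily (N : ℕ) (τs : List (List ℕ)) (bs : List (ℕ × ℕ)) (Φ : List Clause)
    (v : (ℕ → Bool × Bool) → List ℕ → List ℕ → Prop) : Prop where
  type : ∀ z, ∀ τ ∈ τs, v z τ (3 :: τ)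
  fst : ∀ z, ∀ τ ∈ τs, ∀ j < N, v z τ [2, 0, (z j).1.toNat, j]
  snd : ∀ z, ∀ τ ∈ τs, ∀ j < N, v z τ [2, 1, (z j).2.toNat, j]
  sat : ∀ z, ∀ τ ∈ τs, ∀ c ∈ Φ, Satisfies (v z τ) c
  consistent : ∀ z, ∀ τ ∈ τs, ∀ z', ∀ τ' ∈ τs, v z τ [6] → v z' τ' [7] →
    ∃ p ∈ bs, ¬ (v z τ [4, p.1, p.2] ↔ v z' τ' [4, p.1, p.2])

theorem mem_clauseBody {Δ : Type} (I : Interp Δ) (d : Δ) (l : List (List ℕ)) :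
    d ∈ (clauseBody l).sem I ↔ (∀ a ∈ l, d ∈ I.con (mk a)) ∧ d ∈ I.con (mk [1]) := by
  induction l with
  | nil => simp [clauseBody, cn, Concept.sem]
  | cons a l ih => simp [clauseBody, cn, Concept.sem, ih, and_assoc]

theorem mem_clauseHead {Δ : Type} (I : Interp Δ) (d : Δ) (l : List (List ℕ)) :
    d ∈ (clauseHead l).sem I ↔ ∃ a ∈ l, d ∈ I.con (mk a) := by
  induction l with
  | nil => simp [clauseHead, Concept.sem]
  | cons a l ih =>
    simp only [clauseHead, cn, Concept.sem, Set.mem_compl_iff, Set.mem_inter_iff, ih,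
      List.exists_mem_cons_iff, not_and_or, not_not]

theorem clauseAxiom_holds {Δ : Type} (I : Interp Δ) (c : Clause) :
    (clauseAxiom c).Holds I ↔
      ∀ d ∈ I.con (mk [1]), Satisfies (fun a => d ∈ I.con (mk a)) c := by
  simp only [clauseAxiom, TAxiom.Holds, Set.subset_def, mem_clauseBody, mem_clauseHead, Satisfies]
  exact ⟨fun h d hd hb => h d ⟨hb, hd⟩, fun h d hd => h d hd.2 hd.1⟩

section Model

variable {Δ : Type} {I : Interp Δ} {N : ℕ} {τs : List (List ℕ)} {bs : List (ℕ × ℕ)}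
  {Φ : List Clause}

theorem holds_of_mem (h : (kb N τs bs Φ).Models I) :
    (I.ind (mk []) ∈ I.con (mk [0, 0])) ∧ (∀ c ∈ Φ, (clauseAxiom c).Holds I) ∧
      (∀ j < N, ∀ α ∈ levelAxioms j, α.Holds I) ∧ (∀ τ ∈ τs, (leafAxiom N τ).Holds I) ∧
      (∀ p ∈ bs, (oneAxiom p.1 p.2).Holds I ∧ (zeroAxiom p.1 p.2).Holds I) ∧
      loopAxiom.Holds I := by
  obtain ⟨ha, ht⟩ := h
  refine ⟨ha _ (List.mem_singleton.2 rfl), fun c hc => ht _ ?_, fun j hj α hα => ht _ ?_,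
    fun τ hτ => ht _ ?_, fun p hp => ⟨ht _ ?_, ht _ ?_⟩, ht _ ?_⟩
  · simp only [kb, List.mem_append]
    exact Or.inl (List.mem_map_of_mem hc)
  · simp only [kb, List.mem_append]
    exact Or.inr (Or.inl (List.mem_flatMap.2 ⟨j, by simpa using hj, hα⟩))
  · simp only [kb, List.mem_append]
    exact Or.inr (Or.inr (Or.inl (List.mem_map_of_mem hτ)))
  · simp only [kb, List.mem_append]
    exact Or.inr (Or.inr (Or.inr (Or.inl (List.mem_flatMap.2 ⟨p, hp, by simp⟩))))
  · simp only [kb, List.mem_append]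
    exact Or.inr (Or.inr (Or.inr (Or.inl (List.mem_flatMap.2 ⟨p, hp, by simp⟩))))
  · simp [kb]

/-- The conditions stand behind the quantifier so that `choose` yields a total function; `d` itself
is the junk value. -/
theorem exists_child (h : (kb N τs bs Φ).Models I) (d : Δ) (j : ℕ) (b : Bool × Bool) :
    ∃ e, j < N → d ∈ I.con (mk [0, j]) → (d, e) ∈ I.rol (mk [0]) ∧ e ∈ I.con (mk [0, j + 1]) ∧
      e ∈ I.con (mk [2, 0, b.1.toNat, j]) ∧ e ∈ I.con (mk [2, 1, b.2.toNat, j]) := by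
  by_cases hj : j < N
  · by_cases hd : d ∈ I.con (mk [0, j])
    · have hs : (splitAxiom j b.1.toNat b.2.toNat).Holds I := by
        apply (holds_of_mem h).2.2.1 j hj
        rcases b with ⟨_ | _, _ | _⟩ <;> simp [levelAxioms]
      obtain ⟨e, ⟨he₁, he₂, he₃⟩, he⟩ := hs hd
      exact ⟨e, fun _ _ => ⟨he, he₁, he₂, he₃⟩⟩
    · exact ⟨d, fun _ h => absurd h hd⟩
  · exact ⟨d, fun h => absurd h hj⟩

theorem exists_leaf (h : (kb N τs bs Φ).Models I) (d : Δ) (τ : List ℕ) :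
    ∃ e, τ ∈ τs → d ∈ I.con (mk [0, N]) → (d, e) ∈ I.rol (mk [0]) ∧ e ∈ I.con (mk [1]) ∧
      e ∈ I.con (mk (3 :: τ)) := by
  by_cases hτ : τ ∈ τs
  · by_cases hd : d ∈ I.con (mk [0, N])
    · obtain ⟨e, ⟨he₁, he₂⟩, he⟩ := (holds_of_mem h).2.2.2.1 τ hτ hd
      exact ⟨e, fun _ _ => ⟨he, he₁, he₂⟩⟩
    · exact ⟨d, fun _ h => absurd h hd⟩
  · exact ⟨d, fun h => absurd h hτ⟩

theorem exists_bit (h : (kb N τs bs Φ).Models I) (d : Δ) (f j : ℕ) :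
    ∃ e, (f, j) ∈ bs → d ∈ I.con (mk [1]) → e ∈ I.con (mk [5, f, j]) ∧ (e, e) ∈ I.rol (mk [0]) ∧
      ((d ∈ I.con (mk [4, f, j]) ∧ (d, e) ∈ I.rol (mk [1, 1]) ∧ (e, e) ∈ I.rol (mk [1, 0])) ∨
        (d ∉ I.con (mk [4, f, j]) ∧ (d, e) ∈ I.rol (mk [1, 0]) ∧ (e, e) ∈ I.rol (mk [1, 1]))) := by
  by_cases hp : (f, j) ∈ bs
  · by_cases hd : d ∈ I.con (mk [1])
    · by_cases hV : d ∈ I.con (mk [4, f, j])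
      · obtain ⟨e, ⟨he₁, he₂, he₃⟩, he⟩ := ((holds_of_mem h).2.2.2.2.1 _ hp).1 ⟨hd, hV⟩
        exact ⟨e, fun _ _ => ⟨he₁, he₂, Or.inl ⟨hV, he, he₃⟩⟩⟩
      · obtain ⟨e, ⟨he₁, he₂, he₃⟩, he⟩ := ((holds_of_mem h).2.2.2.2.1 _ hp).2 ⟨hd, hV⟩
        exact ⟨e, fun _ _ => ⟨he₁, he₂, Or.inr ⟨hV, he, he₃⟩⟩⟩
    · exact ⟨d, fun _ h => absurd h hd⟩
  · exact ⟨d, fun h => absurd h hp⟩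

/-- The values of the variables of the query, for leaves `P N` and `Y` with the same bits:
`x f j` and `y f j` represent these bits, `Q` is the path to `Y`, and `V f j` is the value. -/
noncomputable def matchValue (a : Δ) (P Q : ℕ → Δ) (X Y : Δ) (x y : ℕ → ℕ → Δ) (V : ℕ → ℕ → Prop) :
    List ℕ → Δ
  | [0, l] => P l
  | [1] => Y
  | [2, f, j, 0] => open Classical in if V f j then x f j else a
  | [2, f, j, 1] => open Classical in if V f j then a else y f j
  | [3, f, j, 0, 0, l] => open Classical in if V f j then x f j else P l
  | [3, f, j, 0, 1, l] => open Classical in if V f j then x f j else Q l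
  | [3, f, j, 1, 0, l] => open Classical in if V f j then P l else y f j
  | [3, f, j, 1, 1, l] => open Classical in if V f j then Q l else y f j
  | [4, f, j, 0] => x f j
  | [4, f, j, 1] => open Classical in if V f j then x f j else y f j
  | [4, f, j, 2] => y f j
  | [5, f, j, 0] => open Classical in if V f j then X else x f j
  | [5, f, j, 1] => open Classical in if V f j then Y else y f j
  | _ => a

/-- If the common value of a bit is 1, block `0` collapses to the bit node of the first leaf, and
block `1` unfolds from the root along `P` and `Q` to the two leaves and their bit nodes. If the
value is 0, block `0` unfolds and block `1` collapses to the bit node of the second leaf. -/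
theorem query_holds_of_eq_bits (h : (kb N τs bs Φ).Models I) (P Q : ℕ → Δ)
    (hP₀ : (I.ind (mk []), P 0) ∈ I.rol (mk [0])) (hQ₀ : (I.ind (mk []), Q 0) ∈ I.rol (mk [0]))
    (hP : ∀ l < N, (P l, P (l + 1)) ∈ I.rol (mk [0]))
    (hQ : ∀ l < N, (Q l, Q (l + 1)) ∈ I.rol (mk [0]))
    (hPN : P N ∈ I.con (mk [1])) (hQN : Q N ∈ I.con (mk [1]))
    (hpos : P N ∈ I.con (mk [6])) (hneg : Q N ∈ I.con (mk [7]))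
    (hV : ∀ p ∈ bs, P N ∈ I.con (mk [4, p.1, p.2]) ↔ Q N ∈ I.con (mk [4, p.1, p.2])) :
    ∃ η, (query N bs).Holds I η := by
  classical
  choose bit hbit using exists_bit h
  set F := matchValue (I.ind (mk [])) P Q (P N) (Q N) (bit (P N)) (bit (Q N))
    (fun f j => P N ∈ I.con (mk [4, f, j])) with hF
  have hη : ∀ l, (vr l).sem I (fun n => F (unmk n)) = F l := fun l => by
    simp [vr, Term.sem]
  have hloop : ∀ d ∈ I.con (mk [1]), (d, d) ∈ I.rol (mk [1, 0]) ∧ (d, d) ∈ I.rol (mk [1, 1]) :=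
    fun d hd => (holds_of_mem h).2.2.2.2.2 hd
  have hedge : ∀ t u, (edgeAtom t u).Holds I (fun n => F (unmk n)) ↔
      (t.sem I (fun n => F (unmk n)), u.sem I (fun n => F (unmk n))) ∈ I.rol (mk [0]) :=
    fun t u => Iff.rfl
  have hbitA : ∀ b t u, (bitAtom b t u).Holds I (fun n => F (unmk n)) ↔
      (t.sem I (fun n => F (unmk n)), u.sem I (fun n => F (unmk n))) ∈ I.rol (mk [1, b]) :=
    fun b t u => Iff.rfl
  refine ⟨fun n => F (unmk n), (conjunction_holds _ _ _ _).2 ⟨?_, ?_, ?_⟩⟩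
  · intro a ha
    rcases List.mem_append.1 ha with ha | ha
    · refine mem_pathAtoms (P := fun a => a.Holds I _).2 ⟨?_, ?_⟩ a ha
      · rw [hedge, hη]
        exact hP₀
      · intro l hl
        rw [hedge, hη, hη]
        exact hP l hl
    · obtain ⟨⟨f, j⟩, hp, ha⟩ := List.mem_flatMap.1 ha
      obtain ⟨x₁, x₂, x₃⟩ := hbit (P N) f j hp hPN
      obtain ⟨y₁, y₂, y₃⟩ := hbit (Q N) f j hp hQN
      have hVp := hV _ hp
      refine mem_compareAtoms (P := fun a => a.Holds I _).2 ⟨?_, ?_⟩ a ha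
      · simp only [markAtoms, List.forall_mem_cons, hbitA, hη, CQ.Holds]
        by_cases hv : P N ∈ I.con (mk [4, f, j])
        · simp only [hv, hVp.1 hv, true_and, not_true_eq_false, false_and, or_false] at x₃ y₃
          simp only [hF, matchValue, hv, if_true]
          exact ⟨x₁, x₁, y₁, (hloop _ hPN).1, x₃.1, (hloop _ hQN).1, y₃.1, by simp⟩
        · simp only [hv, mt hVp.2 hv, not_false_eq_true, true_and, false_and, false_or] at x₃ y₃
          simp only [hF, matchValue, hv, if_false]
          exact ⟨x₁, y₁, y₁, x₃.1, x₃.2, y₃.1, y₃.2, by simp⟩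
      · intro b hb c hc
        refine mem_legAtoms.2 ?_
        by_cases hv : P N ∈ I.con (mk [4, f, j])
        · simp only [hv, hVp.1 hv, true_and, not_true_eq_false, false_and, or_false] at x₃ y₃
          interval_cases b <;> interval_cases c <;>
            simp only [hedge, hbitA, hη, Nat.add_zero, zero_add, Nat.reduceAdd] <;>
            simp only [hF, matchValue, hv, if_true]
          exacts [⟨x₂, x₃.2, fun _ _ => x₂⟩, ⟨x₂, x₃.2, fun _ _ => x₂⟩, ⟨hP₀, x₃.1, hP⟩,
            ⟨hQ₀, y₃.1, hQ⟩]
        · simp only [hv, mt hVp.2 hv, not_false_eq_true, true_and, false_and, false_or] at x₃ y₃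
          interval_cases b <;> interval_cases c <;>
            simp only [hedge, hbitA, hη, Nat.add_zero, zero_add, Nat.reduceAdd] <;>
            simp only [hF, matchValue, hv, if_false]
          exacts [⟨hP₀, x₃.1, hP⟩, ⟨hQ₀, y₃.1, hQ⟩, ⟨y₂, y₃.2, fun _ _ => y₂⟩,
            ⟨y₂, y₃.2, fun _ _ => y₂⟩]
  · change (vr [0, N]).sem I _ ∈ I.con (mk [6])
    rw [hη]
    exact hpos
  · change (vr [1]).sem I _ ∈ I.con (mk [7])
    rw [hη]
    exact hneg

/-- Following the choices `z` down from the root reaches, for each type, a leaf with these address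
bits; the valuation is read off there. Contradictory claims at two leaves would yield a match of the
query. -/
theorem exists_family_of_model (h : (kb N τs bs Φ).Models I)
    (hq : ¬ ∃ η, (query N bs).Holds I η) : ∃ v, IsFamily N τs bs Φ v := by
  choose nx hnx using exists_child h
  choose lf hlf using exists_leaf h
  obtain ⟨hroot, hΦ, hlevel, -, -, -⟩ := holds_of_mem h
  let node : (ℕ → Bool × Bool) → ℕ → Δ := fun z l =>
    Nat.rec (I.ind (mk [])) (fun l d => nx d l (z l)) l
  have hnode : ∀ z l, l ≤ N → node z l ∈ I.con (mk [0, l]) := by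
    intro z l
    induction l with
    | zero => exact fun _ => hroot
    | succ l ih => exact fun hl => (hnx (node z l) l (z l) (by omega) (ih (by omega))).2.1
  have hstep : ∀ z l, l < N → (node z l, node z (l + 1)) ∈ I.rol (mk [0]) := fun z l hl =>
    (hnx (node z l) l (z l) hl (hnode z l hl.le)).1
  have hinh : ∀ f b j, f < 2 → b < 2 → j < N → ∀ d e, d ∈ I.con (mk [2, f, b, j]) →
      (d, e) ∈ I.rol (mk [0]) → e ∈ I.con (mk [2, f, b, j]) := by
    intro f b j hf hb hj d e hd hde
    have hs : (inheritAxiom f b j).Holds I := by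
      apply hlevel j hj
      interval_cases f <;> interval_cases b <;> simp [levelAxioms]
    by_contra he
    exact hs hd ⟨e, he, hde⟩
  have hlt : ∀ b : Bool, b.toNat < 2 := by decide
  have hbits : ∀ z j l, j < l → l ≤ N → node z l ∈ I.con (mk [2, 0, (z j).1.toNat, j]) ∧
      node z l ∈ I.con (mk [2, 1, (z j).2.toNat, j]) := by
    intro z j l hjl
    induction l, hjl using Nat.le_induction with
    | base => exact fun hl => (hnx (node z j) j (z j) (by omega) (hnode z j (by omega))).2.2
    | succ l hjl ih =>
      intro hl
      have := ih (by omega)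
      exact ⟨hinh _ _ _ (by simp) (hlt _) (by omega) _ _ this.1 (hstep z l (by omega)),
        hinh _ _ _ (by simp) (hlt _) (by omega) _ _ this.2 (hstep z l (by omega))⟩
  have hleaf := fun z τ hτ => hlf (node z N) τ hτ (hnode z N le_rfl)
  refine ⟨fun z τ a => lf (node z N) τ ∈ I.con (mk a), ?_, ?_, ?_, ?_, ?_⟩
  · exact fun z τ hτ => (hleaf z τ hτ).2.2
  · exact fun z τ hτ j hj => hinh _ _ _ (by simp) (hlt _) hj _ _ (hbits z j N hj le_rfl).1
      (hleaf z τ hτ).1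
  · exact fun z τ hτ j hj => hinh _ _ _ (by simp) (hlt _) hj _ _ (hbits z j N hj le_rfl).2
      (hleaf z τ hτ).1
  · exact fun z τ hτ c hc => (clauseAxiom_holds I c).1 (hΦ c hc) _ (hleaf z τ hτ).2.1
  · intro z τ hτ z' τ' hτ' hpos hneg
    by_contra hcon
    push Not at hcon
    apply hq
    have key : ∀ z, ∀ τ ∈ τs, ∃ P : ℕ → Δ, (I.ind (mk []), P 0) ∈ I.rol (mk [0]) ∧
        (∀ l < N, (P l, P (l + 1)) ∈ I.rol (mk [0])) ∧ P N = lf (node z N) τ := by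
      intro z τ hτ
      -- The path omits the root, so its entries are shifted by one level and entry `N` is the leaf;
      -- for `N = 0` the leaf is a child of the root.
      refine ⟨fun l => if l < N then node z (l + 1) else lf (node z N) τ, ?_, ?_, by simp⟩
      · by_cases hN : 0 < N
        · simp only [hN, if_true]
          exact hstep z 0 hN
        · obtain rfl : N = 0 := by omega
          exact (hleaf z τ hτ).1
      · intro l hl
        by_cases hl' : l + 1 < N
        · simpa [hl, hl'] using hstep z (l + 1) hl'
        · have e : l + 1 = N := by omega
          simp only [hl, hl', if_true, if_false]
          rw [e]
          exact (hleaf z τ hτ).1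
    obtain ⟨P, hP₀, hP, hPN⟩ := key z τ hτ
    obtain ⟨Q, hQ₀, hQ, hQN⟩ := key z' τ' hτ'
    refine query_holds_of_eq_bits h P Q hP₀ hQ₀ hP hQ ?_ ?_ ?_ ?_ ?_
    · rw [hPN]; exact (hleaf z τ hτ).2.1
    · rw [hQN]; exact (hleaf z' τ' hτ').2.1
    · rw [hPN]; exact hpos
    · rw [hQN]; exact hneg
    · rw [hPN, hQN]; exact hcon

end Model

/-! ### The model given by a family of valuations -/

/-- An inner node carries all of `z`, although `nodeEdge` preserves only the entries below its
level. Several nodes may thus stand for one position of the tree, which does no harm. -/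
inductive Node where
  | inner (l : ℕ) (z : ℕ → Bool × Bool)
  | leaf (z : ℕ → Bool × Bool) (τ : List ℕ)
  | bit (z : ℕ → Bool × Bool) (τ : List ℕ) (f j : ℕ)

def innerCon (l : ℕ) (z : ℕ → Bool × Bool) : List ℕ → Prop
  | [0, j] => l = j
  | [2, 0, b, j] => j < l ∧ b = (z j).1.toNat
  | [2, 1, b, j] => j < l ∧ b = (z j).2.toNat
  | _ => False

/-- Leaves of a type outside `τs` are in the domain but satisfy no concept name. -/
def nodeCon (τs : List (List ℕ)) (v : (ℕ → Bool × Bool) → List ℕ → List ℕ → Prop) (a : List ℕ) :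
    Node → Prop
  | .inner l z => innerCon l z a
  | .leaf z τ => τ ∈ τs ∧ v z τ a
  | .bit _ _ f j => a = [5, f, j]

def nodeEdge (N : ℕ) (τs : List (List ℕ)) : Node → Node → Prop
  | .inner l z, .inner m z' => l < N ∧ m = l + 1 ∧ ∀ j < l, z' j = z j
  | .inner l z, .leaf z' τ => l = N ∧ z' = z ∧ τ ∈ τs
  | .bit z τ f j, n => n = .bit z τ f j
  | _, _ => False

def nodeBit (v : (ℕ → Bool × Bool) → List ℕ → List ℕ → Prop) (b : ℕ) : Node → Node → Prop
  | .leaf z τ, .leaf z' τ' => z = z' ∧ τ = τ'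
  | .leaf z τ, .bit z' τ' f j => z = z' ∧ τ = τ' ∧ (v z τ [4, f, j] ↔ b = 1)
  | .bit z τ f j, n => n = .bit z τ f j ∧ ¬ (v z τ [4, f, j] ↔ b = 1)
  | _, _ => False

def nodeRole (N : ℕ) (τs : List (List ℕ)) (v : (ℕ → Bool × Bool) → List ℕ → List ℕ → Prop) :
    List ℕ → Node → Node → Prop
  | [0] => nodeEdge N τs
  | [1, b] => nodeBit v b
  | _ => fun _ _ => False

/-- The interpretation given by a family of valuations. -/
noncomputable def treeInterp (N : ℕ) (τs : List (List ℕ))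
    (v : (ℕ → Bool × Bool) → List ℕ → List ℕ → Prop) : Interp Node where
  ind _ := .inner 0 fun _ => (false, false)
  con A := {n | nodeCon τs v (unmk A) n}
  rol r := {p | nodeRole N τs v (unmk r) p.1 p.2}

section TreeInterp

variable {N : ℕ} {τs : List (List ℕ)} {bs : List (ℕ × ℕ)} {Φ : List Clause}
  {v : (ℕ → Bool × Bool) → List ℕ → List ℕ → Prop}

@[simp] theorem mem_con (a : List ℕ) (n : Node) :
    n ∈ (treeInterp N τs v).con (mk a) ↔ nodeCon τs v a n := by
  simp [treeInterp]

@[simp] theorem mem_edge (n m : Node) :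
    (n, m) ∈ (treeInterp N τs v).rol (mk [0]) ↔ nodeEdge N τs n m := by
  simp [treeInterp, nodeRole]

@[simp] theorem mem_bit (b : ℕ) (n m : Node) :
    (n, m) ∈ (treeInterp N τs v).rol (mk [1, b]) ↔ nodeBit v b n m := by
  simp [treeInterp, nodeRole]

theorem treeInterp_splitAxiom (h₀ : ∀ z τ j, ¬ v z τ [0, j]) (j : ℕ) (hj : j < N) (b c : Bool) :
    (splitAxiom j b.toNat c.toNat).Holds (treeInterp N τs v) := by
  rintro (⟨l, z⟩ | ⟨z, τ⟩ | ⟨z, τ, f, i⟩) hn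
  · simp only [cn, Concept.sem, mem_con, nodeCon, innerCon] at hn
    subst hn
    -- Overwriting entry `l` keeps the entries below `l`, as an edge requires.
    refine ⟨.inner (l + 1) (Function.update z l (b, c)), ⟨?_, ?_, ?_⟩, ?_⟩
    · simp [cn, Concept.sem, nodeCon, innerCon]
    · simp [cn, Concept.sem, nodeCon, innerCon]
    · simp [cn, Concept.sem, nodeCon, innerCon]
    · simp only [edge, SRole.sem, mem_edge, nodeEdge]
      refine ⟨hj, by trivial, fun i hi => Function.update_of_ne hi.ne _ _⟩
  · simp [cn, Concept.sem, nodeCon, h₀] at hn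
  · simp [cn, Concept.sem, nodeCon] at hn

theorem treeInterp_inheritAxiom (h : IsFamily N τs bs Φ v) (j : ℕ) (f b : ℕ)
    (hf : f < 2) : (inheritAxiom f b j).Holds (treeInterp N τs v) := by
  rintro n hn ⟨m, hm, hnm⟩
  simp only [edge, SRole.sem, mem_edge] at hnm
  apply hm
  simp only [cn, Concept.sem, mem_con] at hn ⊢
  rcases n with ⟨l, z⟩ | ⟨z, τ⟩ | ⟨z, τ, f', i⟩
  · rcases m with ⟨l', z'⟩ | ⟨z', τ⟩ | ⟨z', τ, f', i⟩
    · simp only [nodeEdge] at hnm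
      obtain ⟨-, rfl, hz⟩ := hnm
      interval_cases f <;> simp only [nodeCon, innerCon] at hn ⊢ <;> rw [hz j hn.1] <;>
        exact ⟨by omega, hn.2⟩
    · simp only [nodeEdge] at hnm
      obtain ⟨rfl, rfl, hτ⟩ := hnm
      interval_cases f <;> simp only [nodeCon, innerCon] at hn ⊢ <;> rw [hn.2]
      · exact ⟨hτ, h.fst _ _ hτ _ hn.1⟩
      · exact ⟨hτ, h.snd _ _ hτ _ hn.1⟩
    · simp [nodeEdge] at hnm
  · simp [nodeEdge] at hnm
  · simp [nodeCon] at hn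

theorem treeInterp_models (h : IsFamily N τs bs Φ v) (h₀ : ∀ z τ j, ¬ v z τ [0, j])
    (h₁ : ∀ z τ, v z τ [1]) : (kb N τs bs Φ).Models (treeInterp N τs v) := by
  constructor
  · intro α hα
    obtain rfl := List.mem_singleton.1 hα
    simp only [AAxiom.Holds, mem_con]
    exact (rfl : (0 : ℕ) = 0)
  · intro α hα
    simp only [kb, List.mem_append, List.mem_map, List.mem_flatMap, levelAxioms] at hα
    rcases hα with ⟨c, hc, rfl⟩ | ⟨j, hj, hα⟩ | ⟨τ, hτ, rfl⟩ | ⟨p, -, hα⟩ | hα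
    · rw [clauseAxiom_holds]
      rintro (⟨l, z⟩ | ⟨z, τ⟩ | ⟨z, τ, f, i⟩) hn
      · simp [nodeCon, innerCon] at hn
      · simp only [mem_con, nodeCon] at hn
        have := h.sat z τ hn.1 c hc
        simpa [Satisfies, nodeCon, hn.1] using this
      · simp [nodeCon] at hn
    · have hj : j < N := by simpa using hj
      simp only [List.mem_cons, List.not_mem_nil, or_false] at hα
      rcases hα with rfl | rfl | rfl | rfl | rfl | rfl | rfl | rfl
      · exact treeInterp_splitAxiom h₀ j hj false false
      · exact treeInterp_splitAxiom h₀ j hj false true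
      · exact treeInterp_splitAxiom h₀ j hj true false
      · exact treeInterp_splitAxiom h₀ j hj true true
      all_goals exact treeInterp_inheritAxiom h j _ _ (by simp)
    · rintro (⟨l, z⟩ | ⟨z, τ'⟩ | ⟨z, τ', f, i⟩) hn
      · simp only [cn, Concept.sem, mem_con, nodeCon, innerCon] at hn
        refine ⟨.leaf z τ, ⟨?_, ?_⟩, ?_⟩
        · simpa [cn, Concept.sem, nodeCon, hτ] using h₁ z τ
        · simpa [cn, Concept.sem, nodeCon, hτ] using h.type z τ hτ
        · simpa [edge, SRole.sem, nodeEdge, hτ] using hn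
      · simp [cn, Concept.sem, nodeCon, h₀] at hn
      · simp [cn, Concept.sem, nodeCon] at hn
    · simp only [List.mem_cons, List.not_mem_nil, or_false] at hα
      rcases hα with rfl | rfl
      · rintro (⟨l, z⟩ | ⟨z, τ⟩ | ⟨z, τ, f, i⟩) hn
        · simp [cn, Concept.sem, nodeCon, innerCon] at hn
        · simp only [cn, Concept.sem, Set.mem_inter_iff, mem_con, nodeCon] at hn
          exact ⟨.bit z τ p.1 p.2, by simp [cn, Concept.sem, SRole.sem, edge, bitRole, nodeCon,
            nodeEdge, nodeBit, hn.2.2], by simp [bitRole, SRole.sem, nodeBit, hn.2.2]⟩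
        · simp [cn, Concept.sem, nodeCon] at hn
      · rintro (⟨l, z⟩ | ⟨z, τ⟩ | ⟨z, τ, f, i⟩) hn
        · simp [cn, Concept.sem, nodeCon, innerCon] at hn
        · simp only [cn, Concept.sem, Set.mem_inter_iff, mem_con, nodeCon, Set.mem_compl_iff] at hn
          have hV : ¬ v z τ [4, p.1, p.2] := fun h => hn.2 ⟨hn.1.1, h⟩
          exact ⟨.bit z τ p.1 p.2, by simp [cn, Concept.sem, SRole.sem, edge, bitRole, nodeCon,
            nodeEdge, nodeBit, hV], by simp [bitRole, SRole.sem, nodeBit, hV]⟩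
        · simp [cn, Concept.sem, nodeCon] at hn
    · simp only [List.mem_cons, List.not_mem_nil, or_false] at hα
      subst hα
      rintro (⟨l, z⟩ | ⟨z, τ⟩ | ⟨z, τ, f, i⟩) hn
      · simp [cn, Concept.sem, nodeCon, innerCon] at hn
      · simp [Concept.sem, SRole.sem, bitRole, nodeBit]
      · simp [cn, Concept.sem, nodeCon] at hn

/-- The only edges at bit nodes are loops. Hence if one node of a leg is a given bit node, all of
them are. -/
theorem nodeEdge_bit {n m : Node} (h : nodeEdge N τs n m) (z : ℕ → Bool × Bool) (τ : List ℕ)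
    (f j : ℕ) : n = .bit z τ f j ↔ m = .bit z τ f j := by
  constructor
  · rintro rfl
    exact h
  · rintro rfl
    rcases n with ⟨l, z'⟩ | ⟨z', τ'⟩ | ⟨z', τ', f', i⟩
    · simp [nodeEdge] at h
    · simp [nodeEdge] at h
    · simpa [nodeEdge] using h.symm

/-- A step into a bit node either comes from its own leaf, and then the role reveals the value, or
is a loop. -/
theorem nodeBit_to_bit {b : ℕ} {n : Node} {z : ℕ → Bool × Bool} {τ : List ℕ} {f j : ℕ}
    (h : nodeBit v b n (.bit z τ f j)) :
    (n = .leaf z τ ∧ (v z τ [4, f, j] ↔ b = 1)) ∨ n = .bit z τ f j := by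
  rcases n with ⟨l, z'⟩ | ⟨z', τ'⟩ | ⟨z', τ', f', i⟩
  · simp [nodeBit] at h
  · simp only [nodeBit] at h
    obtain ⟨rfl, rfl, h⟩ := h
    exact Or.inl ⟨rfl, h⟩
  · exact Or.inr h.1.symm

theorem nodeCon_bit (h₅ : ∀ z τ f j, ¬ v z τ [5, f, j]) {n : Node} {f j : ℕ}
    (h : nodeCon τs v [5, f, j] n) : ∃ z τ, n = .bit z τ f j := by
  rcases n with ⟨l, z⟩ | ⟨z, τ⟩ | ⟨z, τ, f', i⟩
  · simp [nodeCon, innerCon] at h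
  · simp [nodeCon, h₅] at h
  · simp only [nodeCon, List.cons.injEq, true_and, and_true] at h
    obtain ⟨rfl, rfl⟩ := h
    exact ⟨z, τ, rfl⟩

theorem eq_of_link {z : ℕ → Bool × Bool} {τ : List ℕ} {w : Node} {z' : ℕ → Bool × Bool}
    {τ' : List ℕ} {f j b c : ℕ} (h : nodeBit v b (.leaf z τ) w)
    (h' : nodeBit v c w (.bit z' τ' f j)) : z = z' ∧ τ = τ' := by
  rcases nodeBit_to_bit h' with ⟨rfl, -⟩ | rfl
  · exact h
  · exact ⟨h.1, h.2.1⟩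

/-- A match picks a positive and a negative claim, which differ in some bit by consistency. The two
blocks for this bit force its values at the two leaves to agree, a contradiction. -/
theorem treeInterp_not_holds (h : IsFamily N τs bs Φ v) (h₅ : ∀ z τ f j, ¬ v z τ [5, f, j])
    (η : Name → Node) : ¬ (query N bs).Holds (treeInterp N τs v) η := by
  intro hq
  rw [query, conjunction_holds] at hq
  obtain ⟨hatoms, hpos, hneg⟩ := hq
  simp only [CQ.Holds, mem_con] at hpos hneg
  have leaf_of : ∀ n a, (a = 6 ∨ a = 7) → nodeCon τs v [a] n →
      ∃ z, ∃ τ ∈ τs, n = .leaf z τ ∧ v z τ [a] := by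
    rintro (⟨l, z⟩ | ⟨z, τ⟩ | ⟨z, τ, f, i⟩) a ha hn
    · rcases ha with rfl | rfl <;> simp [nodeCon, innerCon] at hn
    · exact ⟨z, τ, hn.1, rfl, hn.2⟩
    · simp [nodeCon] at hn
  obtain ⟨z, τ, hτ, hX, hpos⟩ := leaf_of _ _ (Or.inl rfl) hpos
  obtain ⟨z', τ', hτ', hY, hneg⟩ := leaf_of _ _ (Or.inr rfl) hneg
  obtain ⟨⟨f, j⟩, hp, hV⟩ := h.consistent z τ hτ z' τ' hτ' hpos hneg
  apply hV
  obtain ⟨hm, hl⟩ := mem_compareAtoms.1 fun a ha =>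
    hatoms a (List.mem_append_right _ (List.mem_flatMap.2 ⟨_, hp, ha⟩))
  simp only [markAtoms, List.forall_mem_cons, CQ.Holds, bitAtom, mem_con, mem_bit, hX, hY] at hm
  obtain ⟨hu₀, hu₁, hu₂, m₁, m₂, m₃, m₄, -⟩ := hm
  have block : ∀ b < 2, ∀ z₀ τ₀ z₁ τ₁,
      (vr [4, f, j, b]).sem (treeInterp N τs v) η = .bit z₀ τ₀ f j →
      (vr [4, f, j, b + 1]).sem (treeInterp N τs v) η = .bit z₁ τ₁ f j →
      (v z₀ τ₀ [4, f, j] ↔ v z₁ τ₁ [4, f, j]) := by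
    intro b hb z₀ τ₀ z₁ τ₁ e₀ e₁
    have leg : ∀ c < 2, ∀ z₂ τ₂,
        (vr [2, f, j, b]).sem (treeInterp N τs v) η = .bit z₂ τ₂ f j ↔
          (vr [3, f, j, b, c, N]).sem (treeInterp N τs v) η = .bit z₂ τ₂ f j := by
      intro c hc z₂ τ₂
      obtain ⟨a₁, -, a₃⟩ := mem_legAtoms.1 (hl b hb c hc)
      simp only [edgeAtom, CQ.Holds, mem_edge] at a₁ a₃
      have : ∀ l ≤ N, (vr [2, f, j, b]).sem (treeInterp N τs v) η = .bit z₂ τ₂ f j ↔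
          (vr [3, f, j, b, c, l]).sem (treeInterp N τs v) η = .bit z₂ τ₂ f j := by
        intro l
        induction l with
        | zero => exact fun _ => nodeEdge_bit a₁ _ _ _ _
        | succ l ih => exact fun h => (ih (by omega)).trans (nodeEdge_bit (a₃ l (by omega)) _ _ _ _)
      exact this N le_rfl
    have b₀ := (mem_legAtoms.1 (hl b hb 0 (by simp))).2.1
    have b₁ := (mem_legAtoms.1 (hl b hb 1 (by simp))).2.1
    simp only [bitAtom, CQ.Holds, mem_bit, Nat.add_zero, e₀, e₁] at b₀ b₁
    -- If both legs end in leaves, both values are `b`. If one ends in a bit node, the common top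
    -- carries this over to the other leg; steps out of bit nodes being loops, the two ends
    -- coincide.
    rcases nodeBit_to_bit b₀ with ⟨-, i₀⟩ | i₀
    · rcases nodeBit_to_bit b₁ with ⟨-, i₁⟩ | i₁
      · rw [i₀, i₁]
      · rw [(leg 0 (by simp) _ _).1 ((leg 1 (by simp) _ _).2 i₁)] at b₀
        have := b₀.1
        simp only [Node.bit.injEq, and_true] at this
        rw [this.1, this.2]
    · rw [(leg 1 (by simp) _ _).1 ((leg 0 (by simp) _ _).2 i₀)] at b₁
      have := b₁.1
      simp only [Node.bit.injEq, and_true] at this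
      rw [this.1, this.2]
  obtain ⟨z₀, τ₀, e₀⟩ := nodeCon_bit h₅ hu₀
  obtain ⟨z₁, τ₁, e₁⟩ := nodeCon_bit h₅ hu₁
  obtain ⟨z₂, τ₂, e₂⟩ := nodeCon_bit h₅ hu₂
  rw [e₀] at m₂
  rw [e₂] at m₄
  obtain ⟨rfl, rfl⟩ := eq_of_link m₁ m₂
  obtain ⟨rfl, rfl⟩ := eq_of_link m₃ m₄
  exact (block 0 (by simp) _ _ _ _ e₀ e₁).trans (block 1 (by simp) _ _ _ _ e₁ e₂)

end TreeInterp

/-- `IsFamily` leaves open the names that mark levels, leaves and bit nodes; the three further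
conditions fix them at the leaves. -/
theorem not_entails_of_family {N : ℕ} {τs : List (List ℕ)} {bs : List (ℕ × ℕ)} {Φ : List Clause}
    {v : (ℕ → Bool × Bool) → List ℕ → List ℕ → Prop} (h : IsFamily N τs bs Φ v)
    (h₀ : ∀ z τ j, ¬ v z τ [0, j]) (h₁ : ∀ z τ, v z τ [1]) (h₅ : ∀ z τ f j, ¬ v z τ [5, f, j]) :
    ¬ (kb N τs bs Φ).Entails (query N bs) := fun he =>
  let ⟨η, hη⟩ := he _ _ (treeInterp_models h h₀ h₁)
  treeInterp_not_holds h h₅ η hη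

theorem exists_family_of_not_entails {N : ℕ} {τs : List (List ℕ)} {bs : List (ℕ × ℕ)}
    {Φ : List Clause} (h : ¬ (kb N τs bs Φ).Entails (query N bs)) :
    ∃ v, IsFamily N τs bs Φ v := by
  simp only [KB.Entails, not_forall] at h
  obtain ⟨Δ, I, hI, hq⟩ := h
  exact exists_family_of_model hI hq

end DL.Reduction

-- Binary arithmetic and its propositional clauses.

namespace DL.Reduction

/-! ### Bits of numbers -/

/-- Adding one flips bit `j` exactly if a carry arrives there, i.e. if all lower bits are one. -/
theorem testBit_succ_iff (x j : ℕ) :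
    (x + 1).testBit j = true ↔ ¬ (x.testBit j = true ↔ ∀ k < j, x.testBit k = true) := by
  induction j generalizing x with
  | zero => simp [Nat.testBit_zero]; omega
  | succ j ih =>
    have hall : (∀ k < j + 1, x.testBit k = true) ↔
        x % 2 = 1 ∧ ∀ k < j, (x / 2).testBit k = true := by
      constructor
      · intro h
        refine ⟨by simpa [Nat.testBit_zero] using h 0 (by omega), fun k hk => ?_⟩
        rw [← Nat.testBit_succ]
        exact h (k + 1) (by omega)
      · rintro ⟨h₀, h⟩ k hk
        cases k with
        | zero => simpa [Nat.testBit_zero] using h₀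
        | succ k => rw [Nat.testBit_succ]; exact h k (by omega)
    rw [Nat.testBit_succ, Nat.testBit_succ, hall]
    rcases Nat.mod_two_eq_zero_or_one x with hx | hx
    · rw [show (x + 1) / 2 = x / 2 by omega]
      simp [hx]
    · rw [show (x + 1) / 2 = x / 2 + 1 by omega, ih]
      simp [hx]

theorem forall_testBit_iff (N x : ℕ) :
    (∀ k < N, x.testBit k = true) ↔ x % 2 ^ N + 1 = 2 ^ N := by
  have hpos : 0 < 2 ^ N := by positivity
  have hlt : x % 2 ^ N < 2 ^ N := Nat.mod_lt _ hpos
  constructor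
  · intro h
    have : x % 2 ^ N = 2 ^ N - 1 := by
      apply Nat.eq_of_testBit_eq
      intro k
      rw [Nat.testBit_mod_two_pow, Nat.testBit_two_pow_sub_one]
      by_cases hk : k < N <;> simp [hk, h]
    omega
  · intro h k hk
    have : x % 2 ^ N = 2 ^ N - 1 := by omega
    have h2 := congrArg (fun y => Nat.testBit y k) this
    simpa [Nat.testBit_mod_two_pow, Nat.testBit_two_pow_sub_one, hk] using h2

/-- `2 ^ N - (p + 1)` is the bitwise complement of `p`; adding `s` gives all ones modulo `2 ^ N`
exactly if `s = p`. -/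
theorem forall_testBit_chain {N s p : ℕ} (hs : s < 2 ^ N) (hp : p < 2 ^ N) :
    (∀ k < N, (2 ^ N - (p + 1) + s).testBit k = true) ↔ p = s := by
  rw [forall_testBit_iff]
  by_cases h : s ≤ p
  · rw [Nat.mod_eq_of_lt (by omega)]
    omega
  · have e : 2 ^ N - (p + 1) + s = (s - p - 1) + 2 ^ N := by omega
    rw [e, Nat.add_mod_right, Nat.mod_eq_of_lt (by omega)]
    omega

theorem eq_of_testBit_iff {N x y : ℕ} (hx : x < 2 ^ N) (hy : y < 2 ^ N)
    (h : ∀ j < N, x.testBit j = true ↔ y.testBit j = true) : x = y := by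
  apply Nat.eq_of_testBit_eq
  intro j
  by_cases hj : j < N
  · exact Bool.eq_iff_iff.2 (h j hj)
  · have hle : 2 ^ N ≤ 2 ^ j := Nat.pow_le_pow_right (by simp) (by omega)
    rw [Nat.testBit_lt_two_pow (by omega), Nat.testBit_lt_two_pow (by omega)]

theorem exists_testBit_eq (N : ℕ) (f : ℕ → Bool) :
    ∃ x < 2 ^ N, ∀ j < N, x.testBit j = f j := by
  refine ⟨Nat.ofBits fun j : Fin N => f j, Nat.ofBits_lt_two_pow _, fun j hj => ?_⟩
  exact Nat.testBit_ofBits_lt _ _ hj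

/-! ### The clauses

Concept names, given by their lists: `[8, κ]` the claim is the `κ`-th literal, `[9, g, j]` and
`[10, g, j]` carries and sums of the successors of the addresses, `[11, s, j]` and `[12, s, j]` bits
and carries of a chain of successors, whose carry out of the `s`-th step is `[13, s]`: the position
is `s`; `[14, s]` the position is at least `s`, `[15, o]` the input symbol is not `o`. -/

def carry (g j : ℕ) : List ℕ := [9, g, j]

def sum (g j : ℕ) : List ℕ := [10, g, j]

def address (f j : ℕ) : List ℕ := [2, f, 1, j]

def chain (s j : ℕ) : List ℕ := [11, s, j]

def chainCarry (s j : ℕ) : List ℕ := [12, s, j]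

def tileName (ρ : ℕ) : List ℕ := [4, 2, ρ]

/-- `b` is the successor of `a`, with carries `c`. -/
def succClauses (a c b : ℕ → List ℕ) (j : ℕ) : List Clause :=
  [([c j, a j], [c (j + 1)]), ([c (j + 1)], [c j]), ([c (j + 1)], [a j]),
    ([c j, a j, b j], []), ([c j], [a j, b j]), ([a j], [c j, b j]), ([b j], [a j, c j])]

/-- The claim of kind `κ` is about the position `(a, b)`. -/
def copyClauses (κ : ℕ) (a b : ℕ → List ℕ) (j : ℕ) : List Clause :=
  [([[8, κ], a j], [[4, 0, j]]), ([[8, κ], [4, 0, j]], [a j]),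
    ([[8, κ], b j], [[4, 1, j]]), ([[8, κ], [4, 1, j]], [b j])]

/-- The tree asserts address bits only positively, so the first two clauses exclude the opposite
bits. `chain 0` is the complement of `sum 1`, and `sum 2` is obtained from `sum 1`: it is the second
address plus two. -/
def bitClauses (j : ℕ) : List Clause :=
  [([[2, 0, 0, j], [2, 0, 1, j]], []), ([[2, 1, 0, j], [2, 1, 1, j]], []),
    ([chain 0 j, sum 1 j], []), ([], [chain 0 j, sum 1 j])] ++
  (succClauses (address 0) (carry 0) (sum 0) j ++ (succClauses (address 1) (carry 1) (sum 1) j ++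
  (succClauses (sum 1) (carry 2) (sum 2) j ++ (copyClauses 0 (address 0) (address 1) j ++
  (copyClauses 1 (address 0) (sum 1) j ++ (copyClauses 2 (address 0) (sum 2) j ++
  copyClauses 3 (sum 0) (sum 1) j))))))

/-- Counting up from the complement of the position detects that it equals `s`. This way the clauses
depend on `s` through names only and not through its binary digits. -/
def chainClauses (N s : ℕ) : List Clause :=
  [([], [chainCarry s 0]), ([chainCarry s N], [[13, s]]), ([[13, s]], [chainCarry s N])] ++
    (List.range N).flatMap (succClauses (chain s) (chainCarry s) (chain (s + 1)))

/-- `carry 0 N` means that the first address is that of the last row; there the claim has to be the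
positive one, kind `3`. -/
def choiceClauses (N : ℕ) : List Clause :=
  [([], [carry 0 0]), ([], [carry 1 0]), ([], [carry 2 0]), ([], [[14, 0]]),
    ([], [[8, 0], [8, 1], [8, 2], [8, 3]]), ([carry 0 N], [[8, 3]]),
    ([[8, 0]], [[7]]), ([[8, 1]], [[7]]), ([[8, 2]], [[7]]), ([[8, 3]], [[6]])]

def pairs (R : ℕ) : List (ℕ × ℕ) :=
  ((List.range R).flatMap fun a => (List.range R).map fun b => (a, b)).filter fun p => p.1 ≠ p.2

def triples (R : ℕ) : List (ℕ × ℕ × ℕ) :=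
  (List.range R).flatMap fun a => (List.range R).flatMap fun b => (List.range R).map fun c =>
    (a, b, c)

def uniqueClause (p : ℕ × ℕ) : Clause := ([tileName p.1, tileName p.2], [])

def tileClauses (nxt : ℕ → ℕ → ℕ → List ℕ) (N : ℕ) (τ : ℕ × ℕ × ℕ) : List Clause :=
  [([[8, 0], [3, τ.1, τ.2.1, τ.2.2]], [tileName τ.1]),
    ([[8, 1], [3, τ.1, τ.2.1, τ.2.2]], [tileName τ.2.1]),
    ([[8, 2], [3, τ.1, τ.2.1, τ.2.2]], [tileName τ.2.2]),
    ([[8, 3], [3, τ.1, τ.2.1, τ.2.2]], carry 0 N :: (nxt τ.1 τ.2.1 τ.2.2).map tileName)]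

section Clauses

variable {α : Type} (code : Option α → ℕ)

/-- In the last row the successor of the first address wraps to `0`, so the positive claim concerns
the initial row. There is one pair of clauses for each symbol `o`; `[15, code o]` disables it where
another symbol is present. -/
def initClauses (ini : Option α → Bool → List ℕ) (N : ℕ) (o : Option α) : List Clause :=
  [([carry 0 N, [13, 0]], [15, code o] :: (ini o true).map tileName),
    ([carry 0 N], [13, 0] :: [15, code o] :: (ini o false).map tileName)]

/-- At position `s` the clauses for the letter `a` may not be disabled, and `[14, ·]` is passed on
unless the position is `s`. Past the word, `wordClauses` forbids disabling the blank. -/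
def letterClauses (s : ℕ) (a : α) : List Clause :=
  [([[15, code (some a)], [13, s]], []), ([[14, s]], [[13, s], [14, s + 1]])]

def wordClauses (w : List α) : List Clause :=
  (w.zipIdx.flatMap fun p => letterClauses code p.2 p.1) ++
    [([[14, w.length], [15, code none]], [])]

def generalClauses (nxt : ℕ → ℕ → ℕ → List ℕ) (ini : Option α → Bool → List ℕ)
    (os : List (Option α)) (R N : ℕ) : List Clause :=
  (List.range N).flatMap bitClauses ++ ((List.range N).flatMap (chainClauses N) ++
    (choiceClauses N ++ ((pairs R).map uniqueClause ++ ((triples R).flatMap (tileClauses nxt N) ++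
      os.flatMap (initClauses code ini N)))))

def types (R : ℕ) : List (List ℕ) := (triples R).map fun τ => [τ.1, τ.2.1, τ.2.2]

def bits (R N : ℕ) : List (ℕ × ℕ) :=
  ((List.range N).flatMap fun j => [(0, j), (1, j)]) ++ (List.range R).map fun ρ => (2, ρ)

/-- A tiling of `2 ^ N` rows of length `2 ^ N`, closed to a cycle each. -/
def IsTiling (nxt : ℕ → ℕ → ℕ → List ℕ) (ini : Option α → Bool → List ℕ) (w : List α) (N : ℕ)
    (X : ℕ → ℕ → ℕ) : Prop :=
  (∀ i < 2 ^ N, X 0 i ∈ ini w[i]? (decide (i = 0))) ∧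
    ∀ t i, t + 1 < 2 ^ N → i < 2 ^ N → X (t + 1) ((i + 1) % 2 ^ N) ∈
      nxt (X t i) (X t ((i + 1) % 2 ^ N)) (X t ((i + 2) % 2 ^ N))

end Clauses

theorem mem_triples {R a b c : ℕ} : (a, b, c) ∈ triples R ↔ a < R ∧ b < R ∧ c < R := by
  simp [triples]

/-! ### From valuations to numbers -/

section Spec

variable {u : List ℕ → Prop} {N : ℕ}

/-- The clauses determine first the carries, by induction from the carry into bit `0`, and then the
bits of the sum; `succ_sat` is the converse. -/
theorem succ_spec {a c b : ℕ → List ℕ} {x : ℕ} (h₀ : u (c 0))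
    (hsat : ∀ j < N, ∀ cl ∈ succClauses a c b j, Satisfies u cl)
    (ha : ∀ j < N, u (a j) ↔ x.testBit j = true) :
    (∀ j ≤ N, u (c j) ↔ ∀ k < j, x.testBit k = true) ∧
      ∀ j < N, u (b j) ↔ (x + 1).testBit j = true := by
  simp only [succClauses, List.forall_mem_cons, Satisfies, List.exists_mem_cons_iff,
    List.not_mem_nil, false_and, exists_false, or_false, and_imp, false_imp_iff, implies_true,
    true_imp_iff, and_true] at hsat
  have hc : ∀ j ≤ N, u (c j) ↔ ∀ k < j, x.testBit k = true := by
    intro j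
    induction j with
    | zero => simp [h₀]
    | succ j ih =>
      intro hj
      obtain ⟨h₁, h₂, h₃, -⟩ := hsat j (by omega)
      rw [Nat.forall_lt_succ_right, ← ih (by omega), ← ha j (by omega)]
      exact ⟨fun h => ⟨h₂ h, h₃ h⟩, fun h => h₁ h.1 h.2⟩
  refine ⟨hc, fun j hj => ?_⟩
  obtain ⟨-, -, -, h₄, h₅, h₆, h₇⟩ := hsat j hj
  rw [testBit_succ_iff, ← hc j hj.le, ← ha j hj]
  tauto

theorem succ_sat {a c b : ℕ → List ℕ} {x j : ℕ} (ha : u (a j) ↔ x.testBit j = true)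
    (hc : ∀ j, u (c j) ↔ ∀ k < j, x.testBit k = true)
    (hb : u (b j) ↔ (x + 1).testBit j = true) :
    ∀ cl ∈ succClauses a c b j, Satisfies u cl := by
  have hc' : u (c (j + 1)) ↔ u (c j) ∧ u (a j) := by
    rw [hc, hc, ha, Nat.forall_lt_succ_right]
  rw [testBit_succ_iff, ← hc j, ← ha] at hb
  simp only [succClauses, List.forall_mem_cons, Satisfies, List.exists_mem_cons_iff,
    List.not_mem_nil, false_and, exists_false, or_false, and_imp, false_imp_iff, implies_true,
    true_imp_iff, and_true]
  tauto

theorem copy_spec {κ j : ℕ} {a b : ℕ → List ℕ} (hκ : u [8, κ])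
    (hsat : ∀ cl ∈ copyClauses κ a b j, Satisfies u cl) :
    (u [4, 0, j] ↔ u (a j)) ∧ (u [4, 1, j] ↔ u (b j)) := by
  simp only [copyClauses, List.forall_mem_cons, Satisfies, List.exists_mem_cons_iff,
    List.not_mem_nil, false_and, exists_false, or_false, and_imp, false_imp_iff, implies_true,
    true_imp_iff, and_true] at hsat
  tauto

theorem copy_sat {κ j : ℕ} {a b : ℕ → List ℕ} (ha : u [8, κ] → (u [4, 0, j] ↔ u (a j)))
    (hb : u [8, κ] → (u [4, 1, j] ↔ u (b j))) :
    ∀ cl ∈ copyClauses κ a b j, Satisfies u cl := by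
  simp only [copyClauses, List.forall_mem_cons, Satisfies, List.exists_mem_cons_iff,
    List.not_mem_nil, false_and, exists_false, or_false, and_imp, false_imp_iff, implies_true,
    true_imp_iff, and_true]
  tauto

end Spec

end DL.Reduction

-- A tiling from consistent claims.

namespace DL.Reduction

variable {α : Type} {code : Option α → ℕ} {nxt : ℕ → ℕ → ℕ → List ℕ}
  {ini : Option α → Bool → List ℕ} {os : List (Option α)} {R N : ℕ} {w : List α}

/-- All clauses hold under the valuation `u`. -/
def AllSat (code : Option α → ℕ) (nxt : ℕ → ℕ → ℕ → List ℕ) (ini : Option α → Bool → List ℕ)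
    (os : List (Option α)) (R N : ℕ) (w : List α) (u : List ℕ → Prop) : Prop :=
  ∀ c ∈ wordClauses code w ++ generalClauses code nxt ini os R N, Satisfies u c

theorem allSat_iff {u : List ℕ → Prop} : AllSat code nxt ini os R N w u ↔
    ((∀ s (h : s < w.length), ∀ c ∈ letterClauses code s w[s], Satisfies u c) ∧
      Satisfies u ([[14, w.length], [15, code none]], [])) ∧
    (∀ j < N, ∀ c ∈ bitClauses j, Satisfies u c) ∧
    (∀ s < N, ∀ c ∈ chainClauses N s, Satisfies u c) ∧
    (∀ c ∈ choiceClauses N, Satisfies u c) ∧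
    (∀ p ∈ pairs R, Satisfies u (uniqueClause p)) ∧
    (∀ τ ∈ triples R, ∀ c ∈ tileClauses nxt N τ, Satisfies u c) ∧
    ∀ o ∈ os, ∀ c ∈ initClauses code ini N o, Satisfies u c := by
  simp only [AllSat, wordClauses, generalClauses, List.forall_mem_append, List.mem_flatMap,
    List.forall_mem_map, List.mem_range, forall_exists_index, and_imp, List.forall_mem_singleton]
  refine and_congr (and_congr ?_ Iff.rfl) ?_
  · constructor
    · intro h s hs c hc
      exact h c (w[s], s) (by simp [List.mem_zipIdx_iff_getElem?]) hc
    · rintro h c ⟨a, s⟩ hp hc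
      rw [List.mem_zipIdx_iff_getElem?, List.getElem?_eq_some_iff] at hp
      obtain ⟨hs, ha⟩ := hp
      exact h s hs c (by rw [ha]; exact hc)
  · refine and_congr ⟨fun h j hj c => h c j hj, fun h c j hj => h j hj c⟩ (and_congr
      ⟨fun h j hj c => h c j hj, fun h c j hj => h j hj c⟩ (and_congr Iff.rfl (and_congr Iff.rfl
      (and_congr ⟨fun h j hj c => h c j hj, fun h c j hj => h j hj c⟩
        ⟨fun h j hj c => h c j hj, fun h c j hj => h j hj c⟩))))

/-! ### From valuations to tilings -/

/-- The claim of sign `s` made under the valuation `u` is about tile `ρ` at position `(t, i)`. -/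
def ClaimAt (N : ℕ) (u : List ℕ → Prop) (s t i ρ : ℕ) : Prop :=
  u [s] ∧ (∀ j < N, u [4, 0, j] ↔ t.testBit j = true) ∧
    (∀ j < N, u [4, 1, j] ↔ i.testBit j = true) ∧ u (tileName ρ)

/-- Only the lowest `N` bits of a position are recorded, so positions matter modulo `2 ^ N`. -/
theorem ClaimAt.congr {u : List ℕ → Prop} {s t i ρ t' i' : ℕ} (h : ClaimAt N u s t i ρ)
    (ht : t % 2 ^ N = t' % 2 ^ N) (hi : i % 2 ^ N = i' % 2 ^ N) : ClaimAt N u s t' i' ρ := by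
  have key : ∀ x y : ℕ, x % 2 ^ N = y % 2 ^ N → ∀ j < N, x.testBit j = y.testBit j := by
    intro x y hxy j hj
    have := congrArg (fun z => Nat.testBit z j) hxy
    simpa [Nat.testBit_mod_two_pow, hj] using this
  refine ⟨h.1, fun j hj => ?_, fun j hj => ?_, h.2.2.2⟩
  · rw [h.2.1 j hj, key _ _ ht j hj]
  · rw [h.2.2.1 j hj, key _ _ hi j hj]

section Leaf

variable {u : List ℕ → Prop} {t i : ℕ}

theorem leaf_spec (hsat : AllSat code nxt ini os R N w u)
    (ht : ∀ j < N, u [2, 0, (t.testBit j).toNat, j])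
    (hi : ∀ j < N, u [2, 1, (i.testBit j).toNat, j]) :
    (∀ j < N, u (address 0 j) ↔ t.testBit j = true) ∧
    (∀ j < N, u (address 1 j) ↔ i.testBit j = true) ∧
    (u (carry 0 N) ↔ ∀ k < N, t.testBit k = true) ∧
    (∀ j < N, u (sum 0 j) ↔ (t + 1).testBit j = true) ∧
    (∀ j < N, u (sum 1 j) ↔ (i + 1).testBit j = true) ∧
    (∀ j < N, u (sum 2 j) ↔ (i + 2).testBit j = true) := by
  obtain ⟨-, hbit, -, hch, -⟩ := allSat_iff.1 hsat
  simp only [bitClauses, List.forall_mem_append, List.forall_mem_cons] at hbit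
  simp only [choiceClauses, List.forall_mem_cons, Satisfies, List.exists_mem_cons_iff,
    List.not_mem_nil, false_and, exists_false, or_false, and_imp, false_imp_iff, implies_true,
    true_imp_iff, and_true] at hch
  obtain ⟨c₀, c₁, c₂, -⟩ := hch
  have excl : ∀ f j (b : Bool), u [2, f, b.toNat, j] → Satisfies u ([[2, f, 0, j], [2, f, 1, j]], []) →
      (u (address f j) ↔ b = true) := by
    intro f j b hu hs
    cases b with
    | true => exact iff_of_true hu rfl
    | false =>
      refine iff_of_false (fun h => ?_) (by simp)
      have h0 : u [2, f, 0, j] := hu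
      have h1 : u [2, f, 1, j] := h
      simp [Satisfies, h0, h1] at hs
  have a₀ : ∀ j < N, u (address 0 j) ↔ t.testBit j = true := fun j hj =>
    excl 0 j _ (ht j hj) (hbit j hj).1.1
  have a₁ : ∀ j < N, u (address 1 j) ↔ i.testBit j = true := fun j hj =>
    excl 1 j _ (hi j hj) (hbit j hj).1.2.1
  have s₀ := succ_spec c₀ (fun j hj => (hbit j hj).2.1) a₀
  have s₁ := succ_spec c₁ (fun j hj => (hbit j hj).2.2.1) a₁
  have s₂ := succ_spec c₂ (fun j hj => (hbit j hj).2.2.2.1) s₁.2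
  exact ⟨a₀, a₁, s₀.1 N le_rfl, s₀.2, s₁.2, s₂.2⟩

/-- The four alternatives are the kinds `0` to `3`. Since the row is not the last one, `carry 0 N`
fails, which leaves kind `3` a next tile. -/
theorem leaf_claim (hsat : AllSat code nxt ini os R N w u)
    (ht : ∀ j < N, u [2, 0, (t.testBit j).toNat, j])
    (hi : ∀ j < N, u [2, 1, (i.testBit j).toNat, j]) {a b c : ℕ} (hτ : (a, b, c) ∈ triples R)
    (huτ : u [3, a, b, c]) (htN : t + 1 < 2 ^ N) :
    ClaimAt N u 7 t i a ∨ ClaimAt N u 7 t (i + 1) b ∨ ClaimAt N u 7 t (i + 2) c ∨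
      ∃ ρ ∈ nxt a b c, ClaimAt N u 6 (t + 1) (i + 1) ρ := by
  obtain ⟨a₀, a₁, cN, s₀, s₁, s₂⟩ := leaf_spec hsat ht hi
  obtain ⟨-, hbit, -, hch, -, htile, -⟩ := allSat_iff.1 hsat
  simp only [bitClauses, List.forall_mem_append] at hbit
  simp only [choiceClauses, List.forall_mem_cons, Satisfies, List.exists_mem_cons_iff,
    List.not_mem_nil, false_and, exists_false, or_false, and_imp, false_imp_iff, implies_true,
    true_imp_iff, and_true] at hch
  obtain ⟨-, -, -, -, hκ, -, n₀, n₁, n₂, n₃⟩ := hch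
  have htile := htile _ hτ
  simp only [tileClauses, List.forall_mem_cons, Satisfies, List.exists_mem_cons_iff,
    List.not_mem_nil, false_and, exists_false, or_false, and_imp, false_imp_iff, implies_true,
    true_imp_iff, and_true] at htile
  obtain ⟨t₀, t₁, t₂, t₃⟩ := htile
  rcases hκ with hκ | hκ | hκ | hκ
  · have cp := fun j hj => copy_spec hκ (hbit j hj).2.2.2.2.1
    exact Or.inl ⟨n₀ hκ, fun j hj => (cp j hj).1.trans (a₀ j hj),
      fun j hj => (cp j hj).2.trans (a₁ j hj), t₀ hκ huτ⟩
  · have cp := fun j hj => copy_spec hκ (hbit j hj).2.2.2.2.2.1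
    exact Or.inr (Or.inl ⟨n₁ hκ, fun j hj => (cp j hj).1.trans (a₀ j hj),
      fun j hj => (cp j hj).2.trans (s₁ j hj), t₁ hκ huτ⟩)
  · have cp := fun j hj => copy_spec hκ (hbit j hj).2.2.2.2.2.2.1
    exact Or.inr (Or.inr (Or.inl ⟨n₂ hκ, fun j hj => (cp j hj).1.trans (a₀ j hj),
      fun j hj => (cp j hj).2.trans (s₂ j hj), t₂ hκ huτ⟩))
  · have cp := fun j hj => copy_spec hκ (hbit j hj).2.2.2.2.2.2.2
    rcases t₃ hκ huτ with h | ⟨_, h, hρ⟩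
    · rw [cN, forall_testBit_iff, Nat.mod_eq_of_lt (by omega)] at h
      omega
    · obtain ⟨ρ, hρ', rfl⟩ := List.mem_map.1 h
      exact Or.inr (Or.inr (Or.inr ⟨ρ, hρ', n₃ hκ, fun j hj => (cp j hj).1.trans (s₀ j hj),
        fun j hj => (cp j hj).2.trans (s₁ j hj), hρ⟩))

/-- The chain recognises positions `s < N` only. This suffices: the letters of `w` stand at such
positions, and so does the leftmost cell, by `hN`. -/
theorem leaf_init (hsat : AllSat code nxt ini os R N w u) (hw : w.length ≤ N) (hN : 0 < N)
    (hos : ∀ o, o ∈ os)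
    (ht : ∀ j < N, u [2, 0, (t.testBit j).toNat, j])
    (hi : ∀ j < N, u [2, 1, (i.testBit j).toNat, j]) (htN : t + 1 = 2 ^ N) :
    ∃ ρ ∈ ini w[(i + 1) % 2 ^ N]? (decide ((i + 1) % 2 ^ N = 0)), ClaimAt N u 6 0 (i + 1) ρ := by
  obtain ⟨a₀, a₁, cN, s₀, s₁, s₂⟩ := leaf_spec hsat ht hi
  obtain ⟨⟨hw₁, hw₂⟩, hbit, hchain, hch, -, -, hini⟩ := allSat_iff.1 hsat
  simp only [bitClauses, List.forall_mem_append, List.forall_mem_cons] at hbit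
  simp only [choiceClauses, List.forall_mem_cons, Satisfies, List.exists_mem_cons_iff,
    List.not_mem_nil, false_and, exists_false, or_false, and_imp, false_imp_iff, implies_true,
    true_imp_iff, and_true] at hch
  obtain ⟨-, -, -, p₀, -, hκ, -, -, -, n₃⟩ := hch
  set p := (i + 1) % 2 ^ N with hp
  have hpN : p < 2 ^ N := Nat.mod_lt _ (by positivity)
  have hcN : u (carry 0 N) := by
    rw [cN, forall_testBit_iff, Nat.mod_eq_of_lt (by omega)]
    exact htN
  have y : ∀ s ≤ N, ∀ j < N, u (chain s j) ↔ (2 ^ N - (p + 1) + s).testBit j = true := by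
    intro s
    induction s with
    | zero =>
      intro _ j hj
      have h₁ := (hbit j hj).1.2.2.1
      have h₂ := (hbit j hj).1.2.2.2.1
      simp only [List.forall_mem_cons, Satisfies, List.exists_mem_cons_iff,
        List.not_mem_nil, false_and, exists_false, or_false, and_imp, false_imp_iff, implies_true,
        true_imp_iff, and_true] at h₁ h₂
      have h₃ := s₁ j hj
      have h₄ : (i + 1).testBit j = p.testBit j := by
        simp [hp, Nat.testBit_mod_two_pow, hj]
      rw [h₄] at h₃
      rw [Nat.add_zero, Nat.testBit_two_pow_sub_succ hpN]
      simp only [hj, decide_true, Bool.true_and, Bool.not_eq_true']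
      rw [← Bool.not_eq_true, ← h₃]
      tauto
    | succ s ih =>
      intro hs
      have hc := hchain s (by omega)
      simp only [chainClauses, List.forall_mem_append, List.forall_mem_cons, List.mem_flatMap,
        List.mem_range, forall_exists_index, and_imp] at hc
      have h₀ := hc.1.1
      simp only [Satisfies, List.exists_mem_cons_iff, List.not_mem_nil, false_and, exists_false,
        or_false, false_imp_iff, implies_true, true_imp_iff] at h₀
      exact (succ_spec h₀ (fun j hj cl hcl => hc.2 cl j hj hcl) (ih (by omega))).2
  have e : ∀ s < N, u [13, s] ↔ p = s := by
    intro s hs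
    have hc := hchain s hs
    simp only [chainClauses, List.forall_mem_append, List.forall_mem_cons, List.mem_flatMap,
      List.mem_range, forall_exists_index, and_imp] at hc
    obtain ⟨⟨h₀, h₁, h₂, -⟩, h₃⟩ := hc
    simp only [Satisfies, List.forall_mem_cons, List.exists_mem_cons_iff, List.not_mem_nil,
      false_and, exists_false, or_false, false_imp_iff, implies_true, true_imp_iff,
      and_true] at h₀ h₁ h₂
    have := (succ_spec h₀ (fun j hj cl hcl => h₃ cl j hj hcl) (y s hs.le)).1 N le_rfl
    rw [forall_testBit_chain (hs.trans Nat.lt_two_pow_self) hpN] at this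
    exact ⟨fun h => this.1 (h₂ h), fun h => h₁ (this.2 h)⟩
  have hsym : ¬ u [15, code w[p]?] := by
    intro hu
    by_cases hpw : p < w.length
    · have h := hw₁ p hpw _ (List.mem_cons_self)
      rw [List.getElem?_eq_getElem hpw] at hu
      have hp' := (e p (by omega)).2 rfl
      simp [Satisfies, hu, hp'] at h
    -- Beyond the word, the position differs from every `s < w.length`, so `[14, ·]` propagates to
    -- `w.length`, where the blank cannot be disabled.
    · have hge : ∀ s ≤ w.length, u [14, s] := by
        intro s
        induction s with
        | zero => exact fun _ => p₀
        | succ s ih =>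
          intro hs
          have h := hw₁ s (by omega) _ (List.mem_cons_of_mem _ (List.mem_cons_self))
          have hne : ¬ u [13, s] := by
            rw [e s (by omega)]
            omega
          simpa [Satisfies, ih (by omega), hne] using h
      rw [List.getElem?_eq_none (by omega)] at hu
      simp [Satisfies, hu, hge _ le_rfl] at hw₂
  have hini := hini w[p]? (hos _)
  simp only [initClauses, List.forall_mem_cons, Satisfies, List.exists_mem_cons_iff,
    List.not_mem_nil, false_and, exists_false, or_false, and_imp, false_imp_iff, implies_true,
    true_imp_iff, and_true, hcN, hsym, false_or, e 0 hN] at hini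
  obtain ⟨i₁, i₂⟩ := hini
  have hex : ∃ a ∈ (ini w[p]? (decide (p = 0))).map tileName, u a := by
    by_cases hp0 : p = 0
    · simp only [hp0, decide_true] at i₁ ⊢
      exact i₁ trivial
    · simp only [hp0, decide_false, false_or] at i₂ ⊢
      exact i₂
  obtain ⟨_, h, hρ⟩ := hex
  obtain ⟨ρ, hρ', rfl⟩ := List.mem_map.1 h
  have cp := fun j hj => copy_spec (hκ hcN) (hbit j hj).2.2.2.2.2.2.2
  refine ⟨ρ, hρ', n₃ (hκ hcN), fun j hj => (cp j hj).1.trans ((s₀ j hj).trans ?_),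
    fun j hj => (cp j hj).2.trans (s₁ j hj), hρ⟩
  rw [htN]
  simp [Nat.testBit_two_pow, hj.ne']

end Leaf

/-- The invariant `Good t f` says that each cell of row `t`, as given by `f`, is claimed positively
by some leaf; the leaves of the next row's windows then cannot make negative claims. -/
theorem exists_tiling_of_family {v : (ℕ → Bool × Bool) → List ℕ → List ℕ → Prop}
    (h : IsFamily N (types R) (bits R N)
      (wordClauses code w ++ generalClauses code nxt ini os R N) v)
    (hw : w.length ≤ N) (hN : 0 < N) (hR : 0 < R) (hos : ∀ o, o ∈ os)
    (hnxt : ∀ a b c, ∀ ρ ∈ nxt a b c, ρ < R) (hini : ∀ o b, ∀ ρ ∈ ini o b, ρ < R) :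
    ∃ X, IsTiling nxt ini w N X := by
  have hpow : 0 < 2 ^ N := by positivity
  have hmem : ∀ a b c, a < R → b < R → c < R → [a, b, c] ∈ types R := fun a b c ha hb hc =>
    List.mem_map.2 ⟨(a, b, c), mem_triples.2 ⟨ha, hb, hc⟩, rfl⟩
  let C : ℕ → ℕ → ℕ → ℕ → Prop := fun s t i ρ =>
    ∃ z, ∃ τ ∈ types R, ClaimAt N (v z τ) s t i ρ
  have hcon : ∀ t i ρ, ρ < R → C 6 t i ρ → C 7 t i ρ → False := by
    rintro t i ρ hρ ⟨z, τ, hτ, h₁⟩ ⟨z', τ', hτ', h₂⟩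
    obtain ⟨p, hp, hne⟩ := h.consistent z τ hτ z' τ' hτ' h₁.1 h₂.1
    apply hne
    simp only [bits, List.mem_append, List.mem_flatMap, List.mem_map, List.mem_range,
      List.mem_cons, List.not_mem_nil, or_false] at hp
    rcases hp with ⟨j, hj, rfl | rfl⟩ | ⟨ρ', hρ', rfl⟩
    · rw [h₁.2.1 j hj, h₂.2.1 j hj]
    · rw [h₁.2.2.1 j hj, h₂.2.2.1 j hj]
    -- Tiles are recorded by one bit each, of which the unique clauses allow at most one to be set;
    -- two claims about tile `ρ` therefore agree in all tile bits.
    · have uniq : ∀ z, ∀ τ ∈ types R, v z τ (tileName ρ) → (v z τ [4, 2, ρ'] ↔ ρ' = ρ) := by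
        intro z τ hτ hv
        refine ⟨fun hv' => ?_, ?_⟩
        · by_contra hne
          have := (allSat_iff.1 (h.sat z τ hτ)).2.2.2.2.1 (ρ', ρ) (by simp [pairs, hρ, hρ', hne])
          have hv'' : v z τ (tileName ρ') := hv'
          simp [Satisfies, uniqueClause, hv'', hv] at this
        · rintro rfl
          exact hv
      rw [uniq z τ hτ h₁.2.2.2, uniq z' τ' hτ' h₂.2.2.2]
  let z : ℕ → ℕ → ℕ → Bool × Bool := fun t i j => (t.testBit j, i.testBit j)
  have win : ∀ t i a b c, t + 1 < 2 ^ N → a < R → b < R → c < R →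
      C 7 t i a ∨ C 7 t (i + 1) b ∨ C 7 t (i + 2) c ∨ ∃ ρ ∈ nxt a b c, C 6 (t + 1) (i + 1) ρ := by
    intro t i a b c ht ha hb hc
    have hτ := hmem a b c ha hb hc
    rcases leaf_claim (h.sat (z t i) _ hτ) (h.fst (z t i) _ hτ) (h.snd (z t i) _ hτ)
      (mem_triples.2 ⟨ha, hb, hc⟩) (h.type _ _ hτ) ht with h | h | h | ⟨ρ, hρ, h⟩
    · exact Or.inl ⟨_, _, hτ, h⟩
    · exact Or.inr (Or.inl ⟨_, _, hτ, h⟩)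
    · exact Or.inr (Or.inr (Or.inl ⟨_, _, hτ, h⟩))
    · exact Or.inr (Or.inr (Or.inr ⟨ρ, hρ, _, _, hτ, h⟩))
  have hC : ∀ {s t i ρ t' i'}, C s t i ρ → t % 2 ^ N = t' % 2 ^ N → i % 2 ^ N = i' % 2 ^ N →
      C s t' i' ρ := by
    rintro s t i ρ t' i' ⟨z, τ, hτ, h⟩ ht hi
    exact ⟨z, τ, hτ, h.congr ht hi⟩
  have pred : ∀ i < 2 ^ N, ∃ i' < 2 ^ N, (i' + 1) % 2 ^ N = i := by
    intro i hi
    by_cases h0 : i = 0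
    · exact ⟨2 ^ N - 1, by omega, by rw [Nat.sub_add_cancel hpow, Nat.mod_self, h0]⟩
    · exact ⟨i - 1, by omega, by rw [Nat.sub_add_cancel (by omega), Nat.mod_eq_of_lt hi]⟩
  let Good : ℕ → (ℕ → ℕ) → Prop := fun t f => ∀ i < 2 ^ N, f i < R ∧ C 6 t i (f i)
  have base : ∃ f, Good 0 f ∧ ∀ i < 2 ^ N, f i ∈ ini w[i]? (decide (i = 0)) := by
    have : ∀ i, ∃ ρ, i < 2 ^ N → (ρ < R ∧ C 6 0 i ρ) ∧ ρ ∈ ini w[i]? (decide (i = 0)) := by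
      intro i
      by_cases hi : i < 2 ^ N
      · obtain ⟨i', hi', rfl⟩ := pred i hi
        -- In the last row the type is irrelevant, so any one will do.
        have hτ := hmem 0 0 0 hR hR hR
        obtain ⟨ρ, hρ, hcl⟩ := leaf_init (h.sat (z (2 ^ N - 1) i') _ hτ) hw hN hos
          (h.fst (z (2 ^ N - 1) i') _ hτ) (h.snd (z (2 ^ N - 1) i') _ hτ)
          (Nat.sub_add_cancel hpow)
        exact ⟨ρ, fun _ => ⟨⟨hini _ _ _ hρ, hC ⟨_, _, hτ, hcl⟩ rfl (by simp)⟩, hρ⟩⟩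
      · exact ⟨0, fun h => absurd h hi⟩
    choose f hf using this
    exact ⟨f, fun i hi => (hf i hi).1, fun i hi => (hf i hi).2⟩
  have step : ∀ t f, ∃ g, t + 1 < 2 ^ N → Good t f → Good (t + 1) g ∧ ∀ i < 2 ^ N,
      g ((i + 1) % 2 ^ N) ∈ nxt (f i) (f ((i + 1) % 2 ^ N)) (f ((i + 2) % 2 ^ N)) := by
    intro t f
    by_cases ht : t + 1 < 2 ^ N
    swap
    · exact ⟨f, fun h => absurd h ht⟩
    by_cases hf : Good t f
    swap
    · exact ⟨f, fun _ h => absurd h hf⟩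
    have ex : ∀ i < 2 ^ N, ∃ ρ ∈ nxt (f i) (f ((i + 1) % 2 ^ N)) (f ((i + 2) % 2 ^ N)),
        C 6 (t + 1) ((i + 1) % 2 ^ N) ρ := by
      intro i hi
      have m₁ : (i + 1) % 2 ^ N < 2 ^ N := Nat.mod_lt _ hpow
      have m₂ : (i + 2) % 2 ^ N < 2 ^ N := Nat.mod_lt _ hpow
      rcases win t i _ _ _ ht (hf i hi).1 (hf _ m₁).1 (hf _ m₂).1 with h | h | h | ⟨ρ, hρ, h⟩
      · exact (hcon _ _ _ (hf i hi).1 (hf i hi).2 h).elim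
      · exact (hcon _ _ _ (hf _ m₁).1 (hf _ m₁).2 (hC h rfl (by simp))).elim
      · exact (hcon _ _ _ (hf _ m₂).1 (hf _ m₂).2 (hC h rfl (by simp))).elim
      · exact ⟨ρ, hρ, hC h rfl (by simp)⟩
    -- The tile is reindexed by its own cell `k` instead of the left end `i` of its window, which
    -- `k` determines.
    have ex' : ∀ k, ∃ ρ, k < 2 ^ N → C 6 (t + 1) k ρ ∧ ∀ i < 2 ^ N, (i + 1) % 2 ^ N = k →
        ρ ∈ nxt (f i) (f k) (f ((i + 2) % 2 ^ N)) := by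
      intro k
      by_cases hk : k < 2 ^ N
      · obtain ⟨i, hi, rfl⟩ := pred k hk
        obtain ⟨ρ, hρ, hρC⟩ := ex i hi
        refine ⟨ρ, fun _ => ⟨hρC, fun i' hi' e => ?_⟩⟩
        have : i' = i := by
          have h1 : i' + 1 ≡ i + 1 [MOD 2 ^ N] := e
          have h2 := Nat.ModEq.add_right_cancel' 1 h1
          rwa [Nat.ModEq, Nat.mod_eq_of_lt hi', Nat.mod_eq_of_lt hi] at h2
        rw [this]
        exact hρ
      · exact ⟨0, fun h => absurd h hk⟩
    choose g hg using ex'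
    have m := fun i => Nat.mod_lt (i + 1) hpow
    refine ⟨g, fun _ _ => ⟨fun k hk => ⟨?_, (hg k hk).1⟩, fun i hi => (hg _ (m i)).2 i hi rfl⟩⟩
    obtain ⟨i, hi, rfl⟩ := pred k hk
    exact hnxt _ _ _ _ ((hg _ (m i)).2 i hi rfl)
  obtain ⟨f₀, hf₀, hf₀'⟩ := base
  choose nx hnx using step
  let X : ℕ → ℕ → ℕ := fun t => Nat.rec f₀ (fun t f => nx t f) t
  have hX : ∀ t, t < 2 ^ N → Good t (X t) := by
    intro t
    induction t with
    | zero => exact fun _ => hf₀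
    | succ t ih => exact fun ht => (hnx t (X t) ht (ih (by omega))).1
  exact ⟨X, hf₀', fun t i ht hi => (hnx t (X t) ht (hX t (by omega))).2 i hi⟩

end DL.Reduction

-- Consistent claims from a tiling.

namespace DL.Reduction

variable {α : Type} {code : Option α → ℕ} {nxt : ℕ → ℕ → ℕ → List ℕ}
  {ini : Option α → Bool → List ℕ} {os : List (Option α)} {R N : ℕ} {w : List α}

/-! ### From tilings to valuations -/

/-- The kind of the claim made at the leaf with addresses `t`, `i` and type `a`, `b`, `c`. -/
noncomputable def kind (N : ℕ) (X : ℕ → ℕ → ℕ) (t i a b c : ℕ) : ℕ :=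
  open Classical in
  if t + 1 = 2 ^ N then 3 else if X t i ≠ a then 0 else if X t ((i + 1) % 2 ^ N) ≠ b then 1 else
    if X t ((i + 2) % 2 ^ N) ≠ c then 2 else 3

def claimRow (N t : ℕ) : ℕ → ℕ
  | 3 => (t + 1) % 2 ^ N
  | _ => t

def claimColumn (N i : ℕ) : ℕ → ℕ
  | 0 => i
  | 2 => (i + 2) % 2 ^ N
  | _ => (i + 1) % 2 ^ N

def claimTile (N : ℕ) (X : ℕ → ℕ → ℕ) (t i a b c : ℕ) : ℕ → ℕ
  | 0 => a
  | 1 => b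
  | 2 => c
  | _ => X ((t + 1) % 2 ^ N) ((i + 1) % 2 ^ N)

/-- The valuation at the leaf with addresses `t`, `i` and type `τ` that makes the claim of kind `κ`
about tile `ρ` at position `(t', i')`. -/
def leafVal (code : Option α → ℕ) (w : List α) (N t i : ℕ) (τ : List ℕ) (κ t' i' ρ : ℕ) :
    List ℕ → Prop
  | [1] => True
  | [2, 0, b, j] => b = (t.testBit j).toNat
  | [2, 1, b, j] => b = (i.testBit j).toNat
  | 3 :: τ' => τ' = τ
  | [4, 0, j] => t'.testBit j = true
  | [4, 1, j] => i'.testBit j = true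
  | [4, 2, ρ'] => ρ' = ρ
  | [6] => κ = 3
  | [7] => κ ≠ 3
  | [8, k] => k = κ
  | [9, 0, j] => ∀ k < j, t.testBit k = true
  | [9, 1, j] => ∀ k < j, i.testBit k = true
  | [9, 2, j] => ∀ k < j, (i + 1).testBit k = true
  | [10, 0, j] => (t + 1).testBit j = true
  | [10, 1, j] => (i + 1).testBit j = true
  | [10, 2, j] => (i + 2).testBit j = true
  | [11, s, j] => (2 ^ N - ((i + 1) % 2 ^ N + 1) + s).testBit j = true
  | [12, s, j] => ∀ k < j, (2 ^ N - ((i + 1) % 2 ^ N + 1) + s).testBit k = true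
  | [13, s] => (i + 1) % 2 ^ N = s
  | [14, s] => s ≤ (i + 1) % 2 ^ N
  | [15, o] => o ≠ code w[(i + 1) % 2 ^ N]?
  | _ => False

/-- `kind` picks a claim that is true of `X`: it is positive exactly if the tile it names is the
actual one. So position and tile determine its sign. -/
theorem claim_iff {X : ℕ → ℕ → ℕ} {t i a b c : ℕ} :
    (kind N X t i a b c = 3) ↔ X (claimRow N t (kind N X t i a b c))
      (claimColumn N i (kind N X t i a b c)) =
        claimTile N X t i a b c (kind N X t i a b c) := by
  unfold kind
  split_ifs with h₁ h₂ h₃ h₄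
  · simp [claimRow, claimColumn, claimTile]
  · simpa [claimRow, claimColumn, claimTile] using h₂
  · simpa [claimRow, claimColumn, claimTile] using h₃
  · simpa [claimRow, claimColumn, claimTile] using h₄
  · simp [claimRow, claimColumn, claimTile]

theorem kind_le {X : ℕ → ℕ → ℕ} {t i a b c : ℕ} : kind N X t i a b c < 4 := by
  unfold kind
  split_ifs <;> simp

theorem kind_eq_three {X : ℕ → ℕ → ℕ} {t i a b c : ℕ} (h : kind N X t i a b c = 3)
    (ht : t + 1 ≠ 2 ^ N) :
    X t i = a ∧ X t ((i + 1) % 2 ^ N) = b ∧ X t ((i + 2) % 2 ^ N) = c := by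
  unfold kind at h
  split_ifs at h with h₁ h₂ h₃ <;> simp_all

theorem testBit_toNat_eq_one (b : Bool) : 1 = b.toNat ↔ b = true := by cases b <;> simp

section LeafVal

variable {t i κ t' i' ρ : ℕ} {τ : List ℕ}

local notation "U" => leafVal code w N t i τ κ t' i' ρ

theorem leafVal_bitClauses (hκ : t' = claimRow N t κ) (hκ' : i' = claimColumn N i κ) :
    ∀ j < N, ∀ c ∈ bitClauses j, Satisfies U c := by
  intro j hj
  have hmod : ∀ x : ℕ, (x % 2 ^ N).testBit j = x.testBit j := fun x => by
    simp [Nat.testBit_mod_two_pow, hj]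
  have hpN : (i + 1) % 2 ^ N < 2 ^ N := Nat.mod_lt _ (by positivity)
  have hchain : (2 ^ N - ((i + 1) % 2 ^ N + 1)).testBit j = !(i + 1).testBit j := by
    rw [Nat.testBit_two_pow_sub_succ hpN, hmod]
    simp [hj]
  simp only [bitClauses, List.forall_mem_append, List.forall_mem_cons]
  refine ⟨⟨?_, ?_, ?_, ?_, by simp⟩, ?_, ?_, ?_, ?_, ?_, ?_, ?_⟩
  · simp only [Satisfies, List.forall_mem_cons, leafVal, and_imp, List.not_mem_nil, false_and,
      exists_false]
    omega
  · simp only [Satisfies, List.forall_mem_cons, leafVal, and_imp, List.not_mem_nil, false_and,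
      exists_false]
    omega
  · simp [Satisfies, chain, sum, leafVal, hchain]
  · simp [Satisfies, chain, sum, leafVal, hchain]
  · exact succ_sat (x := t) (by simp only [address, leafVal, testBit_toNat_eq_one])
      (fun j => Iff.rfl) Iff.rfl
  · exact succ_sat (x := i) (by simp only [address, leafVal, testBit_toNat_eq_one])
      (fun j => Iff.rfl) Iff.rfl
  · exact succ_sat (x := i + 1) Iff.rfl (fun j => Iff.rfl) Iff.rfl
  · apply copy_sat <;> intro h <;> change 0 = κ at h <;> subst h
    · simp only [address, leafVal, testBit_toNat_eq_one, hκ, claimRow]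
    · simp only [address, leafVal, testBit_toNat_eq_one, hκ', claimColumn]
  · apply copy_sat <;> intro h <;> change 1 = κ at h <;> subst h
    · simp only [address, leafVal, testBit_toNat_eq_one, hκ, claimRow]
    · simp only [sum, leafVal, hκ', claimColumn, hmod]
  · apply copy_sat <;> intro h <;> change 2 = κ at h <;> subst h
    · simp only [address, leafVal, testBit_toNat_eq_one, hκ, claimRow]
    · simp only [sum, leafVal, hκ', claimColumn, hmod]
  · apply copy_sat <;> intro h <;> change 3 = κ at h <;> subst h
    · simp only [sum, leafVal, hκ, claimRow, hmod]
    · simp only [sum, leafVal, hκ', claimColumn, hmod]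

theorem leafVal_chainClauses : ∀ s < N, ∀ c ∈ chainClauses N s, Satisfies U c := by
  intro s hs
  have hpN : (i + 1) % 2 ^ N < 2 ^ N := Nat.mod_lt _ (by positivity)
  have e := forall_testBit_chain (hs.trans Nat.lt_two_pow_self) hpN
  simp only [chainClauses, List.forall_mem_append, List.forall_mem_cons, List.mem_flatMap,
    List.mem_range, forall_exists_index, and_imp]
  refine ⟨⟨?_, ?_, ?_, by simp⟩, fun c j hj => ?_⟩
  · simp [Satisfies, chainCarry, leafVal]
  · simp only [Satisfies, chainCarry, leafVal, List.forall_mem_cons, List.exists_mem_cons_iff, e]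
    exact fun h => Or.inl h.1
  · simp only [Satisfies, chainCarry, leafVal, List.forall_mem_cons, List.exists_mem_cons_iff, e]
    exact fun h => Or.inl h.1
  · revert c
    exact succ_sat (x := 2 ^ N - ((i + 1) % 2 ^ N + 1) + s) Iff.rfl (fun j => Iff.rfl) Iff.rfl

theorem leafVal_choiceClauses (hκ : κ < 4) (ht : t < 2 ^ N) (h₃ : t + 1 = 2 ^ N → κ = 3) :
    ∀ c ∈ choiceClauses N, Satisfies U c := by
  have hN : (∀ k < N, t.testBit k = true) ↔ t + 1 = 2 ^ N := by
    rw [forall_testBit_iff, Nat.mod_eq_of_lt ht]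
  simp only [choiceClauses, List.forall_mem_cons, Satisfies, List.exists_mem_cons_iff,
    List.not_mem_nil, false_and, exists_false, or_false, false_imp_iff, implies_true,
    true_imp_iff, and_true, leafVal, carry, hN]
  simp only [not_lt_zero, false_imp_iff, implies_true, true_and, zero_le]
  omega

theorem leafVal_uniqueClause : ∀ p ∈ pairs R, Satisfies U (uniqueClause p) := by
  rintro ⟨a, b⟩ hp
  have hne : a ≠ b := by simpa using (List.mem_filter.1 hp).2
  simp only [Satisfies, uniqueClause, tileName, leafVal, List.forall_mem_cons]
  rintro ⟨rfl, rfl, -⟩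
  exact absurd rfl hne

theorem leafVal_wordClauses :
    (∀ s (h : s < w.length), ∀ c ∈ letterClauses code s w[s], Satisfies U c) ∧
      Satisfies U ([[14, w.length], [15, code none]], []) := by
  constructor
  · intro s hs
    simp only [letterClauses, List.forall_mem_cons, Satisfies, List.exists_mem_cons_iff,
      List.not_mem_nil, false_and, exists_false, or_false, false_imp_iff, implies_true,
      and_true, leafVal]
    refine ⟨?_, by omega⟩
    rintro ⟨h, e⟩
    rw [e, List.getElem?_eq_getElem hs] at h
    exact h rfl
  · simp only [List.forall_mem_cons, Satisfies, List.not_mem_nil, false_and, exists_false,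
      false_imp_iff, implies_true, and_true, leafVal]
    rintro ⟨h, h'⟩
    exact h' (by rw [List.getElem?_eq_none h])

end LeafVal

theorem leafVal_allSat (hcode : Function.Injective code) {X : ℕ → ℕ → ℕ}
    (hX : IsTiling nxt ini w N X) {t i a b c : ℕ} (ht : t < 2 ^ N) (hi : i < 2 ^ N) :
    AllSat code nxt ini os R N w (leafVal code w N t i [a, b, c] (kind N X t i a b c)
      (claimRow N t (kind N X t i a b c)) (claimColumn N i (kind N X t i a b c))
      (claimTile N X t i a b c (kind N X t i a b c))) := by
  have hN : (∀ k < N, t.testBit k = true) ↔ t + 1 = 2 ^ N := by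
    rw [forall_testBit_iff, Nat.mod_eq_of_lt ht]
  have h₃ : t + 1 = 2 ^ N → kind N X t i a b c = 3 := fun h => by simp [kind, h]
  rw [allSat_iff]
  refine ⟨leafVal_wordClauses, leafVal_bitClauses rfl rfl, leafVal_chainClauses,
    leafVal_choiceClauses kind_le ht h₃, leafVal_uniqueClause, ?_, ?_⟩
  · rintro ⟨a', b', c'⟩ -
    simp only [tileClauses, List.forall_mem_cons, Satisfies, List.exists_mem_cons_iff,
      List.not_mem_nil, false_and, exists_false, or_false, and_imp, false_imp_iff, implies_true,
      and_true, leafVal, carry, tileName, hN, List.cons.injEq]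
    refine ⟨?_, ?_, ?_, ?_⟩
    · rintro hk rfl rfl rfl
      rw [← hk]; rfl
    · rintro hk rfl rfl rfl
      rw [← hk]; rfl
    · rintro hk rfl rfl rfl
      rw [← hk]; rfl
    · rintro hk rfl rfl rfl
      by_cases htN : t + 1 = 2 ^ N
      · exact Or.inl htN
      · right
        obtain ⟨e₁, e₂, e₃⟩ := kind_eq_three hk.symm htN
        have := hX.2 t i (by omega) hi
        rw [e₁, e₂, e₃] at this
        refine ⟨[4, 2, _], List.mem_map_of_mem this, ?_⟩
        simp only [leafVal, ← hk, claimTile, Nat.mod_eq_of_lt (show t + 1 < 2 ^ N by omega)]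
  · intro o _
    simp only [initClauses, List.forall_mem_cons, Satisfies, List.exists_mem_cons_iff,
      List.not_mem_nil, false_and, exists_false, or_false, and_imp, false_imp_iff, implies_true,
      and_true, leafVal, carry, hN]
    have key : t + 1 = 2 ^ N → o = w[(i + 1) % 2 ^ N]? →
        ∃ x ∈ (ini o (decide ((i + 1) % 2 ^ N = 0))).map tileName,
          leafVal code w N t i [a, b, c] (kind N X t i a b c)
            (claimRow N t (kind N X t i a b c)) (claimColumn N i (kind N X t i a b c))
            (claimTile N X t i a b c (kind N X t i a b c)) x := by
      intro htN ho
      have := hX.1 ((i + 1) % 2 ^ N) (Nat.mod_lt _ (by positivity))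
      rw [← ho] at this
      refine ⟨_, List.mem_map_of_mem this, ?_⟩
      simp only [tileName, leafVal, h₃ htN, claimTile, htN, Nat.mod_self]
    constructor
    · intro htN hp
      by_cases ho : o = w[(i + 1) % 2 ^ N]?
      · have := key htN ho
        simp only [hp, decide_true] at this
        exact Or.inr this
      · exact Or.inl fun h => ho (hcode h)
    · intro htN
      by_cases hp : (i + 1) % 2 ^ N = 0
      · exact Or.inl hp
      · by_cases ho : o = w[(i + 1) % 2 ^ N]?
        · have := key htN ho
          simp only [hp, decide_false] at this
          exact Or.inr (Or.inr this)
        · exact Or.inr (Or.inl fun h => ho (hcode h))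

/-- Two claims with the same bits are about the same cell and tile, so by `claim_iff` they have the
same sign. -/
theorem exists_family_of_tiling (hcode : Function.Injective code) {X : ℕ → ℕ → ℕ}
    (hX : IsTiling nxt ini w N X)
    (hnxt : ∀ a b c, ∀ ρ ∈ nxt a b c, ρ < R) (hini : ∀ o b, ∀ ρ ∈ ini o b, ρ < R) :
    ∃ v, IsFamily N (types R) (bits R N)
      (wordClauses code w ++ generalClauses code nxt ini os R N) v ∧
      (∀ z τ j, ¬ v z τ [0, j]) ∧ (∀ z τ, v z τ [1]) ∧ ∀ z τ f j, ¬ v z τ [5, f, j] := by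
  have hpow : 0 < 2 ^ N := by positivity
  choose num hlt hnum using exists_testBit_eq N
  have hR : ∀ t < 2 ^ N, ∀ i < 2 ^ N, X t i < R := by
    intro t ht i hi
    cases t with
    | zero => exact hini _ _ _ (hX.1 i hi)
    | succ t =>
      obtain ⟨i', hi', rfl⟩ : ∃ i' < 2 ^ N, (i' + 1) % 2 ^ N = i := by
        by_cases h0 : i = 0
        · exact ⟨2 ^ N - 1, by omega, by rw [Nat.sub_add_cancel hpow, Nat.mod_self, h0]⟩
        · exact ⟨i - 1, by omega, by rw [Nat.sub_add_cancel (by omega), Nat.mod_eq_of_lt hi]⟩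
      exact hnxt _ _ _ _ (hX.2 t i' ht hi')
  let T : (ℕ → Bool × Bool) → ℕ := fun z => num fun j => (z j).1
  let C : (ℕ → Bool × Bool) → ℕ := fun z => num fun j => (z j).2
  -- Members of `types R` have three entries; the default `0` only serves other lists.
  let K : (ℕ → Bool × Bool) → List ℕ → ℕ := fun z τ =>
    kind N X (T z) (C z) (τ.getD 0 0) (τ.getD 1 0) (τ.getD 2 0)
  refine ⟨fun z τ => leafVal code w N (T z) (C z) τ (K z τ) (claimRow N (T z) (K z τ))
    (claimColumn N (C z) (K z τ))
    (claimTile N X (T z) (C z) (τ.getD 0 0) (τ.getD 1 0) (τ.getD 2 0) (K z τ)), ⟨?_, ?_, ?_, ?_, ?_⟩,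
    ?_, ?_, ?_⟩
  · exact fun z τ _ => rfl
  · intro z τ _ j hj
    simp only [leafVal, T, hnum _ j hj]
  · intro z τ _ j hj
    simp only [leafVal, C, hnum _ j hj]
  · intro z τ hτ
    obtain ⟨⟨a, b, c⟩, -, rfl⟩ := List.mem_map.1 hτ
    exact leafVal_allSat hcode hX (hlt _) (hlt _)
  · intro z τ hτ z' τ' hτ' h₆ h₇
    by_contra hcon
    push Not at hcon
    obtain ⟨⟨a, b, c⟩, hm, rfl⟩ := List.mem_map.1 hτ
    obtain ⟨⟨a', b', c'⟩, hm', rfl⟩ := List.mem_map.1 hτ'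
    change kind N X (T z) (C z) a b c = 3 at h₆
    change kind N X (T z') (C z') a' b' c' ≠ 3 at h₇
    have e₁ := claim_iff.1 h₆
    have e₂ := mt claim_iff.2 h₇
    have hrow : ∀ x κ, x < 2 ^ N → claimRow N x κ < 2 ^ N := by
      intro x κ hx
      unfold claimRow
      split
      · exact Nat.mod_lt _ hpow
      · exact hx
    have hcol : ∀ x κ, x < 2 ^ N → claimColumn N x κ < 2 ^ N := by
      intro x κ hx
      unfold claimColumn
      split
      · exact hx
      · exact Nat.mod_lt _ hpow
      · exact Nat.mod_lt _ hpow
    have r := eq_of_testBit_iff (hrow _ (K z [a, b, c]) (hlt fun j => (z j).1))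
      (hrow _ (K z' [a', b', c']) (hlt fun j => (z' j).1))
      fun j hj => hcon (0, j) (by simp [bits, hj])
    have s := eq_of_testBit_iff (hcol _ (K z [a, b, c]) (hlt fun j => (z j).2))
      (hcol _ (K z' [a', b', c']) (hlt fun j => (z' j).2))
      fun j hj => hcon (1, j) (by simp [bits, hj])
    have hρ : claimTile N X (T z) (C z) a b c (K z [a, b, c]) < R := by
      change claimTile N X (T z) (C z) a b c (kind N X (T z) (C z) a b c) < R
      rw [← e₁]
      exact hR _ (hrow _ _ (hlt _)) _ (hcol _ _ (hlt _))
    -- The bit of the first claim's own tile is set at the first leaf, hence at the second one,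
    -- which says that the tiles are equal.
    have q := (hcon (2, claimTile N X (T z) (C z) a b c (K z [a, b, c])) (List.mem_append_right _
      (List.mem_map_of_mem (List.mem_range.2 hρ)))).1 rfl
    apply e₂
    change claimRow N (T z) (kind N X (T z) (C z) a b c) =
      claimRow N (T z') (kind N X (T z') (C z') a' b' c') at r
    change claimColumn N (C z) (kind N X (T z) (C z) a b c) =
      claimColumn N (C z') (kind N X (T z') (C z') a' b' c') at s
    change claimTile N X (T z) (C z) a b c (kind N X (T z) (C z) a b c) =
      claimTile N X (T z') (C z') a' b' c' (kind N X (T z') (C z') a' b' c') at q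
    rw [← r, ← s, ← q]
    exact e₁
  · exact fun z τ j h => h
  · exact fun z τ => trivial
  · exact fun z τ f j h => h

/-- The knowledge base for the word `w`. -/
def wordKB (code : Option α → ℕ) (nxt : ℕ → ℕ → ℕ → List ℕ) (ini : Option α → Bool → List ℕ)
    (os : List (Option α)) (R N : ℕ) (w : List α) : KB :=
  kb N (types R) (bits R N) (wordClauses code w ++ generalClauses code nxt ini os R N)

theorem entails_iff_no_tiling (hcode : Function.Injective code) (hw : w.length ≤ N) (hN : 0 < N)
    (hR : 0 < R) (hos : ∀ o, o ∈ os)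
    (hnxt : ∀ a b c, ∀ ρ ∈ nxt a b c, ρ < R) (hini : ∀ o b, ∀ ρ ∈ ini o b, ρ < R) :
    (wordKB code nxt ini os R N w).Entails (query N (bits R N)) ↔
      ¬ ∃ X, IsTiling nxt ini w N X := by
  constructor
  · rintro h ⟨X, hX⟩
    obtain ⟨v, hv, h₀, h₁, h₅⟩ := exists_family_of_tiling (os := os) hcode hX hnxt hini
    exact not_entails_of_family hv h₀ h₁ h₅ h
  · intro h
    by_contra hne
    obtain ⟨v, hv⟩ := exists_family_of_not_entails hne
    exact h (exists_tiling_of_family hv hw hN hR hos hnxt hini)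

end DL.Reduction

-- Accepting runs of nondeterministic machines as tilings.

namespace NTM

open Turing (Dir)

variable {α : Type} (M : NTM α)

/-! ### Computations as tilings -/

/-- A transition, or `none` for a pause in the accepting state. -/
abbrev Instr := Option (M.Q × M.Γ × Dir)

/-- A tile describes a cell at some time: whether it is the leftmost one, its symbol, and, if the
head is there, the state and the next instruction. -/
abbrev Tile := Bool × M.Γ × Option (M.Q × M.Instr)

variable {M}

def Enabled (q : M.Q) (γ : M.Γ) : M.Instr → Prop
  | none => q = M.accept
  | some d => q ≠ M.accept ∧ d ∈ M.δ q γ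

def Cfg.next (c : M.Cfg) : M.Instr → M.Cfg
  | none => c
  | some (q, b, d) => ⟨q, move d c.head, Function.update c.tape c.head b⟩

def tileOf (c : M.Cfg) (tr : M.Instr) (i : ℕ) : M.Tile :=
  (decide (i = 0), c.tape i, if c.head = i then some (c.state, tr) else none)

/-- The tile at the head guesses the next instruction. This is all the nondeterminism: the rest of a
tile, its `view`, follows from the row before. -/
def ValidTile (x : M.Tile) : Prop := ∀ q tr, x.2.2 = some (q, tr) → Enabled q x.2.1 tr

/-- A tile without the instruction. -/
def view (x : M.Tile) : Bool × M.Γ × Option M.Q := (x.1, x.2.1, x.2.2.map Prod.fst)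

def written (x : M.Tile) : M.Γ :=
  match x.2.2 with
  | some (_, some (_, b, _)) => b
  | _ => x.2.1

/-- The flag of the leftmost cell keeps the head there on a move to the left and cuts the cycle: no
state arrives across the seam. -/
def arrival (x y z : M.Tile) : Option M.Q :=
  match y.2.2 with
  | some (q, none) => some q
  | some (_, some (q, _, Dir.left)) => if y.1 then some q else none
  | some (_, some (_, _, Dir.right)) => none
  | none =>
    match x.2.2 with
    | some (_, some (q, _, Dir.right)) => if y.1 then none else some q
    | _ =>
      match z.2.2 with
      | some (_, some (q, _, Dir.left)) => if z.1 then none else some q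
      | _ => none

/-- The tile `y'` may occur at the position of `y` one step later; `x` and `z` are the neighbours. -/
def NextTile (x y z y' : M.Tile) : Prop :=
  ValidTile y' ∧ view y' = (y.1, written y, arrival x y z)

variable (M) in
/-- The tiles at time `0`, given the input symbol and whether the cell is the leftmost one. -/
def InitTile (o : Option α) (b : Bool) (x : M.Tile) : Prop :=
  ValidTile x ∧ view x = (b, (o.map M.input).getD M.blank, if b then some M.start else none)

theorem written_tileOf (c : M.Cfg) (tr : M.Instr) (p : ℕ) :
    written (tileOf c tr p) = (c.next tr).tape p := by
  by_cases h : c.head = p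
  · subst h
    rcases tr with - | ⟨q, b, d⟩ <;> simp [written, tileOf, Cfg.next]
  · rcases tr with - | ⟨q, b, d⟩
    · simp [written, tileOf, Cfg.next, h]
    · simp [written, tileOf, Cfg.next, h, Function.update_of_ne (Ne.symm h)]

theorem tileOf_of_eq (c : M.Cfg) (tr : M.Instr) {i : ℕ} (h : c.head = i) :
    (tileOf c tr i).2.2 = some (c.state, tr) := if_pos h

theorem tileOf_of_ne (c : M.Cfg) (tr : M.Instr) {i : ℕ} (h : c.head ≠ i) :
    (tileOf c tr i).2.2 = none := if_neg h

/-- As `L ≥ 4`, the cells `i`, `p`, `k` are distinct, and by `hc` the head does not leave the row to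
the right. -/
theorem arrival_tileOf (c : M.Cfg) (tr : M.Instr) {L i p k : ℕ} (hL : 4 ≤ L) (hc : c.head + 1 < L)
    (hi : i < L) (hp : i + 1 < L ∧ p = i + 1 ∨ i + 1 = L ∧ p = 0)
    (hk : p + 1 < L ∧ k = p + 1 ∨ p + 1 = L ∧ k = 0) :
    arrival (tileOf c tr i) (tileOf c tr p) (tileOf c tr k) =
      if (c.next tr).head = p then some (c.next tr).state else none := by
  by_cases h₁ : c.head = p
  · rcases tr with - | ⟨q, b, d | d⟩
    · simp only [arrival, tileOf_of_eq c _ h₁]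
      exact (if_pos h₁).symm
    · simp only [arrival, tileOf_of_eq c _ h₁]
      by_cases h₀ : p = 0
      · rw [if_pos (show (tileOf c _ p).1 = true from decide_eq_true h₀)]
        exact (if_pos (show c.head - 1 = p by omega)).symm
      · rw [if_neg (show ¬ (tileOf c _ p).1 = true from of_decide_eq_false (by simp [tileOf, h₀]))]
        exact (if_neg (show ¬ c.head - 1 = p by omega)).symm
    · simp only [arrival, tileOf_of_eq c _ h₁]
      exact (if_neg (show ¬ c.head + 1 = p by omega)).symm
  · by_cases h₂ : c.head = i
    · have h₃ : c.head ≠ k := by omega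
      rcases tr with - | ⟨q, b, d | d⟩
      · simp only [arrival, tileOf_of_ne c _ h₁, tileOf_of_eq c _ h₂, tileOf_of_ne c _ h₃]
        exact (if_neg h₁).symm
      · simp only [arrival, tileOf_of_ne c _ h₁, tileOf_of_eq c _ h₂, tileOf_of_ne c _ h₃]
        exact (if_neg (show ¬ c.head - 1 = p by omega)).symm
      · simp only [arrival, tileOf_of_ne c _ h₁, tileOf_of_eq c _ h₂]
        have h₀ : p ≠ 0 := by omega
        rw [if_neg (show ¬ (tileOf c _ p).1 = true from of_decide_eq_false (by simp [tileOf, h₀]))]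
        exact (if_pos (show c.head + 1 = p by omega)).symm
    · by_cases h₃ : c.head = k
      · rcases tr with - | ⟨q, b, d | d⟩
        · simp only [arrival, tileOf_of_ne c _ h₁, tileOf_of_ne c _ h₂, tileOf_of_eq c _ h₃]
          exact (if_neg h₁).symm
        · simp only [arrival, tileOf_of_ne c _ h₁, tileOf_of_ne c _ h₂, tileOf_of_eq c _ h₃]
          by_cases h₀ : k = 0
          · rw [if_pos (show (tileOf c _ k).1 = true from decide_eq_true h₀)]
            exact (if_neg (show ¬ c.head - 1 = p by omega)).symm
          · rw [if_neg (show ¬ (tileOf c _ k).1 = true from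
              of_decide_eq_false (by simp [tileOf, h₀]))]
            exact (if_pos (show c.head - 1 = p by omega)).symm
        · simp only [arrival, tileOf_of_ne c _ h₁, tileOf_of_ne c _ h₂, tileOf_of_eq c _ h₃]
          exact (if_neg (show ¬ c.head + 1 = p by omega)).symm
      · simp only [arrival, tileOf_of_ne c _ h₁, tileOf_of_ne c _ h₂, tileOf_of_ne c _ h₃]
        rcases tr with - | ⟨q, b, d | d⟩
        · exact (if_neg h₁).symm
        · exact (if_neg (show ¬ c.head - 1 = p by omega)).symm
        · exact (if_neg (show ¬ c.head + 1 = p by omega)).symm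

theorem validTile_tileOf {c : M.Cfg} {tr : M.Instr}
    (h : Enabled c.state (c.tape c.head) tr) (i : ℕ) : ValidTile (tileOf c tr i) := by
  intro q tr' e
  simp only [tileOf] at e
  split_ifs at e with hi
  cases e
  rw [← hi]
  exact h

theorem view_tileOf (c : M.Cfg) (tr : M.Instr) (i : ℕ) :
    view (tileOf c tr i) = (decide (i = 0), c.tape i, if c.head = i then some c.state else none) := by
  simp only [view, tileOf]
  split_ifs <;> rfl

theorem nextTile_view (c : M.Cfg) (tr tr' : M.Instr) {L i : ℕ} (hL : 4 ≤ L) (hc : c.head + 1 < L)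
    (hi : i < L) :
    ((tileOf c tr ((i + 1) % L)).1, written (tileOf c tr ((i + 1) % L)),
      arrival (tileOf c tr i) (tileOf c tr ((i + 1) % L)) (tileOf c tr ((i + 2) % L))) =
    view (tileOf (c.next tr) tr' ((i + 1) % L)) := by
  rw [view_tileOf, written_tileOf, arrival_tileOf c tr hL hc hi]
  · rfl
  · by_cases h : i + 1 < L
    · exact Or.inl ⟨h, Nat.mod_eq_of_lt h⟩
    · have : i + 1 = L := by omega
      exact Or.inr ⟨this, by rw [this, Nat.mod_self]⟩
  · by_cases h : i + 1 < L
    · rw [Nat.mod_eq_of_lt h]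
      by_cases h' : i + 2 < L
      · exact Or.inl ⟨h', Nat.mod_eq_of_lt h'⟩
      · have : i + 2 = L := by omega
        exact Or.inr ⟨this, by rw [this, Nat.mod_self]⟩
    · have e : i + 1 = L := by omega
      rw [e, Nat.mod_self, show i + 2 = 1 + L by omega, Nat.add_mod_right,
        Nat.mod_eq_of_lt (by omega)]
      exact Or.inl ⟨by omega, rfl⟩

theorem tile_eq_of_view {x : M.Tile} {c : M.Cfg} {tr : M.Instr} {i : ℕ}
    (h : view x = view (tileOf c tr i))
    (htr : c.head = i → ∀ q tr', x.2.2 = some (q, tr') → tr' = tr) : x = tileOf c tr i := by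
  rw [view_tileOf] at h
  obtain ⟨b, γ, o⟩ := x
  simp only [view, Prod.mk.injEq] at h
  obtain ⟨rfl, rfl, h⟩ := h
  simp only [tileOf, Prod.mk.injEq, true_and]
  split_ifs at h ⊢ with hi
  · obtain ⟨⟨q, tr'⟩, rfl, hq⟩ := Option.map_eq_some_iff.1 h
    rw [htr hi q tr' rfl, ← hq]
  · exact Option.map_eq_none_iff.1 h

theorem exists_instr {x : M.Tile} {c : M.Cfg} (hv : ValidTile x)
    (h : view x = view (tileOf c none c.head)) :
    ∃ tr, x.2.2 = some (c.state, tr) ∧ Enabled c.state (c.tape c.head) tr := by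
  rw [view_tileOf] at h
  simp only [view, Prod.mk.injEq, if_true] at h
  obtain ⟨-, hγ, h⟩ := h
  obtain ⟨⟨q, tr⟩, hx, rfl⟩ := Option.map_eq_some_iff.1 h
  exact ⟨tr, hx, hγ ▸ hv _ _ hx⟩

theorem Reaches.snoc {n : ℕ} {c d e : M.Cfg} (h : M.Reaches n c d) (h' : M.Step d e) :
    M.Reaches (n + 1) c e := by
  induction n generalizing c with
  | zero =>
    cases h
    exact ⟨e, h', rfl⟩
  | succ n ih =>
    obtain ⟨c', hc, h⟩ := h
    exact ⟨c', hc, ih h⟩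

/-- A tiling of `L` rows of length `L`, closed to a cycle each, by tiles of the machine. -/
def IsTrace (M : NTM α) (L : ℕ) (w : List α) (Y : ℕ → ℕ → M.Tile) : Prop :=
  (∀ i < L, M.InitTile w[i]? (decide (i = 0)) (Y 0 i)) ∧
    ∀ t i, t + 1 < L → i < L →
      NextTile (Y t i) (Y t ((i + 1) % L)) (Y t ((i + 2) % L)) (Y (t + 1) ((i + 1) % L))

theorem head_next_le (c : M.Cfg) (tr : M.Instr) : (c.next tr).head ≤ c.head + 1 := by
  rcases tr with - | ⟨q, b, d | d⟩ <;> simp [Cfg.next, move]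
  omega

/-- An accepting computation is prolonged forever by pauses, so that it fills any number of rows. -/
theorem exists_run : ∀ (n : ℕ) (c₀ c' : M.Cfg), M.Reaches n c₀ c' → c'.state = M.accept →
    ∃ (c : ℕ → M.Cfg) (tr : ℕ → M.Instr), c 0 = c₀ ∧ ∀ t, c (t + 1) = (c t).next (tr t) ∧
      Enabled (c t).state ((c t).tape (c t).head) (tr t)
  | 0, c₀, c', h, ha => by
    cases h
    exact ⟨fun _ => c₀, fun _ => none, rfl, fun t => ⟨rfl, ha⟩⟩
  | n + 1, c₀, c', ⟨d, ⟨hne, q, b, m, hδ, hd⟩, h⟩, ha => by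
    obtain ⟨c, tr, h₀, hc⟩ := exists_run n d c' h ha
    refine ⟨fun t => t.casesOn c₀ c, fun t => t.casesOn (some (q, b, m)) tr, rfl, fun t => ?_⟩
    cases t with
    | zero => exact ⟨h₀.trans hd, hne, hδ⟩
    | succ t => exact hc t

theorem init_view (w : List α) (i : ℕ) (tr : M.Instr) :
    view (tileOf (M.init w) tr i) =
      (decide (i = 0), (w[i]?.map M.input).getD M.blank,
        if decide (i = 0) = true then some M.start else none) := by
  rw [view_tileOf]
  simp [init, eq_comm]

theorem exists_trace_of_accepts {L : ℕ} (hL : 4 ≤ L) {w : List α} {n : ℕ} {c' : M.Cfg}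
    (h : M.Reaches n (M.init w) c') (ha : c'.state = M.accept) : ∃ Y, M.IsTrace L w Y := by
  obtain ⟨c, tr, h₀, hc⟩ := exists_run n _ _ h ha
  have hhead : ∀ t, (c t).head ≤ t := by
    intro t
    induction t with
    | zero => rw [h₀]; exact le_rfl
    | succ t ih =>
      rw [(hc t).1]
      exact (head_next_le _ _).trans (by omega)
  refine ⟨fun t i => tileOf (c t) (tr t) i, fun i _ => ⟨validTile_tileOf (hc 0).2 i, ?_⟩,
    fun t i ht hi => ⟨validTile_tileOf (hc (t + 1)).2 _, ?_⟩⟩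
  · simp only [h₀]
    exact init_view w i _
  · rw [nextTile_view (c t) (tr t) (tr (t + 1)) hL (by have := hhead t; omega) hi, ← (hc t).1]

/-- A pause is possible only in the accepting state. Without acceptance every row would be a genuine
step of a computation of `L - 1 > B` steps, against the time bound. -/
theorem accepts_of_trace {L B : ℕ} (hL : 4 ≤ L) (hB : B + 1 < L) {w : List α}
    (hbound : ∀ n c, M.Reaches n (M.init w) c → n ≤ B) {Y : ℕ → ℕ → M.Tile}
    (hY : M.IsTrace L w Y) : ∃ n c, M.Reaches n (M.init w) c ∧ c.state = M.accept := by
  by_contra hno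
  push Not at hno
  have key : ∀ t < L, ∃ c tr, M.Reaches t (M.init w) c ∧ c.head ≤ t ∧
      Enabled c.state (c.tape c.head) tr ∧ ∀ i < L, Y t i = tileOf c tr i := by
    intro t
    induction t with
    | zero =>
      intro _
      have hv : ∀ i < L, ∀ tr, view (Y 0 i) = view (tileOf (M.init w) tr i) := fun i hi tr => by
        rw [init_view]
        exact (hY.1 i hi).2
      obtain ⟨tr, htr, hen⟩ := exists_instr (hY.1 0 (by omega)).1 (hv 0 (by omega) none)
      refine ⟨M.init w, tr, rfl, le_rfl, hen, fun i hi => tile_eq_of_view (hv i hi tr) ?_⟩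
      intro hi0 q tr' e
      have hi0 : 0 = i := hi0
      subst hi0
      rw [htr] at e
      cases e
      rfl
    | succ t ih =>
      intro ht
      obtain ⟨c, tr, hr, hh, hen, hc⟩ := ih (by omega)
      have hstep : M.Step c (c.next tr) := by
        rcases tr with - | ⟨q, b, d⟩
        · exact absurd hen (hno _ _ hr)
        · exact ⟨hen.1, q, b, d, hen.2, rfl⟩
      have hnext : ∀ p < L, ValidTile (Y (t + 1) p) ∧
          ∀ tr', view (Y (t + 1) p) = view (tileOf (c.next tr) tr' p) := by
        intro p hp
        obtain ⟨i, hi, rfl⟩ : ∃ i < L, (i + 1) % L = p := by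
          by_cases h0 : p = 0
          · exact ⟨L - 1, by omega, by rw [Nat.sub_add_cancel (by omega), Nat.mod_self, h0]⟩
          · exact ⟨p - 1, by omega, by rw [Nat.sub_add_cancel (by omega), Nat.mod_eq_of_lt hp]⟩
        obtain ⟨h₁, h₂⟩ := hY.2 t i ht hi
        refine ⟨h₁, fun tr' => ?_⟩
        rw [h₂, hc i hi, hc _ (Nat.mod_lt _ (by omega)), hc _ (Nat.mod_lt _ (by omega))]
        exact nextTile_view c tr tr' hL (by omega) hi
      have hh' : (c.next tr).head ≤ t + 1 := (head_next_le _ _).trans (by omega)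
      obtain ⟨hv, hw⟩ := hnext (c.next tr).head (by omega)
      obtain ⟨tr', htr', hen'⟩ := exists_instr hv (hw none)
      refine ⟨c.next tr, tr', hr.snoc hstep, hh', hen', fun p hp =>
        tile_eq_of_view ((hnext p hp).2 tr') ?_⟩
      rintro rfl q tr'' e
      rw [htr'] at e
      cases e
      rfl
  obtain ⟨c, -, hr, -⟩ := key (L - 1) (by omega)
  have := hbound _ _ hr
  omega

/-! ### Tiles as numbers -/

theorem exists_codes (M : NTM α) : ∃ (R : ℕ) (nxt : ℕ → ℕ → ℕ → List ℕ)
    (ini : Option α → Bool → List ℕ), 0 < R ∧ (∀ a b c, ∀ ρ ∈ nxt a b c, ρ < R) ∧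
      (∀ o b, ∀ ρ ∈ ini o b, ρ < R) ∧ ∀ (N : ℕ) (w : List α),
        (∃ X, DL.Reduction.IsTiling nxt ini w N X) ↔ ∃ Y, M.IsTrace (2 ^ N) w Y := by
  classical
  have := M.finQ
  have := M.finΓ
  have : Finite Dir := Finite.of_surjective (fun b : Bool => cond b Dir.left Dir.right) (by
    intro d
    cases d
    exacts [⟨true, rfl⟩, ⟨false, rfl⟩])
  obtain ⟨R, ⟨e⟩⟩ := Finite.exists_equiv_fin M.Tile
  have hR : 0 < R := (Nat.zero_le _).trans_lt (e (true, M.blank, none)).2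
  let dec : ℕ → M.Tile := fun r => if h : r < R then e.symm ⟨r, h⟩ else (true, M.blank, none)
  have hdec : ∀ x, dec (e x) = x := fun x => by simp [dec]
  refine ⟨R, fun a b c => (List.range R).filter fun r => NextTile (dec a) (dec b) (dec c) (dec r),
    fun o b => (List.range R).filter fun r => M.InitTile o b (dec r), hR,
    fun a b c ρ h => List.mem_range.1 (List.mem_filter.1 h).1,
    fun o b ρ h => List.mem_range.1 (List.mem_filter.1 h).1, fun N w => ⟨?_, ?_⟩⟩
  · rintro ⟨X, h₁, h₂⟩
    refine ⟨fun t i => dec (X t i), fun i hi => ?_, fun t i ht hi => ?_⟩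
    · simpa using (List.mem_filter.1 (h₁ i hi)).2
    · simpa using (List.mem_filter.1 (h₂ t i ht hi)).2
  · rintro ⟨Y, h₁, h₂⟩
    refine ⟨fun t i => e (Y t i), fun i hi => ?_, fun t i ht hi => ?_⟩
    · exact List.mem_filter.2 ⟨List.mem_range.2 (Fin.is_lt _), by simpa [hdec] using h₁ i hi⟩
    · exact List.mem_filter.2 ⟨List.mem_range.2 (Fin.is_lt _), by simpa [hdec] using h₂ t i ht hi⟩

end NTM

-- A language of stack programs and its compilation to `TM2` machines.

namespace StackProgram

open Turing Function

/-! ### Programs on stacks -/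

variable {K : Type} (Γ : K → Type)

/-- Programs that work on stacks. -/
inductive Cmd where
  | skip
  | push (k : K) (x : Γ k)
  | seq (a b : Cmd)
  /-- As long as the stack `k` is not empty, pop its topmost symbol and run the program which
  belongs to this symbol. -/
  | loop (k : K) (c : Γ k → Cmd)

/-- The contents of the stacks. -/
abbrev Stacks := ∀ k, List (Γ k)

variable {Γ} [DecidableEq K]

/-- `Exec c S S' n`: the program `c`, started with `S`, terminates with `S'`; its cost is `n`. -/
inductive Exec : Cmd Γ → Stacks Γ → Stacks Γ → ℕ → Prop
  | skip (S : Stacks Γ) : Exec .skip S S 0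
  | push (k : K) (x : Γ k) (S : Stacks Γ) : Exec (.push k x) S (update S k (x :: S k)) 1
  | seq {a b : Cmd Γ} {S S' S'' : Stacks Γ} {m n : ℕ} : Exec a S S' m → Exec b S' S'' n →
      Exec (.seq a b) S S'' (m + n)
  | loop_nil {k : K} {c : Γ k → Cmd Γ} {S : Stacks Γ} : S k = [] → Exec (.loop k c) S S 1
  | loop_cons {k : K} {c : Γ k → Cmd Γ} {S S' S'' : Stacks Γ} {x : Γ k} {l : List (Γ k)} {m n : ℕ} :
      S k = x :: l → Exec (c x) (update S k l) S' m → Exec (.loop k c) S' S'' n →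
      Exec (.loop k c) S S'' (m + n + 2)

/-- Each push costs one, so the cost bounds the growth of every stack; this later bounds the length
of the printed text. -/
theorem Exec.length_le {c : Cmd Γ} {S S' : Stacks Γ} {n : ℕ} (h : Exec c S S' n) (k : K) :
    (S' k).length ≤ (S k).length + n := by
  induction h with
  | skip => exact Nat.le_add_right _ _
  | push k' x S =>
    by_cases e : k = k'
    · subst e; simp
    · rw [update_of_ne e]; exact Nat.le_add_right _ _
  | seq _ _ ih₁ ih₂ => omega
  | loop_nil => exact Nat.le_add_right _ _
  | @loop_cons k' c S S' S'' x l m n hS _ _ ih₁ ih₂ =>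
    by_cases e : k = k'
    · subst e
      rw [update_self] at ih₁
      rw [hS, List.length_cons]
      omega
    · rw [update_of_ne e] at ih₁
      omega

/-! ### Compilation -/

/-- The labels of a program: in a loop, one for the loop and one for the body of each symbol. -/
def Label : Cmd Γ → Type
  | .skip => Empty
  | .push _ _ => Empty
  | .seq a b => Label a ⊕ Label b
  | .loop k c => Option (Σ x : Γ k, Option (Label (c x)))

noncomputable instance Label.fintype [∀ k, Fintype (Γ k)] : ∀ c : Cmd Γ, Fintype (Label c)
  | .skip => inferInstanceAs (Fintype Empty)
  | .push _ _ => inferInstanceAs (Fintype Empty)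
  | .seq a b =>
    have := Label.fintype a
    have := Label.fintype b
    inferInstanceAs (Fintype (Label a ⊕ Label b))
  | .loop k c =>
    have := fun x => Label.fintype (c x)
    inferInstanceAs (Fintype (Option (Σ x : Γ k, Option (Label (c x)))))

/-- The internal states: the symbol popped last. -/
abbrev Memory (Γ : K → Type) := Option (Σ k, Γ k)

variable {L : Type}

/-- The label to go to after the topmost symbol of the stack `k` has been popped. -/
def select (k : K) (f : Option (Γ k) → L) : Memory Γ → L
  | none => f none
  | some ⟨k', x⟩ => if h : k' = k then f (some (h ▸ x)) else f none

/-- Continuation-passing style: `q` is executed after the program, and the map on labels embeds them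
into the machine. `code` gives the statements at these labels. -/
def entry : (c : Cmd Γ) → (Label c → L) → TM2.Stmt Γ L (Memory Γ) → TM2.Stmt Γ L (Memory Γ)
  | .skip, _, q => q
  | .push k x, _, q => .push k (fun _ => x) q
  | .seq a b, i, q => entry a (fun l => i (.inl l)) (entry b (fun l => i (.inr l)) q)
  | .loop _ _, i, _ => .goto fun _ => i none

def code : (c : Cmd Γ) → (Label c → L) → TM2.Stmt Γ L (Memory Γ) → Label c →
    TM2.Stmt Γ L (Memory Γ)
  | .skip, _, _ => Empty.elim
  | .push _ _, _, _ => Empty.elim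
  | .seq a b, i, q => Sum.elim (code a (fun l => i (.inl l)) (entry b (fun l => i (.inr l)) q))
      (code b (fun l => i (.inr l)) q)
  | .loop k c, i, q => fun l => l.elim
      (.pop k (fun _ o => o.map (Sigma.mk k)) (.branch Option.isSome
        (.goto (select k fun o => i (o.map fun x => ⟨x, none⟩))) q))
      fun y => y.2.elim
        (entry (c y.1) (fun l => i (some ⟨y.1, some l⟩)) (.goto fun _ => i none))
        (code (c y.1) (fun l => i (some ⟨y.1, some l⟩)) (.goto fun _ => i none))

/-- `m` steps lead from `a` to `b`. -/
def Steps (p : L → TM2.Stmt Γ L (Memory Γ)) (m : ℕ) (a b : TM2.Cfg Γ L (Memory Γ)) : Prop :=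
  (flip bind (TM2.step p))^[m] (some a) = some b

theorem Steps.trans {p : L → TM2.Stmt Γ L (Memory Γ)} {m n : ℕ} {a b c : TM2.Cfg Γ L (Memory Γ)}
    (h : Steps p m a b) (h' : Steps p n b c) : Steps p (n + m) a c := by
  unfold Steps at *
  rw [iterate_add_apply, h, h']

theorem Steps.single (p : L → TM2.Stmt Γ L (Memory Γ)) (l : L) (v : Memory Γ) (S : Stacks Γ) :
    Steps p 1 ⟨some l, v, S⟩ (TM2.stepAux (p l) v S) := rfl

/-- Pushes are merged into the surrounding statement, so only jumps take steps: one pass of a loop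
needs one step to pop and one to enter its body. -/
theorem Exec.steps {p : L → TM2.Stmt Γ L (Memory Γ)} {c : Cmd Γ} {S S' : Stacks Γ} {n : ℕ}
    (h : Exec c S S' n) : ∀ (i : Label c → L) (q : TM2.Stmt Γ L (Memory Γ)) (v : Memory Γ),
      (∀ l, p (i l) = code c i q l) →
      ∃ m ≤ n, ∃ v', Steps p m (TM2.stepAux (entry c i q) v S) (TM2.stepAux q v' S') := by
  induction h with
  | skip S => exact fun i q v _ => ⟨0, le_rfl, v, rfl⟩
  | push k x S => exact fun i q v _ => ⟨0, by omega, v, rfl⟩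
  | seq _ _ ih₁ ih₂ =>
    intro i q v hp
    obtain ⟨m₁, h₁, v₁, e₁⟩ := ih₁ (fun l => i (.inl l)) (entry _ (fun l => i (.inr l)) q) v
      fun l => hp (.inl l)
    obtain ⟨m₂, h₂, v₂, e₂⟩ := ih₂ (fun l => i (.inr l)) q v₁ fun l => hp (.inr l)
    exact ⟨m₂ + m₁, by omega, v₂, e₁.trans e₂⟩
  | @loop_nil k c S hS =>
    intro i q v hp
    refine ⟨1, le_rfl, none, ?_⟩
    have := Steps.single p (i none) v S
    rw [hp none] at this
    have hS' : update S k [] = S := by rw [← hS, update_eq_self]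
    simpa [code, entry, hS, hS'] using this
  | @loop_cons k c S S' S'' x l m n hS _ _ ih₁ ih₂ =>
    intro i q v hp
    obtain ⟨m₁, h₁, v₁, e₁⟩ := ih₁ (fun l => i (some ⟨x, some l⟩)) (.goto fun _ => i none)
      (some ⟨k, x⟩) fun l => hp (some ⟨x, some l⟩)
    obtain ⟨m₂, h₂, v₂, e₂⟩ := ih₂ i q v₁ hp
    have e₃ := Steps.single p (i none) v S
    have e₄ := Steps.single p (i (some ⟨x, none⟩)) (some ⟨k, x⟩) (update S k l)
    rw [hp none] at e₃
    rw [hp (some ⟨x, none⟩)] at e₄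
    have e₅ : TM2.stepAux (code (.loop k c) i q none) v S =
        ⟨some (i (some ⟨x, none⟩)), some ⟨k, x⟩, update S k l⟩ := by
      simp [code, hS, select]
    rw [e₅] at e₃
    exact ⟨m₂ + (m₁ + (1 + 1)), by omega, v₂, ((e₃.trans e₄).trans e₁).trans e₂⟩

/-- The machine that runs a program. -/
noncomputable def machine [Fintype K] [∀ k, Fintype (Γ k)] (k₀ k₁ : K) (c : Cmd Γ) : FinTM2 where
  K := K
  k₀ := k₀
  k₁ := k₁
  Γ := Γ
  Λ := Option (Label c)
  main := none
  σ := Memory Γ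
  initialState := none
  -- The memory is reset before halting because `haltList` requires the initial internal state.
  m l := l.elim (entry c some (.load (fun _ => none) .halt))
    (code c some (.load (fun _ => none) .halt))

theorem Exec.steps_machine [Fintype K] [∀ k, Fintype (Γ k)] {k₀ k₁ : K} {c : Cmd Γ}
    {S S' : Stacks Γ} {n : ℕ} (h : Exec c S S' n) :
    ∃ m ≤ n + 1, (flip bind (machine k₀ k₁ c).step)^[m]
      (some (⟨some none, none, S⟩ : TM2.Cfg Γ (Option (Label c)) (Memory Γ))) =
      some (⟨none, none, S'⟩ : TM2.Cfg Γ (Option (Label c)) (Memory Γ)) := by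
  obtain ⟨m, hm, v, e⟩ := h.steps (p := (machine k₀ k₁ c).m) some
    (.load (fun _ => none) .halt) none fun l => rfl
  exact ⟨m + 1, by omega, (Steps.single (machine k₀ k₁ c).m none none S).trans e⟩

end StackProgram

-- Printing texts that depend on unary numbers.

namespace StackProgram

open Turing Function

/-! ### Programs that print text

All stacks but the one with the input have the same alphabet. Text is printed to `buf`, in reverse
order. Numbers are kept in unary: `size`, and indices `idx ℓ` of loops, with `rest ℓ` for what
remains to be done. -/

inductive Reg where
  | out
  | buf
  | tmp
  | size
  | idx (ℓ : Fin 2)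
  | rest (ℓ : Fin 2)
  deriving DecidableEq, Fintype

variable {α β : Type}

variable (α β) in
/-- The alphabets of the stacks; `none` is the input. -/
def Alphabet : Option Reg → Type
  | none => α
  | some _ => β

def contents (w : List α) (ρ : Reg → List β) : Stacks (Alphabet α β)
  | none => w
  | some v => ρ v

theorem update_contents_some (w : List α) (ρ : Reg → List β) (v : Reg) (l : List β) :
    update (contents w ρ) (some v) l = contents w (update ρ v l) := by
  funext k
  cases k with
  | none => rfl
  | some u =>
    by_cases h : u = v
    · subst h
      exact (update_self _ _ _).trans (update_self (β := fun _ => List β) u l ρ).symm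
    · exact (update_of_ne (by simpa using h) _ _).trans (update_of_ne (β := fun _ => List β) h l ρ).symm

theorem update_contents_none (w : List α) (ρ : Reg → List β) (l : List α) :
    update (contents w ρ) none l = contents l ρ := by
  funext k
  cases k with
  | none => exact update_self _ _ _
  | some u => exact update_of_ne (by simp) _ _

/-- The program `c` terminates with the given result; its cost is at most `n`. -/
def Runs (c : Cmd (Alphabet α β)) (w : List α) (ρ : Reg → List β) (w' : List α)
    (ρ' : Reg → List β) (n : ℕ) : Prop :=
  ∃ m ≤ n, Exec c (contents w ρ) (contents w' ρ') m

section Runs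

variable {a b : Cmd (Alphabet α β)} {w w' w'' : List α} {ρ ρ' ρ'' : Reg → List β} {m n : ℕ}

theorem Runs.mono (h : Runs a w ρ w' ρ' m) (hmn : m ≤ n) : Runs a w ρ w' ρ' n :=
  let ⟨k, hk, h⟩ := h
  ⟨k, hk.trans hmn, h⟩

theorem Runs.congr (h : Runs a w ρ w' ρ' m) (hρ : ρ' = ρ'') (hmn : m ≤ n) :
    Runs a w ρ w' ρ'' n := hρ ▸ h.mono hmn

theorem Runs.skip : Runs (.skip : Cmd (Alphabet α β)) w ρ w ρ 0 := ⟨0, le_rfl, .skip _⟩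

theorem Runs.push (v : Reg) (x : β) :
    Runs (.push (some v) x : Cmd (Alphabet α β)) w ρ w (update ρ v (x :: ρ v)) 1 := by
  refine ⟨1, le_rfl, ?_⟩
  rw [← update_contents_some]
  exact .push (Γ := Alphabet α β) (some v) x _

theorem Runs.seq (h : Runs a w ρ w' ρ' m) (h' : Runs b w' ρ' w'' ρ'' n) :
    Runs (.seq a b) w ρ w'' ρ'' (m + n) :=
  let ⟨_, hk, h⟩ := h
  let ⟨_, hk', h'⟩ := h'
  ⟨_, Nat.add_le_add hk hk', h.seq h'⟩

theorem Runs.loop_nil {v : Reg} {c : β → Cmd (Alphabet α β)} (h : ρ v = []) :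
    Runs (.loop (some v) c) w ρ w ρ 1 := ⟨1, le_rfl, .loop_nil h⟩

theorem Runs.loop_cons {v : Reg} {c : β → Cmd (Alphabet α β)} {x : β} {l : List β}
    (h : ρ v = x :: l) (h₁ : Runs (c x) w (update ρ v l) w' ρ' m)
    (h₂ : Runs (.loop (some v) c) w' ρ' w'' ρ'' n) :
    Runs (.loop (some v) c) w ρ w'' ρ'' (m + n + 2) := by
  obtain ⟨i, hi, h₁⟩ := h₁
  obtain ⟨j, hj, h₂⟩ := h₂
  refine ⟨i + j + 2, by omega, .loop_cons (Γ := Alphabet α β) (k := some v) (x := x) (l := l) h ?_ h₂⟩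
  rw [update_contents_some]
  exact h₁

theorem Runs.input_nil {c : α → Cmd (Alphabet α β)} : Runs (.loop none c) [] ρ [] ρ 1 :=
  ⟨1, le_rfl, .loop_nil rfl⟩

theorem Runs.input_cons {c : α → Cmd (Alphabet α β)} {x : α} {l : List α}
    (h₁ : Runs (c x) l ρ w' ρ' m) (h₂ : Runs (.loop none c) w' ρ' w'' ρ'' n) :
    Runs (.loop none c) (x :: l) ρ w'' ρ'' (m + n + 2) := by
  obtain ⟨i, hi, h₁⟩ := h₁
  obtain ⟨j, hj, h₂⟩ := h₂
  refine ⟨i + j + 2, by omega, .loop_cons (Γ := Alphabet α β) (k := none) (x := x) (l := l) rfl ?_ h₂⟩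
  rw [update_contents_none]
  exact h₁

/-- A loop, with the states before and after its iterations. -/
theorem Runs.loop {v : Reg} {c : β → Cmd (Alphabet α β)} {σ : ℕ → Reg → List β} {k : ℕ}
    (hn : σ n v = [])
    (h : ∀ j < n, ∃ x l, σ j v = x :: l ∧ Runs (c x) w (update (σ j) v l) w (σ (j + 1)) k) :
    Runs (.loop (some v) c) w (σ 0) w (σ n) ((k + 2) * n + 1) := by
  induction n generalizing σ with
  | zero => exact (Runs.loop_nil hn).mono (by omega)
  | succ n ih =>
    obtain ⟨x, l, e, hr⟩ := h 0 (by omega)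
    have := ih (σ := fun j => σ (j + 1)) hn fun j hj => h (j + 1) (by omega)
    exact (Runs.loop_cons e hr this).mono (by ring_nf; omega)

end Runs

section Transfer

variable {w : List α} {ρ : Reg → List β}

def moveCmd (u v : Reg) : Cmd (Alphabet α β) := .loop (some u) fun x => .push (some v) x

theorem runs_moveCmd {u v : Reg} (huv : u ≠ v) :
    Runs (moveCmd u v : Cmd (Alphabet α β)) w ρ w
      (update (update ρ u []) v ((ρ u).reverse ++ ρ v)) (3 * (ρ u).length + 1) := by
  generalize hl : ρ u = l
  induction l generalizing ρ with
  | nil =>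
    have e : update (update ρ u []) v (([] : List β).reverse ++ ρ v) = ρ := by
      rw [List.reverse_nil, List.nil_append, ← hl]; simp
    rw [e]
    exact Runs.loop_nil hl
  | cons x l ih =>
    have h := Runs.push (α := α) (w := w) (ρ := update ρ u l) v x
    have := ih (ρ := update (update ρ u l) v (x :: update ρ u l v)) (by simp [huv])
    refine (Runs.loop_cons hl h this).congr ?_ (by simp; omega)
    funext y
    simp only [update_apply]
    split_ifs <;> simp_all

def drainCmd (u : Reg) : Cmd (Alphabet α β) := .loop (some u) fun _ => .skip

theorem runs_drainCmd (u : Reg) :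
    Runs (drainCmd u : Cmd (Alphabet α β)) w ρ w (update ρ u []) (2 * (ρ u).length + 1) := by
  generalize hl : ρ u = l
  induction l generalizing ρ with
  | nil =>
    have e : update ρ u [] = ρ := by rw [← hl, update_eq_self]
    rw [e]
    exact Runs.loop_nil hl
  | cons x l ih =>
    have := ih (ρ := update ρ u l) (by simp)
    rw [update_idem] at this
    exact (Runs.loop_cons hl Runs.skip this).mono (by simp; omega)

/-- Adds the number `u` to `v`. -/
def addCmd (one : β) (u v : Reg) : Cmd (Alphabet α β) :=
  .seq (.loop (some u) fun x => .seq (.push (some .tmp) x) (.push (some v) one)) (moveCmd .tmp u)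

theorem runs_addCmd_loop (one : β) {u v : Reg} (huv : u ≠ v) (hu : u ≠ .tmp) (hv : v ≠ .tmp) :
    Runs (.loop (some u) fun x => .seq (.push (some .tmp) x) (.push (some v) one) :
        Cmd (Alphabet α β)) w ρ w
      (update (update (update ρ u []) .tmp ((ρ u).reverse ++ ρ .tmp)) v
        (List.replicate (ρ u).length one ++ ρ v)) (4 * (ρ u).length + 1) := by
  generalize hl : ρ u = l
  induction l generalizing ρ with
  | nil =>
    have e : update (update (update ρ u []) .tmp (([] : List β).reverse ++ ρ .tmp)) v
        (List.replicate ([] : List β).length one ++ ρ v) = ρ := by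
      rw [List.reverse_nil, List.nil_append, List.length_nil, List.replicate_zero, List.nil_append,
        ← hl]
      simp
    rw [e]
    exact Runs.loop_nil hl
  | cons x l ih =>
    have h := (Runs.push (α := α) (w := w) (ρ := update ρ u l) .tmp x).seq (Runs.push v one)
    have := ih (ρ := _) (by
      rw [update_of_ne huv, update_of_ne hu, update_self] : (update (update (update ρ u l) .tmp
        (x :: update ρ u l .tmp)) v (one :: update (update ρ u l) .tmp
        (x :: update ρ u l .tmp) v)) u = l)
    refine (Runs.loop_cons hl h this).congr ?_ (by simp; omega)
    funext y
    simp only [update_apply]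
    split_ifs <;> simp_all [List.replicate_succ']

theorem runs_addCmd (one : β) {u v : Reg} (huv : u ≠ v) (hu : u ≠ .tmp) (hv : v ≠ .tmp)
    (htmp : ρ .tmp = []) :
    Runs (addCmd one u v : Cmd (Alphabet α β)) w ρ w
      (update ρ v (List.replicate (ρ u).length one ++ ρ v)) (7 * (ρ u).length + 2) := by
  have h := (runs_addCmd_loop (α := α) (w := w) (ρ := ρ) one huv hu hv).seq
    (runs_moveCmd (u := .tmp) (v := u) hu.symm)
  refine h.congr ?_ ?_
  · funext y
    simp only [update_apply]
    split_ifs <;> simp_all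
  · simp [hv.symm, htmp]
    omega

end Transfer

/-! ### Printable texts -/

variable (α) in
/-- Some program prints the text `f`, which may depend on the number `size` and the indices of the
loops, in polynomial time. It does not use the loops `ℓ ∉ I`. -/
def Prints (I : Set (Fin 2)) (f : ℕ → (Fin 2 → ℕ) → List β) : Prop :=
  ∃ (c : Cmd (Alphabet α β)) (t : Polynomial ℕ), ∀ (w : List α) (ρ : Reg → List β) (B : ℕ),
    ρ .tmp = [] → (∀ ℓ ∈ I, ρ (.idx ℓ) = [] ∧ ρ (.rest ℓ) = []) → (ρ .size).length ≤ B →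
    (∀ ℓ, (ρ (.idx ℓ)).length ≤ B) →
    Runs c w ρ w (update ρ .buf
      ((f (ρ .size).length fun ℓ => (ρ (.idx ℓ)).length).reverse ++ ρ .buf)) (t.eval B)

namespace Prints

variable {I J : Set (Fin 2)} {f g : ℕ → (Fin 2 → ℕ) → List β}

theorem mono (h : Prints α I f) (hIJ : I ⊆ J) : Prints α J f :=
  let ⟨c, t, h⟩ := h
  ⟨c, t, fun w ρ B h₁ h₂ => h w ρ B h₁ fun ℓ hℓ => h₂ ℓ (hIJ hℓ)⟩

theorem append (hf : Prints α I f) (hg : Prints α I g) :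
    Prints α I fun N e => f N e ++ g N e := by
  obtain ⟨c, t, hc⟩ := hf
  obtain ⟨d, s, hd⟩ := hg
  refine ⟨.seq c d, t + s, fun w ρ B h₁ h₂ h₃ h₄ => ?_⟩
  rw [Polynomial.eval_add]
  have := (hc w ρ B h₁ h₂ h₃ h₄).seq (hd w _ B (by simpa using h₁) (by simpa using h₂)
    (by simpa using h₃) (by simpa using h₄))
  simpa using this

theorem nil : Prints α I fun _ _ => ([] : List β) :=
  ⟨.skip, 0, fun w ρ B _ _ _ _ => by simpa using Runs.skip⟩

theorem singleton (x : β) : Prints α I fun _ _ => [x] :=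
  ⟨.push (some .buf) x, 1, fun w ρ B _ _ _ _ => by simpa using Runs.push .buf x⟩

theorem const (l : List β) : Prints α I fun _ _ => l := by
  induction l with
  | nil => exact nil
  | cons x l ih => exact (singleton x).append ih

theorem cons (x : β) (hf : Prints α I f) : Prints α I fun N e => x :: f N e :=
  (singleton x).append hf

theorem flatMap {ι : Type} (l : List ι) {f : ι → ℕ → (Fin 2 → ℕ) → List β}
    (h : ∀ i, Prints α I (f i)) : Prints α I fun N e => l.flatMap fun i => f i N e := by
  induction l with
  | nil => exact nil
  | cons x l ih => exact (h x).append ih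

theorem number (one : β) (v : Reg) (hv : v ≠ .buf) (hv' : v ≠ .tmp)
    (f : ℕ → (Fin 2 → ℕ) → ℕ)
    (hf : ∀ ρ : Reg → List β, f (ρ .size).length (fun ℓ => (ρ (.idx ℓ)).length) = (ρ v).length)
    (hB : ∀ (ρ : Reg → List β) (B : ℕ), (ρ .size).length ≤ B → (∀ ℓ, (ρ (.idx ℓ)).length ≤ B) →
      (ρ v).length ≤ B) :
    Prints α I fun N e => List.replicate (f N e) one := by
  refine ⟨addCmd one v .buf, 7 * .X + 2, fun w ρ B h₁ _ h₂ h₃ => ?_⟩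
  have := runs_addCmd (α := α) (w := w) one hv hv' (by simp) h₁
  simp only [hf, List.reverse_replicate]
  refine this.mono ?_
  have := hB ρ B h₂ h₃
  simp
  omega

theorem size (one : β) : Prints α I fun N _ => List.replicate N one :=
  number one .size (by simp) (by simp) (fun N _ => N) (fun _ => rfl) fun _ _ h _ => h

theorem index (one : β) (ℓ : Fin 2) : Prints α I fun _ e => List.replicate (e ℓ) one :=
  number one (.idx ℓ) (by simp) (by simp) (fun _ e => e ℓ) (fun _ => rfl) fun _ _ _ h => h ℓ

/-- `rest ℓ` receives a copy of `size` and counts down while `idx ℓ` counts up; draining `idx ℓ` at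
the end restores all stacks but `buf`. -/
theorem loop (one : β) {ℓ : Fin 2} (hℓ : ℓ ∉ I) (hf : Prints α I f) :
    Prints α (insert ℓ I) fun N e => (List.range N).flatMap fun j => f N (update e ℓ j) := by
  obtain ⟨c, t, hc⟩ := hf
  refine ⟨.seq (addCmd one .size (.rest ℓ)) (.seq (.loop (some (.rest ℓ)) fun _ =>
    .seq c (.push (some (.idx ℓ)) one)) (drainCmd (.idx ℓ))),
    (7 * .X + 2) + (((t + 1 + 2) * .X + 1) + (2 * .X + 1)), fun w ρ B h₁ h₂ h₃ h₄ => ?_⟩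
  obtain ⟨h₅, h₆⟩ := h₂ ℓ (Set.mem_insert _ _)
  set N := (ρ .size).length with hN
  set e : Fin 2 → ℕ := fun ℓ => (ρ (.idx ℓ)).length with he
  let σ : ℕ → Reg → List β := fun j => update (update (update ρ (.rest ℓ)
    (List.replicate (N - j) one)) (.idx ℓ) (List.replicate j one)) .buf
    (((List.range j).flatMap fun j => f N (update e ℓ j)).reverse ++ ρ .buf)
  have r₁ : Runs (addCmd one .size (.rest ℓ)) w ρ w (σ 0) (7 * N + 2) := by
    have := runs_addCmd (α := α) (w := w) (ρ := ρ) (u := .size) (v := .rest ℓ) one (by simp)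
      (by simp) (by simp) h₁
    refine this.congr ?_ le_rfl
    funext y
    simp only [σ, update_apply]
    split_ifs <;> simp_all
  have r₂ : Runs (.loop (some (.rest ℓ)) fun _ => .seq c (.push (some (.idx ℓ)) one)) w (σ 0) w
      (σ N) ((t.eval B + 1 + 2) * N + 1) := by
    refine Runs.loop (by simp [σ]) fun j hj => ⟨one, List.replicate (N - (j + 1)) one, ?_, ?_⟩
    · rw [← List.replicate_succ, show N - (j + 1) + 1 = N - j by omega]
      simp [σ]
    · have hidx : (fun k => (update (σ j) (.rest ℓ) (List.replicate (N - (j + 1)) one)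
          (.idx k)).length) = update e ℓ j := by
        funext k
        by_cases hk : k = ℓ
        · subst hk; simp [σ]
        · simp [σ, hk, he]
      have hb := hc w (update (σ j) (.rest ℓ) (List.replicate (N - (j + 1)) one)) B
        (by simpa [σ] using h₁) ?_ (by simpa [σ] using h₃) ?_
      · rw [hidx] at hb
        have hs : (update (σ j) (.rest ℓ) (List.replicate (N - (j + 1)) one) .size).length = N := by
          simp [σ, hN]
        rw [hs] at hb
        refine (hb.seq (Runs.push (.idx ℓ) one)).congr ?_ le_rfl
        funext y
        simp only [σ, update_apply]
        split_ifs <;> simp_all [List.range_succ, List.replicate_succ]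
      · intro k hk
        have hne : k ≠ ℓ := fun e => hℓ (e ▸ hk)
        simpa [σ, hne] using h₂ k (Set.mem_insert_of_mem _ hk)
      · intro k
        rw [congrFun hidx k]
        by_cases hk : k = ℓ
        · subst hk; simp; omega
        · simpa [hk, he] using h₄ k
  have r₃ := runs_drainCmd (α := α) (w := w) (ρ := σ N) (.idx ℓ)
  have r := r₁.seq (r₂.seq r₃)
  have e₁ : update (σ N) (.idx ℓ) [] = update ρ .buf
      (((List.range N).flatMap fun j => f N (update e ℓ j)).reverse ++ ρ .buf) := by
    funext y
    simp only [σ, update_apply]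
    split_ifs <;> simp_all
  rw [e₁] at r
  refine r.mono ?_
  have : (t.eval B + 1 + 2) * N ≤ (t.eval B + 1 + 2) * B := Nat.mul_le_mul_left _ h₃
  simp [σ]
  omega

theorem loop_inner (one : β) {f : ℕ → ℕ → ℕ → List β} (hf : Prints α ∅ fun N e => f N (e 0) (e 1)) :
    Prints α {1} fun N e => (List.range N).flatMap (f N (e 0)) := by
  simpa using hf.loop one (ℓ := 1) (by simp)

theorem loop_outer (one : β) {f : ℕ → ℕ → List β} (hf : Prints α {1} fun N e => f N (e 0)) :
    Prints α Set.univ fun N _ => (List.range N).flatMap (f N) := by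
  have := hf.loop one (ℓ := 0) (by simp)
  simp only [update_self] at this
  exact this.mono (Set.subset_univ _)

end Prints

end StackProgram

-- Polynomial-time functions given by printing programs.

namespace StackProgram

open Turing Function

/-! ### A text for every input word -/

variable {α β : Type}

instance Alphabet.fintype [Fintype α] [Fintype β] : ∀ k, Fintype (Alphabet α β k)
  | none => inferInstanceAs (Fintype α)
  | some _ => inferInstanceAs (Fintype β)

theorem computable_of_runs [Fintype α] [Fintype β] {f : List α → List β} (c : Cmd (Alphabet α β))
    (t : Polynomial ℕ)
    (h : ∀ w, Runs c w (fun _ => []) [] (update (fun _ => []) .out (f w)) (t.eval w.length)) :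
    Nonempty (TM2ComputableInPolyTime (id : List α → List α) (id : List β → List β) f) := by
  let tm := machine (Γ := Alphabet α β) none (some .out) c
  have outputs : ∀ w : List α, ∃ m ≤ t.eval w.length + 1,
      (flip bind tm.step)^[m] (some (initList tm w)) = some (haltList tm (f w)) := by
    intro w
    obtain ⟨m, hm, r⟩ := h w
    obtain ⟨k, hk, r⟩ := r.steps_machine (k₀ := none) (k₁ := some Reg.out)
    refine ⟨k, by omega, ?_⟩
    have e₁ : initList tm w = (⟨some none, none, contents w fun _ => []⟩ :
        TM2.Cfg (Alphabet α β) (Option (Label c)) (Memory (Alphabet α β))) := by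
      unfold initList
      congr 1
      funext k
      cases k <;> rfl
    have e₂ : haltList tm (f w) = (⟨none, none, contents [] (update (fun _ => []) .out (f w))⟩ :
        TM2.Cfg (Alphabet α β) (Option (Label c)) (Memory (Alphabet α β))) := by
      unfold haltList
      congr 1
      funext k
      cases k with
      | none => rfl
      | some v =>
        by_cases hv : v = .out
        · subst hv
          exact (dif_pos rfl).trans (update_self (β := fun _ => List β) Reg.out (f w)
            fun _ => []).symm
        · exact (dif_neg fun e => hv (Option.some_injective _ e)).trans
            (update_of_ne (β := fun _ => List β) hv (f w) fun _ => []).symm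
    rw [e₁, e₂]
    exact r
  choose m hm r using outputs
  refine ⟨⟨⟨tm, Equiv.refl α, Equiv.refl β⟩, t + 1, fun w => ⟨⟨m w, ?_⟩, ?_⟩⟩⟩
  · have e₁ : List.map (Equiv.refl α).invFun (id w) = w := List.map_id w
    have e₂ : List.map (Equiv.refl β).invFun (id (f w)) = f w := List.map_id (f w)
    exact (congrArg (fun l => (flip bind tm.step)^[m w] (some (initList tm l))) e₁).trans
      ((r w).trans (congrArg (fun l => some (haltList tm l)) e₂.symm))
  · refine (hm w).trans (le_of_eq ?_)
    simp

/-- The number `size` is `N`, and the text `L` has been printed. -/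
def base (one : β) (N : ℕ) (L : List β) : Reg → List β :=
  update (update (fun _ => []) .size (List.replicate N one)) .buf L

theorem Prints.exists_runs (one : β) {f : ℕ → List β}
    (h : Prints α Set.univ fun N _ => f N) :
    ∃ (c : Cmd (Alphabet α β)) (t : Polynomial ℕ), ∀ (w : List α) (N B : ℕ) (L : List β), N ≤ B →
      Runs c w (base one N L) w (base one N ((f N).reverse ++ L)) (t.eval B) := by
  obtain ⟨c, t, h⟩ := h
  refine ⟨c, t, fun w N B L hN => ?_⟩
  have := h w (base one N L) B (by simp [base]) (by simp [base]) (by simpa [base] using hN)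
    (by simp [base])
  simpa [base] using this

/-- `size` counts the letters read so far, hence it is the index of the current letter, and in the
end the length of the word. -/
theorem runs_letters (one : β) (c : α → Cmd (Alphabet α β)) (g : α → ℕ → List β) (T B : ℕ)
    (h : ∀ a w N L, N ≤ B →
      Runs (c a) w (base one N L) w (base one N ((g a N).reverse ++ L)) T) (w : List α) :
    ∀ (N : ℕ) (L : List β), N + w.length ≤ B →
      Runs (.loop none fun a => .seq (c a) (.push (some .size) one)) w (base one N L) []
        (base one (N + w.length) (((w.zipIdx N).flatMap fun p => g p.1 p.2).reverse ++ L))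
        ((T + 3) * w.length + 1) := by
  induction w with
  | nil => exact fun N L _ => Runs.input_nil.congr (by simp) (by simp)
  | cons a w ih =>
    intro N L hB
    rw [List.length_cons] at hB
    have h₁ := (h a w N L (by omega)).seq (Runs.push .size one)
    have h₂ := ih (N + 1) ((g a N).reverse ++ L) (by omega)
    have e : update (base one N ((g a N).reverse ++ L)) .size
        (one :: base one N ((g a N).reverse ++ L) .size) =
        base one (N + 1) ((g a N).reverse ++ L) := by
      funext y
      simp only [base, update_apply]
      split_ifs <;> simp_all [List.replicate_succ]
    rw [e] at h₁
    refine (Runs.input_cons h₁ h₂).congr ?_ (by rw [List.length_cons]; ring_nf; omega)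
    rw [List.length_cons, show N + 1 + w.length = N + (w.length + 1) by omega]
    simp

/-- Each symbol of `idx 0` is traded for `size` plus one symbols of `rest 0`, which are then moved
back. -/
def mulCmd (one : β) : Cmd (Alphabet α β) :=
  .seq (.loop (some (.idx 0)) fun _ =>
    .seq (addCmd one .size (.rest 0)) (.push (some (.rest 0)) one)) (moveCmd (.rest 0) (.idx 0))

theorem runs_mulCmd (one : β) (w : List α) (n a : ℕ) (L : List β) :
    Runs (mulCmd one) w (update (base one n L) (.idx 0) (List.replicate a one)) w
      (update (base one n L) (.idx 0) (List.replicate (a * (n + 1)) one))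
      (10 * (a * (n + 1)) + 2) := by
  let σ : ℕ → Reg → List β := fun j => update (update (base one n L) (.idx 0)
    (List.replicate (a - j) one)) (.rest 0) (List.replicate (j * (n + 1)) one)
  have r₁ : Runs (.loop (some (.idx 0)) fun _ => .seq (addCmd one .size (.rest 0))
      (.push (some (.rest 0)) one)) w (σ 0) w (σ a) ((7 * n + 2 + 1 + 2) * a + 1) := by
    refine Runs.loop (by simp [σ]) fun j hj => ⟨one, List.replicate (a - (j + 1)) one, ?_, ?_⟩
    · rw [← List.replicate_succ, show a - (j + 1) + 1 = a - j by omega]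
      simp [σ]
    · have := (runs_addCmd (α := α) (w := w) (ρ := update (σ j) (.idx 0)
        (List.replicate (a - (j + 1)) one)) (u := .size) (v := .rest 0) one (by simp) (by simp)
        (by simp) (by simp [σ, base])).seq (Runs.push (.rest 0) one)
      refine this.congr ?_ (by simp [σ, base])
      funext y
      simp only [σ, base, update_apply]
      split_ifs <;> simp_all
      rw [← List.replicate_succ]
      congr 1
      ring
  have r₂ := runs_moveCmd (α := α) (w := w) (ρ := σ a) (u := .rest 0) (v := .idx 0) (by simp)
  have e : σ 0 = update (base one n L) (.idx 0) (List.replicate a one) := by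
    funext y
    simp only [σ, base, update_apply]
    split_ifs <;> simp_all
  rw [← e]
  refine (r₁.seq r₂).congr ?_ ?_
  · funext y
    simp only [σ, base, update_apply]
    split_ifs <;> simp_all
  · simp only [σ, update_self, List.length_replicate]
    ring_nf
    omega

def powCmd (one : β) : ℕ → Cmd (Alphabet α β)
  | 0 => .skip
  | d + 1 => .seq (mulCmd one) (powCmd one d)

theorem runs_powCmd (one : β) (w : List α) (n : ℕ) (L : List β) : ∀ d a : ℕ,
    Runs (powCmd one d) w (update (base one n L) (.idx 0) (List.replicate a one)) w
      (update (base one n L) (.idx 0) (List.replicate (a * (n + 1) ^ d) one))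
      (d * (10 * (a * (n + 1) ^ d) + 2))
  | 0, a => Runs.skip.congr (by simp) (by simp)
  | d + 1, a => by
    refine ((runs_mulCmd one w n a L).seq (runs_powCmd one w n L d (a * (n + 1)))).congr ?_ ?_
    · rw [mul_assoc, ← pow_succ']
    · rw [mul_assoc a, ← pow_succ']
      have : a * (n + 1) ≤ a * (n + 1) ^ (d + 1) :=
        Nat.mul_le_mul_left _ (Nat.le_self_pow (by omega) _)
      rw [add_mul d]
      omega

def pushNumber (one : β) (v : Reg) : ℕ → Cmd (Alphabet α β)
  | 0 => .skip
  | C + 1 => .seq (pushNumber one v C) (.push (some v) one)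

theorem runs_pushNumber (one : β) (w : List α) (ρ : Reg → List β) (v : Reg) (hv : ρ v = []) :
    ∀ C : ℕ, Runs (pushNumber one v C) w ρ w (update ρ v (List.replicate C one)) C
  | 0 => Runs.skip.congr (by simp [← hv]) le_rfl
  | C + 1 => ((runs_pushNumber one w ρ v hv C).seq (Runs.push v one)).congr
      (by simp [List.replicate_succ]) le_rfl

/-- Replaces the number `n` by `C * (n + 1) ^ d`. -/
def polyCmd (one : β) (C d : ℕ) : Cmd (Alphabet α β) :=
  .seq (pushNumber one (.idx 0) C) (.seq (powCmd one d) (.seq (drainCmd .size)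
    (moveCmd (.idx 0) .size)))

theorem runs_polyCmd (one : β) (w : List α) (C d n : ℕ) (L : List β) :
    Runs (polyCmd one C d) w (base one n L) w (base one (C * (n + 1) ^ d) L)
      (C + (d * (10 * (C * (n + 1) ^ d) + 2) + ((2 * n + 1) + (3 * (C * (n + 1) ^ d) + 1)))) := by
  have r₁ := runs_pushNumber one w (base one n L) (.idx 0) (by simp [base]) C
  have r₂ := runs_powCmd one w n L d C
  have r₃ := runs_drainCmd (α := α) (w := w) (ρ := update (base one n L) (.idx 0)
    (List.replicate (C * (n + 1) ^ d) one)) .size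
  have r₄ := runs_moveCmd (α := α) (w := w) (ρ := update (update (base one n L) (.idx 0)
    (List.replicate (C * (n + 1) ^ d) one)) .size []) (u := .idx 0) (v := .size) (by simp)
  refine (r₁.seq (r₂.seq (r₃.seq r₄))).congr ?_ ?_
  · funext y
    simp only [base, update_apply]
    split_ifs <;> simp_all
  · simp [base]

/-- One register, `size`, plays three roles in turn: position in the word for `g`, length of the
word for `h`, and polynomial bound for `G`. -/
theorem computable_of_prints [Fintype α] [Fintype β] (one : β) (pre : List β)
    {g : α → ℕ → List β} {h G : ℕ → List β} (hg : ∀ a, Prints α Set.univ fun N _ => g a N)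
    (hh : Prints α Set.univ fun N _ => h N) (hG : Prints α Set.univ fun N _ => G N) (C d : ℕ) :
    Nonempty (TM2ComputableInPolyTime (id : List α → List α) (id : List β → List β) fun w =>
      pre ++ ((w.zipIdx.flatMap fun p => g p.1 p.2) ++
        (h w.length ++ G (C * (w.length + 1) ^ d)))) := by
  obtain ⟨c₀, t₀, h₀⟩ := (Prints.const (α := α) (I := Set.univ) pre).exists_runs one
  choose c₁ t₁ h₁ using fun a => (hg a).exists_runs one
  obtain ⟨c₂, t₂, h₂⟩ := hh.exists_runs one
  obtain ⟨c₃, t₃, h₃⟩ := hG.exists_runs one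
  let N : ℕ → ℕ := fun n => C * (n + 1) ^ d
  let T : ℕ → ℕ := fun n => t₀.eval n + (((∑ a, t₁ a).eval n + 3) * n + 1 + (t₂.eval n +
    ((C + (d * (10 * N n + 2) + ((2 * n + 1) + (3 * N n + 1)))) + (t₃.eval (N n) + (2 * N n + 1)))))
  let q : Polynomial ℕ := Polynomial.C C * (.X + 1) ^ d
  let t : Polynomial ℕ := t₀ + (((∑ a, t₁ a) + 3) * .X + 1 + (t₂ +
    ((Polynomial.C C + (Polynomial.C d * (10 * q + 2) + ((2 * .X + 1) + (3 * q + 1)))) +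
      (t₃.comp q + (2 * q + 1)))))
  have ht : ∀ n, t.eval n = T n := fun n => by simp [t, T, q, N]
  let c : Cmd (Alphabet α β) := .seq c₀ (.seq (.loop none fun a => .seq (c₁ a)
    (.push (some .size) one)) (.seq c₂ (.seq (polyCmd one C d) (.seq c₃ (drainCmd .size)))))
  let f : List α → List β := fun w => pre ++ ((w.zipIdx.flatMap fun p => g p.1 p.2) ++
    (h w.length ++ G (C * (w.length + 1) ^ d)))
  have main : ∀ w, Runs (.seq c (moveCmd .buf .out)) w (fun _ => []) []
      (update (fun _ => []) .out (f w)) (4 * T w.length + 1) := by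
    intro w
    -- The sum over the finite alphabet bounds the cost for each letter.
    have r₁ := runs_letters one c₁ g ((∑ a, t₁ a).eval w.length) w.length
      (fun a w' N L hN => (h₁ a w' N w.length L hN).mono (by
        rw [Polynomial.eval_finsetSum]
        exact Finset.single_le_sum (f := fun a => (t₁ a).eval w.length) (fun _ _ => Nat.zero_le _)
          (Finset.mem_univ a))) w 0
      (pre.reverse ++ []) (by omega)
    rw [Nat.zero_add] at r₁
    have r := (h₀ w 0 w.length [] (Nat.zero_le _)).seq (r₁.seq ((h₂ [] w.length w.length _
      le_rfl).seq ((runs_polyCmd one [] C d w.length _).seq ((h₃ [] (N w.length) (N w.length) _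
        le_rfl).seq (runs_drainCmd .size)))))
    have e₀ : base one 0 [] = fun _ => [] := by
      funext y
      simp only [base, update_apply]
      split_ifs <;> rfl
    have r' : Runs c w (fun _ => []) [] (update (fun _ => []) .buf (f w).reverse) (T w.length) := by
      rw [e₀] at r
      refine r.congr ?_ ?_
      · funext y
        simp only [base, update_apply, f, N]
        split_ifs <;> simp_all
      · simp [T, base, N]
    -- The text is no longer than the time taken to print it, which bounds the cost of the final
    -- reversal from `buf` to `out`.
    have hlen : (f w).length ≤ T w.length := by
      obtain ⟨m, hm, r'⟩ := r'
      have : (update (fun _ => ([] : List β)) Reg.buf (f w).reverse Reg.buf).length ≤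
        ([] : List β).length + m := r'.length_le (some .buf)
      rw [update_self, List.length_reverse, List.length_nil] at this
      omega
    refine (r'.seq (runs_moveCmd (u := .buf) (v := .out) (by simp))).congr ?_ ?_
    · funext y
      simp only [update_apply]
      split_ifs <;> simp_all
    · simp
      omega
  refine computable_of_runs (.seq c (moveCmd .buf .out)) (4 * t + 1) fun w => (main w).mono ?_
  simp [ht]

end StackProgram

-- The text of the reduction is printable.

namespace DL.Reduction

open StackProgram

/-! ### Printing knowledge bases and queries -/

def axiomsText (l : List TAxiom) : List Sym := l.flatMap fun a => .cons :: a.enc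

def clausesText (l : List Clause) : List Sym := l.flatMap fun c => .cons :: (clauseAxiom c).enc

def atomsText (l : List CQ) : List Sym := l.flatMap fun a => .inter :: a.enc

theorem listEnc_eq {ι : Type} (enc : ι → List Sym) (l : List ι) :
    listEnc enc l = (l.flatMap fun a => .cons :: enc a) ++ [.nil] := by
  induction l with
  | nil => rfl
  | cons a l ih => simp [listEnc, ih]

/-- In prefix notation a right-nested conjunction has no closing symbols, so its text is a
concatenation. -/
theorem conjunction_enc (l : List CQ) (q : CQ) :
    (conjunction l q).enc = atomsText l ++ q.enc := by
  induction l with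
  | nil => rfl
  | cons a l ih => simp [conjunction, CQ.enc, atomsText, ih]

theorem axiomsText_append (l m : List TAxiom) :
    axiomsText (l ++ m) = axiomsText l ++ axiomsText m := List.flatMap_append

theorem axiomsText_map_clauseAxiom (l : List Clause) :
    axiomsText (l.map clauseAxiom) = clausesText l := List.flatMap_map ..

theorem clausesText_append (l m : List Clause) :
    clausesText (l ++ m) = clausesText l ++ clausesText m := List.flatMap_append

theorem atomsText_append (l m : List CQ) :
    atomsText (l ++ m) = atomsText l ++ atomsText m := List.flatMap_append

theorem axiomsText_flatMap {ι : Type} (l : List ι) (f : ι → List TAxiom) :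
    axiomsText (l.flatMap f) = l.flatMap fun i => axiomsText (f i) := List.flatMap_assoc

theorem clausesText_flatMap {ι : Type} (l : List ι) (f : ι → List Clause) :
    clausesText (l.flatMap f) = l.flatMap fun i => clausesText (f i) := List.flatMap_assoc

theorem atomsText_flatMap {ι : Type} (l : List ι) (f : ι → List CQ) :
    atomsText (l.flatMap f) = l.flatMap fun i => atomsText (f i) := List.flatMap_assoc

theorem axiomsText_map {ι : Type} (l : List ι) (f : ι → TAxiom) :
    axiomsText (l.map f) = l.flatMap fun i => .cons :: (f i).enc := List.flatMap_map ..

theorem atomsText_map {ι : Type} (l : List ι) (f : ι → CQ) :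
    atomsText (l.map f) = l.flatMap fun i => .inter :: (f i).enc := List.flatMap_map ..

theorem atomsText_cons (a : CQ) (l : List CQ) :
    atomsText (a :: l) = .inter :: (a.enc ++ atomsText l) := rfl

theorem enc_mk_cons (a : ℕ) (l : List ℕ) : Name.enc (mk (a :: l)) =
    List.replicate a (Sym.bit true) ++ Sym.bit false :: Name.enc (mk l) := by
  simp [Name.enc, mk_cons]

section Prints

variable {α : Type} {I : Set (Fin 2)}

theorem prints_succ {t : ℕ → (Fin 2 → ℕ) → ℕ}
    (h : Prints α I fun N e => List.replicate (t N e) (Sym.bit true)) :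
    Prints α I fun N e => List.replicate (t N e + 1) (Sym.bit true) := by
  simpa only [List.replicate_succ] using h.cons _

/-- Names are unary precisely so that a number held on a stack can be copied into them. -/
theorem prints_name {t : ℕ → (Fin 2 → ℕ) → ℕ} {l : ℕ → (Fin 2 → ℕ) → List ℕ}
    (h : Prints α I fun N e => List.replicate (t N e) (Sym.bit true))
    (h' : Prints α I fun N e => Name.enc (mk (l N e))) :
    Prints α I fun N e => Name.enc (mk (t N e :: l N e)) := by
  simpa only [enc_mk_cons] using h.append (h'.cons _)

theorem prints_body {a : ℕ → (Fin 2 → ℕ) → List ℕ} {l : ℕ → (Fin 2 → ℕ) → List (List ℕ)}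
    (h : Prints α I fun N e => Name.enc (mk (a N e)))
    (h' : Prints α I fun N e => (clauseBody (l N e)).enc) :
    Prints α I fun N e => (clauseBody (a N e :: l N e)).enc := by
  simpa only [clauseBody, cn, Concept.enc] using ((h.cons _).append h').cons _

theorem prints_head {a : ℕ → (Fin 2 → ℕ) → List ℕ} {l : ℕ → (Fin 2 → ℕ) → List (List ℕ)}
    (h : Prints α I fun N e => Name.enc (mk (a N e)))
    (h' : Prints α I fun N e => (clauseHead (l N e)).enc) :
    Prints α I fun N e => (clauseHead (a N e :: l N e)).enc := by
  simpa only [clauseHead, cn, Concept.enc] using ((((h.cons _).cons _).append (h'.cons _)).cons _).cons _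

theorem prints_clause {b h : ℕ → (Fin 2 → ℕ) → List (List ℕ)}
    {l : ℕ → (Fin 2 → ℕ) → List Clause}
    (hb : Prints α I fun N e => (clauseBody (b N e)).enc)
    (hh : Prints α I fun N e => (clauseHead (h N e)).enc)
    (hl : Prints α I fun N e => clausesText (l N e)) :
    Prints α I fun N e => clausesText ((b N e, h N e) :: l N e) := by
  simpa only [clausesText, clauseAxiom, TAxiom.enc, List.flatMap_cons] using
    (((hb.append hh).cons _).cons _).append hl

theorem prints_succClauses {t : ℕ → (Fin 2 → ℕ) → ℕ} {a c b : ℕ → (Fin 2 → ℕ) → ℕ → List ℕ}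
    (ha : Prints α I fun N e => Name.enc (mk (a N e (t N e))))
    (hc : Prints α I fun N e => Name.enc (mk (c N e (t N e))))
    (hc' : Prints α I fun N e => Name.enc (mk (c N e (t N e + 1))))
    (hb : Prints α I fun N e => Name.enc (mk (b N e (t N e)))) :
    Prints α I fun N e => clausesText (succClauses (a N e) (c N e) (b N e) (t N e)) := by
  unfold succClauses
  -- Each lemma peels off one constructor of the text; what depends on neither `size` nor an index
  -- is closed by `Prints.const`.
  with_reducible repeat' first
    | exact Prints.const _ | assumption | apply prints_clause | apply prints_body
    | apply prints_head

theorem prints_copyClauses {κ : ℕ} {t : ℕ → (Fin 2 → ℕ) → ℕ} {a b : ℕ → (Fin 2 → ℕ) → ℕ → List ℕ}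
    (ht : Prints α I fun N e => List.replicate (t N e) (Sym.bit true))
    (ha : Prints α I fun N e => Name.enc (mk (a N e (t N e))))
    (hb : Prints α I fun N e => Name.enc (mk (b N e (t N e)))) :
    Prints α I fun N e => clausesText (copyClauses κ (a N e) (b N e) (t N e)) := by
  unfold copyClauses
  with_reducible repeat' first
    | exact Prints.const _ | assumption | apply prints_clause | apply prints_body
    | apply prints_head | apply prints_name

theorem prints_bitClauses : Prints α I fun _ e => clausesText (bitClauses (e 0)) := by
  have h := Prints.index (α := α) (I := I) (Sym.bit true) 0
  unfold bitClauses address carry sum chain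
  simp only [clausesText_append]
  with_reducible repeat' first
    | exact Prints.const _ | assumption | apply Prints.append | apply prints_clause
    | apply prints_body | apply prints_head | apply prints_name | apply prints_succ
    | apply prints_succClauses (t := fun _ e => e 0) | apply prints_copyClauses (t := fun _ e => e 0)

theorem prints_chainClauses : Prints α {1} fun N e => clausesText (chainClauses N (e 0)) := by
  have h₀ := fun I => Prints.index (α := α) (I := I) (Sym.bit true) 0
  have h₁ := fun I => Prints.index (α := α) (I := I) (Sym.bit true) 1
  have hN := fun I => Prints.size (α := α) (I := I) (Sym.bit true)
  unfold chainClauses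
  simp only [clausesText_append, clausesText_flatMap]
  refine Prints.append ?_ (Prints.loop_inner (Sym.bit true) (f := fun N s j =>
    clausesText (succClauses (chain s) (chainCarry s) (chain (s + 1)) j)) ?_)
  · unfold chainCarry
    with_reducible repeat' first
      | exact Prints.const _ | apply h₀ | apply hN | apply prints_clause | apply prints_body
      | apply prints_head | apply prints_name
  · unfold chain chainCarry
    with_reducible repeat' first
      | exact Prints.const _ | apply h₀ | apply h₁ | apply prints_name | apply prints_succ
      | apply prints_succClauses (t := fun _ e => e 1)

/-- Tiles and symbols do not depend on the input, so clauses ranging over them are finitely many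
fixed texts, possibly with `N` inserted; only levels and chain steps need loops. -/
theorem prints_generalClauses (code : Option α → ℕ) (nxt : ℕ → ℕ → ℕ → List ℕ)
    (ini : Option α → Bool → List ℕ) (os : List (Option α)) (R : ℕ) :
    Prints α Set.univ fun N _ => clausesText (generalClauses code nxt ini os R N) := by
  have hN := fun I => Prints.size (α := α) (I := I) (Sym.bit true)
  unfold generalClauses
  simp only [clausesText_append, clausesText_flatMap]
  refine (Prints.loop_outer (Sym.bit true) (f := fun _ j => clausesText (bitClauses j))
    prints_bitClauses).append ((Prints.loop_outer (Sym.bit true) (f := fun N s =>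
    clausesText (chainClauses N s)) prints_chainClauses).append (Prints.append ?_
    ((Prints.const _).append (Prints.append ?_ ?_))))
  · unfold choiceClauses carry
    with_reducible repeat' first
      | exact Prints.const _ | apply hN | apply prints_clause | apply prints_body
      | apply prints_head | apply prints_name
  · refine Prints.flatMap _ fun τ => ?_
    unfold tileClauses carry
    with_reducible repeat' first
      | exact Prints.const _ | apply hN | apply prints_clause | apply prints_body
      | apply prints_head | apply prints_name
  · refine Prints.flatMap _ fun o => ?_
    unfold initClauses carry
    with_reducible repeat' first
      | exact Prints.const _ | apply hN | apply prints_clause | apply prints_body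
      | apply prints_head | apply prints_name

theorem prints_letterClauses (code : Option α → ℕ) (a : α) :
    Prints α I fun N _ => clausesText (letterClauses code N a) := by
  have hN := fun I => Prints.size (α := α) (I := I) (Sym.bit true)
  unfold letterClauses
  with_reducible repeat' first
    | exact Prints.const _ | apply hN | apply prints_clause | apply prints_body
    | apply prints_head | apply prints_name | apply prints_succ

theorem prints_lastClause (code : Option α → ℕ) :
    Prints α I fun N _ => clausesText [([[14, N], [15, code none]], [])] := by
  have hN := fun I => Prints.size (α := α) (I := I) (Sym.bit true)
  with_reducible repeat' first
    | exact Prints.const _ | apply hN | apply prints_clause | apply prints_body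
    | apply prints_head | apply prints_name

theorem prints_levelAxioms : Prints α I fun _ e => axiomsText (levelAxioms (e 0)) := by
  have h := Prints.index (α := α) (I := I) (Sym.bit true) 0
  simp only [levelAxioms, axiomsText, List.flatMap_cons, List.flatMap_nil, TAxiom.enc, splitAxiom,
    inheritAxiom, Concept.enc, cn, edge, SRole.enc]
  with_reducible repeat' first
    | exact Prints.const _ | assumption | apply Prints.append | apply Prints.cons
    | apply prints_name | apply prints_succ

theorem prints_leafAxiom (τ : List ℕ) : Prints α I fun N _ => (leafAxiom N τ).enc := by
  have hN := fun I => Prints.size (α := α) (I := I) (Sym.bit true)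
  simp only [TAxiom.enc, leafAxiom, Concept.enc, cn, edge, SRole.enc]
  with_reducible repeat' first
    | exact Prints.const _ | apply hN | apply Prints.append | apply Prints.cons | apply prints_name

theorem prints_bitAxioms (f : ℕ) :
    Prints α I fun _ e => axiomsText [oneAxiom f (e 0), zeroAxiom f (e 0)] := by
  have h := Prints.index (α := α) (I := I) (Sym.bit true) 0
  simp only [axiomsText, List.flatMap_cons, List.flatMap_nil, TAxiom.enc, oneAxiom, zeroAxiom,
    Concept.enc, cn, edge, bitRole, SRole.enc]
  with_reducible repeat' first
    | exact Prints.const _ | assumption | apply Prints.append | apply Prints.cons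
    | apply prints_name

/-- The function `t` covers both uses: address bits, numbered by the outer index, and tile bits,
numbered by a constant. -/
theorem prints_legAtoms (f b c : ℕ) {t : ℕ → ℕ}
    (ht : ∀ I, Prints α I fun _ e => List.replicate (t (e 0)) (Sym.bit true)) :
    Prints α {1} fun N e => atomsText (legAtoms N f (t (e 0)) b c) := by
  have h₁ := fun I => Prints.index (α := α) (I := I) (Sym.bit true) 1
  have hN := fun I => Prints.size (α := α) (I := I) (Sym.bit true)
  simp only [legAtoms, atomsText_cons, atomsText_map]
  refine Prints.cons _ (Prints.append ?_ (Prints.cons _ (Prints.append ?_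
    (Prints.loop_inner (Sym.bit true) (f := fun N i l => .inter ::
      (edgeAtom (vr [3, f, t i, b, c, l]) (vr [3, f, t i, b, c, l + 1])).enc) ?_))))
  all_goals
    simp only [edgeAtom, bitAtom, vr, CQ.enc, Term.enc]
    with_reducible repeat' first
      | exact Prints.const _ | apply ht | apply h₁ | apply hN | apply Prints.append
      | apply Prints.cons | apply prints_name | apply prints_succ

theorem prints_compareAtoms (f : ℕ) {t : ℕ → ℕ}
    (ht : ∀ I, Prints α I fun _ e => List.replicate (t (e 0)) (Sym.bit true)) :
    Prints α {1} fun N e => atomsText (compareAtoms N f (t (e 0))) := by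
  have hN := fun I => Prints.size (α := α) (I := I) (Sym.bit true)
  simp only [compareAtoms, atomsText_append]
  refine Prints.append ?_ ((prints_legAtoms f 0 0 ht).append ((prints_legAtoms f 0 1 ht).append
    ((prints_legAtoms f 1 0 ht).append (prints_legAtoms f 1 1 ht))))
  simp only [markAtoms, atomsText, List.flatMap_cons, List.flatMap_nil, bitAtom, vr, CQ.enc,
    Term.enc]
  with_reducible repeat' first
    | exact Prints.const _ | apply ht | apply hN | apply Prints.append | apply Prints.cons
    | apply prints_name

theorem prints_query (R : ℕ) : Prints α Set.univ fun N _ => (query N (bits R N)).enc := by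
  have h₀ := fun I => Prints.index (α := α) (I := I) (Sym.bit true) 0
  have hN := fun I => Prints.size (α := α) (I := I) (Sym.bit true)
  simp only [query, conjunction_enc, pathAtoms, bits, atomsText_append, atomsText_cons,
    atomsText_map, atomsText_flatMap, List.flatMap_append, List.flatMap_assoc, List.flatMap_map,
    List.flatMap_cons, List.flatMap_nil, List.append_nil]
  refine Prints.append (Prints.append ?_ (Prints.append ?_ ?_)) ?_
  · refine Prints.cons _ (Prints.append (Prints.const _) (Prints.loop_outer (Sym.bit true)
      (f := fun N l => .inter :: (edgeAtom (vr [0, l]) (vr [0, l + 1])).enc) ?_))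
    simp only [edgeAtom, vr, CQ.enc, Term.enc]
    with_reducible repeat' first
      | exact Prints.const _ | apply h₀ | apply Prints.append | apply Prints.cons
      | apply prints_name | apply prints_succ
  · exact Prints.loop_outer (Sym.bit true) (f := fun N j => atomsText (compareAtoms N 0 j) ++
      atomsText (compareAtoms N 1 j))
      ((prints_compareAtoms 0 (t := id) h₀).append (prints_compareAtoms 1 (t := id) h₀))
  · exact Prints.flatMap _ fun ρ => (prints_compareAtoms 2 (t := fun _ => ρ) fun _ =>
      Prints.const _).mono (Set.subset_univ _)
  · simp only [vr, CQ.enc, Term.enc]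
    with_reducible repeat' first
      | exact Prints.const _ | apply hN | apply Prints.append | apply Prints.cons
      | apply prints_name

theorem prints_tail (code : Option α → ℕ) (nxt : ℕ → ℕ → ℕ → List ℕ)
    (ini : Option α → Bool → List ℕ) (os : List (Option α)) (R : ℕ) :
    Prints α Set.univ fun N _ => clausesText (generalClauses code nxt ini os R N) ++
      (axiomsText ((List.range N).flatMap levelAxioms) ++ (axiomsText ((types R).map (leafAxiom N)) ++
        (axiomsText ((bits R N).flatMap fun p => [oneAxiom p.1 p.2, zeroAxiom p.1 p.2]) ++
          (axiomsText [loopAxiom] ++ (.nil :: (query N (bits R N)).enc))))) := by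
  refine (prints_generalClauses code nxt ini os R).append (Prints.append ?_ (Prints.append ?_
    (Prints.append ?_ ((Prints.const _).append ((prints_query R).cons _)))))
  · simp only [axiomsText_flatMap]
    exact Prints.loop_outer (Sym.bit true) (f := fun _ j => axiomsText (levelAxioms j))
      prints_levelAxioms
  · simp only [axiomsText_map]
    exact Prints.flatMap _ fun τ => (prints_leafAxiom τ).cons _
  · simp only [bits, List.flatMap_append, axiomsText_append, axiomsText_flatMap,
      List.flatMap_assoc, List.flatMap_cons, List.flatMap_nil, List.append_nil]
    exact (Prints.loop_outer (Sym.bit true) (f := fun _ j =>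
      axiomsText [oneAxiom 0 j, zeroAxiom 0 j] ++ axiomsText [oneAxiom 1 j, zeroAxiom 1 j])
      ((prints_bitAxioms 0).append (prints_bitAxioms 1))).append (Prints.const _)

/-- The clauses for the word come first in the knowledge base, so that the text has the shape
demanded by `computable_of_prints`. -/
theorem encInput_wordKB (code : Option α → ℕ) (nxt : ℕ → ℕ → ℕ → List ℕ)
    (ini : Option α → Bool → List ℕ) (os : List (Option α)) (R N : ℕ) (w : List α) :
    encInput (wordKB code nxt ini os R N w) (query N (bits R N)) =
      listEnc AAxiom.enc [.concept (mk [0, 0]) (mk [])] ++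
        ((w.zipIdx.flatMap fun p => clausesText (letterClauses code p.2 p.1)) ++
          (clausesText [([[14, w.length], [15, code none]], [])] ++
            (clausesText (generalClauses code nxt ini os R N) ++
      (axiomsText ((List.range N).flatMap levelAxioms) ++ (axiomsText ((types R).map (leafAxiom N)) ++
        (axiomsText ((bits R N).flatMap fun p => [oneAxiom p.1 p.2, zeroAxiom p.1 p.2]) ++
          (axiomsText [loopAxiom] ++ (.nil :: (query N (bits R N)).enc)))))))) := by
  have h : ∀ l, listEnc TAxiom.enc l = axiomsText l ++ [.nil] := listEnc_eq _
  simp only [encInput, wordKB, kb, h, List.map_append, axiomsText_append,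
    axiomsText_map_clauseAxiom, wordClauses, clausesText_flatMap]
  simp only [List.append_assoc, List.cons_append, List.nil_append]

/-- The reduction is computable in polynomial time. -/
theorem computable_encInput [Fintype α] (code : Option α → ℕ) (nxt : ℕ → ℕ → ℕ → List ℕ)
    (ini : Option α → Bool → List ℕ) (os : List (Option α)) (R C d : ℕ) :
    Nonempty (Turing.TM2ComputableInPolyTime (id : List α → List α) (id : List Sym → List Sym)
      fun w => encInput (wordKB code nxt ini os R (C * (w.length + 1) ^ d) w)
        (query (C * (w.length + 1) ^ d) (bits R (C * (w.length + 1) ^ d)))) := by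
  simp only [encInput_wordKB]
  exact computable_of_prints (Sym.bit true) _ (g := fun a N => clausesText (letterClauses code N a))
    (h := fun N => clausesText [([[14, N], [15, code none]], [])])
    (prints_letterClauses code) (prints_lastClause code) (prints_tail code nxt ini os R) C d

end Prints

-- Correctness of the reduction and hardness.

theorem exists_eval_le (p : Polynomial ℕ) : ∃ C d, ∀ n, p.eval n ≤ C * (n + 1) ^ d := by
  induction p using Polynomial.induction_on' with
  | add p q hp hq =>
    obtain ⟨C, d, hp⟩ := hp
    obtain ⟨C', d', hq⟩ := hq
    refine ⟨C + C', d + d', fun n => ?_⟩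
    have h₁ : (n + 1) ^ d ≤ (n + 1) ^ (d + d') := Nat.pow_le_pow_right (by omega) (by omega)
    have h₂ : (n + 1) ^ d' ≤ (n + 1) ^ (d + d') := Nat.pow_le_pow_right (by omega) (by omega)
    rw [Polynomial.eval_add, add_mul]
    exact Nat.add_le_add ((hp n).trans (Nat.mul_le_mul_left _ h₁))
      ((hq n).trans (Nat.mul_le_mul_left _ h₂))
  | monomial d C =>
    refine ⟨C, d, fun n => ?_⟩
    rw [Polynomial.eval_monomial]
    exact Nat.mul_le_mul_left _ (Nat.pow_le_pow_left (by omega) _)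

theorem encInput_mem_iff {IsKB : KB → Prop} {K : KB} {q : CQ} (hK : IsKB K) (hq : q.IsRooted) :
    encInput K q ∈ RootedCQEntailment IsKB ↔ K.Entails q := by
  constructor
  · rintro ⟨K', q', e, -, -, h⟩
    obtain ⟨rfl, rfl⟩ := encInput_inj _ _ _ _ e
    exact h
  · exact fun h => ⟨K, q, rfl, hK, hq, h⟩

/-- Since the produced knowledge bases are in ALCSelf, hardness passes to every class of knowledge
bases that contains this fragment. -/
theorem coNExpTimeHard {IsKB : KB → Prop} (hKB : ∀ K : KB, K.IsALCSelf → IsKB K) :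
    CoNExpTimeHard (RootedCQEntailment IsKB) := by
  rintro α _ L ⟨p, M, hbound, hacc⟩
  obtain ⟨R, nxt, ini, hR, hnxt, hini, htile⟩ := M.exists_codes
  -- The summand `.X` makes room for the word among the `N` recognised positions; the summand `2`
  -- gives at least four cells per row and `2 ^ p n + 1 < 2 ^ N`.
  obtain ⟨C, d, hC⟩ := exists_eval_le (p + .X + 2)
  let code : Option α → ℕ := fun o => (Fintype.equivFin (Option α) o : ℕ)
  have hcode : Function.Injective code :=
    Fin.val_injective.comp (Fintype.equivFin (Option α)).injective
  refine ⟨_, computable_encInput code nxt ini Finset.univ.toList R C d, fun w => ?_⟩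
  set N := C * (w.length + 1) ^ d with hN
  have hle : p.eval w.length + w.length + 2 ≤ N := by simpa using hC w.length
  have h4 : 4 ≤ 2 ^ N := (Nat.pow_le_pow_right (n := 2) (by omega) (by omega : 2 ≤ N))
  have hB : 2 ^ p.eval w.length + 1 < 2 ^ N := by
    have h₁ : 2 ^ (p.eval w.length + 1) < 2 ^ N := Nat.pow_lt_pow_right (by omega) (by omega)
    have h₂ := Nat.one_le_two_pow (n := p.eval w.length)
    rw [pow_succ] at h₁
    omega
  have hbits : bits R N ≠ [] := by
    intro h
    have := congrArg List.length h
    simp [bits] at this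
    omega
  rw [encInput_mem_iff (K := wordKB ..) (hKB _ (kb_isALCSelf _ _ _ _)) (query_isRooted N hbits),
    entails_iff_no_tiling hcode (by omega) (by omega) hR (by simp) hnxt hini, htile]
  have hw : w ∉ L ↔ ∃ n c, M.Reaches n (M.init w) c ∧ c.state = M.accept := hacc w
  rw [← not_iff_not, not_not, hw]
  constructor
  · rintro ⟨n, c, h, hc⟩
    exact NTM.exists_trace_of_accepts h4 h hc
  · rintro ⟨Y, hY⟩
    exact NTM.accepts_of_trace h4 hB (hbound w) hY

end DL.Reduction

theorem mainTheorem5 :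
    CoNExpTimeHard (DL.RootedCQEntailment DL.KB.IsALCSelf) ∧
      CoNExpTimeHard (DL.RootedCQEntailment DL.KB.IsZIQ) :=
  ⟨DL.Reduction.coNExpTimeHard fun _ h => h, DL.Reduction.coNExpTimeHard fun _ h => h.isZIQ⟩
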